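/- Let $R$ be a commutative ring, let $(r_1,\dots,r_n)$ be a regular sequence in $R$ (each $r_i$ is a non-zero-divisor on $R/(r_1,\dots,r_{i-1})$; $R/(r_1,\dots,r_n)$ may be zero), let $I=(r_1,\dots,r_n)$ and $S=R/I$. Let $U$ be a free $R$-module with basis $e_1,\dots,e_n$ and $W$ a free $S$-module with basis $f_1,\dots,f_n$. Tor is computed with projective resolutions of the second variable. For $s\ge 0$ let $$\delta^s\colon \mathrm{Tor}^R_*(S,I^s/I^{s+1})\to \mathrm{Tor}^R_{*-1}(S,I^{s+1}/I^{s+2})$$ be the connecting homomorphism (zero on $\mathrm{Tor}_0$) of $0\to I^{s+1}/I^{s+2}\to I^s/I^{s+2}\to I^s/I^{s+1}\to 0$, let $\delta^*=\bigoplus_s\delta^s$ be their sum, an endomorphism of $\bigoplus_{s}\mathrm{Tor}^R_*(S,I^s/I^{s+1})\cong \mathrm{Tor}^R_*(S,\mathrm{gr}_I(R))$, and let $\eta\colon S\cong \mathrm{Tor}^R_0(S,R)\to \mathrm{Tor}^R_0(S,S)\subseteq\mathrm{Tor}^R_*(S,S)$ be induced by the projection $R\to S$. Then the following hold. 1. The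 Koszul complex $K(r_1,\dots,r_n)=\Lambda^R_*(U)$, with its augmentation to $S$, is a projective resolution of $S$. Write $\kappa(x)\in \mathrm{Tor}^R_p(S,S)$ for the class of the cycle $1\otimes x$ of $S\otimes_R\Lambda^R_*(U)$, for $x\in\Lambda_p^R(U)$. 2. There is an isomorphism of graded algebras $\varphi\colon \mathrm{gr}_I(R)=\bigoplus_s I^s/I^{s+1}\cong \mathrm{Sym}_S^*(W)$ sending the class of $r_j$ in $I/I^2$ to $-f_j$. 3. There is an isomorphism of bigraded $S$-modules $$\psi\colon \bigoplus_{s\ge0}\mathrm{Tor}^R_*(S,I^s/I^{s+1})\;\cong\;\Lambda_*^{\mathrm{Sym}_S(W)}\bigl(\mathrm{Sym}_S(W)\otimes_R U\bigr)$$ such that $\psi(m_*\kappa(u_1\wedge\dots\wedge u_p))=\varphi(m)\cdot(1\otimes u_1)\wedge\dots\wedge(1\otimes u_p)$ for all $m\in I^s/I^{s+1}$ and $u_1,\dots,u_p\in U$, where $m_*$ is induced by the $R$-linear map $S\to I^s/I^{s+1}$, $1\mapsto m$. 4. Under $\psi$ the endomorphism $\delta^*$ corresponds to the Koszul differential $d_*$,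 the $\mathrm{Sym}_S(W)$-linear graded derivation with $d_*(1\otimes e_j)=f_j$; and $\psi\circ\eta$ (with $S$ identified with $I^0/I^1$) is the inclusion of $S$ as the part of bidegree $(0,0)$. 5. The sequence of graded $S$-modules $$0\to S\xrightarrow{\ \eta\ }\mathrm{Tor}^R_*(S,S)\xrightarrow{\ \delta^0\ }\mathrm{Tor}^R_{*-1}(S,I/I^2)\xrightarrow{\ \delta^1\ }\mathrm{Tor}^R_{*-2}(S,I^2/I^3)\xrightarrow{\ \delta^2\ }\cdots$$ is exact. -/

import Mathlib

open CategoryTheory Limits TensorProduct DirectSum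

universe u v w

namespace CategoryTheory

section Horseshoe
variable {C : Type u} [Category.{v} C] [Abelian C]

/-- A short exact sequence of projective resolutions lying over the short complex `S`. -/
structure ResolvedSequence (S : ShortComplex C) where
  P₁ : ProjectiveResolution S.X₁
  P₂ : ProjectiveResolution S.X₂
  P₃ : ProjectiveResolution S.X₃
  f : P₁.complex ⟶ P₂.complex
  g : P₂.complex ⟶ P₃.complex
  comm_f : f ≫ P₂.π = P₁.π ≫ (ChainComplex.single₀ C).map S.f
  comm_g : g ≫ P₃.π = P₂.π ≫ (ChainComplex.single₀ C).map S.g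
  zero : f ≫ g = 0
  shortExact : (ShortComplex.mk f g zero).ShortExact

namespace Horseshoe

/-- The augmentation of a projective resolution. -/
noncomputable def aug {Z : C} (P : ProjectiveResolution Z) : P.complex.X 0 ⟶ Z := P.π.f 0

instance instEpiAug {Z : C} (P : ProjectiveResolution Z) : Epi (aug P) :=
  inferInstanceAs (Epi (P.π.f 0))

lemma d_aug {Z : C} (P : ProjectiveResolution Z) : P.complex.d 1 0 ≫ aug P = 0 :=
  P.complex_d_comp_π_f_zero

lemma aug_exact {Z : C} (P : ProjectiveResolution Z) :
    (ShortComplex.mk _ _ (d_aug P)).Exact := P.exact₀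

lemma exists_theta {S : ShortComplex C} (P : ProjectiveResolution S.X₁)
    (Q : ProjectiveResolution S.X₃) (γ : Q.complex.X 1 ⟶ S.X₁) (hγ : Q.complex.d 2 1 ≫ γ = 0) :
    ∃ θ : ∀ n, Q.complex.X (n + 1) ⟶ P.complex.X n,
    θ 0 ≫ aug P = -γ ∧
    ∀ n, θ (n + 1) ≫ P.complex.d (n + 1) n + Q.complex.d (n + 2) (n + 1) ≫ θ n = 0 := by
  let z : Q.complex.X 1 ⟶ P.complex.X 0 := Projective.factorThru (-γ) (aug P)
  have hz : z ≫ aug P = -γ := Projective.factorThru_comp _ _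
  let o : Q.complex.X 2 ⟶ P.complex.X 1 :=
    (aug_exact P).liftFromProjective (-Q.complex.d 2 1 ≫ z) (by simp [hz, hγ])
  have ho : o ≫ P.complex.d 1 0 = -Q.complex.d 2 1 ≫ z :=
    (aug_exact P).liftFromProjective_comp _ _
  -- The resolution of `S.X₃` shifted down by one, with the negative differential.
  let T : ChainComplex C ℕ :=
    ChainComplex.of (fun n => Q.complex.X (n + 1)) (fun n => -Q.complex.d (n + 2) (n + 1))
      (fun n => by simp)
  have hT (n : ℕ) : T.d (n + 1) n = -Q.complex.d (n + 2) (n + 1) :=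
    ChainComplex.of_d (fun n => Q.complex.X (n + 1)) (fun n => -Q.complex.d (n + 2) (n + 1)) n
  have hp (n : ℕ) : Projective (T.X n) := Q.projective (n + 1)
  let F : T ⟶ P.complex := ChainComplex.mkHom _ _ z o
    (by rw [hT]; simpa using ho)
    (fun n p => ⟨(P.exact_succ n).liftFromProjective
      (T.d (n + 2) (n + 1) ≫ p.2.1) (by
        change (T.d (n + 2) (n + 1) ≫ p.2.1) ≫ P.complex.d (n + 1) n = 0
        rw [Category.assoc, p.2.2]; simp),
      (P.exact_succ n).liftFromProjective_comp _ _⟩)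
  refine ⟨fun n => F.f n, hz, fun n => ?_⟩
  have := F.comm (n + 1) n
  rw [hT] at this
  change F.f (n + 1) ≫ P.complex.d (n + 1) n + _ = 0
  rw [this]
  change (-Q.complex.d (n + 2) (n + 1)) ≫ F.f n + _ = 0
  simp

lemma homology_isZero {Z : C} (P : ProjectiveResolution Z) (n : ℕ) :
    IsZero (P.complex.homology (n + 1)) :=
  (HomologicalComplex.exactAt_iff_isZero_homology _ _).1 (P.complex_exactAt_succ n)

end Horseshoe

open Horseshoe in
/-- The horseshoe lemma. -/
lemma exists_resolvedSequence [EnoughProjectives C] {S : ShortComplex C} (hS : S.ShortExact) :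
    Nonempty (ResolvedSequence S) := by
  have := hS.epi_g
  have := hS.mono_f
  let P := projectiveResolution S.X₁
  let Q := projectiveResolution S.X₃
  let lam : Q.complex.X 0 ⟶ S.X₂ := Projective.factorThru (aug Q) S.g
  have hlam : lam ≫ S.g = aug Q := Projective.factorThru_comp _ _
  let γ : Q.complex.X 1 ⟶ S.X₁ := hS.exact.lift (Q.complex.d 1 0 ≫ lam)
    (by rw [Category.assoc, hlam, d_aug])
  have hγf : γ ≫ S.f = Q.complex.d 1 0 ≫ lam := hS.exact.lift_f _ _
  have hγ : Q.complex.d 2 1 ≫ γ = 0 := by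
    rw [← cancel_mono S.f, Category.assoc, hγf]; simp
  obtain ⟨θ, hθ0, hθ⟩ := exists_theta P Q γ hγ
  let dM (n : ℕ) : P.complex.X (n + 1) ⊞ Q.complex.X (n + 1) ⟶ P.complex.X n ⊞ Q.complex.X n :=
    biprod.desc (P.complex.d (n + 1) n ≫ biprod.inl)
      (θ n ≫ biprod.inl + Q.complex.d (n + 1) n ≫ biprod.inr)
  have hdM (n : ℕ) : dM (n + 1) ≫ dM n = 0 := by
    apply biprod.hom_ext'
    · simp [dM]
    · have := hθ n
      simp only [dM, biprod.inr_desc_assoc, comp_zero, Preadditive.add_comp, Category.assoc,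
        biprod.inl_desc, biprod.inr_desc, Preadditive.comp_add]
      rw [HomologicalComplex.d_comp_d_assoc, zero_comp, add_zero, ← Category.assoc,
        ← Category.assoc, ← Preadditive.add_comp, this, zero_comp]
  let M : ChainComplex C ℕ := ChainComplex.of (fun n => P.complex.X n ⊞ Q.complex.X n) dM hdM
  have hM (n : ℕ) : M.d (n + 1) n = dM n :=
    ChainComplex.of_d (fun n => P.complex.X n ⊞ Q.complex.X n) dM n
  let εM : M.X 0 ⟶ S.X₂ := biprod.desc (aug P ≫ S.f) lam
  have hεM : M.d 1 0 ≫ εM = 0 := by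
    rw [hM]
    apply biprod.hom_ext'
    · simp only [dM, εM, biprod.inl_desc_assoc, Category.assoc, biprod.inl_desc, comp_zero]
      rw [← Category.assoc, d_aug, zero_comp]
    · simp only [dM, εM, biprod.inr_desc_assoc, Category.assoc, biprod.inl_desc, comp_zero,
        Preadditive.add_comp, biprod.inr_desc]
      rw [← Category.assoc, hθ0, ← hγf]; simp
  let f : P.complex ⟶ M := ChainComplex.ofHom (fun n => biprod.inl) (fun n => by
    rw [hM]; simp [dM])
  let g : M ⟶ Q.complex := ChainComplex.ofHom (fun n => biprod.snd) (fun n => by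
    rw [hM]
    apply biprod.hom_ext' <;> simp [dM])
  have hfg : f ≫ g = 0 := by
    ext n
    exact biprod.inl_snd
  have hse : (ShortComplex.mk f g hfg).ShortExact := by
    apply HomologicalComplex.shortExact_of_degreewise_shortExact
    intro n
    exact (ShortComplex.Splitting.ofHasBinaryBiproduct (P.complex.X n) (Q.complex.X n)).shortExact
  let πM : M ⟶ (ChainComplex.single₀ C).obj S.X₂ := (ChainComplex.toSingle₀Equiv M S.X₂).symm ⟨εM, hεM⟩
  have hπM : πM.f 0 = εM := ChainComplex.toSingle₀Equiv_symm_apply_f_zero _ _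
  have cf : f ≫ πM = P.π ≫ (ChainComplex.single₀ C).map S.f := by
    apply HomologicalComplex.to_single_hom_ext
    change biprod.inl ≫ πM.f 0 = P.π.f 0 ≫ ((ChainComplex.single₀ C).map S.f).f 0
    rw [hπM]
    change biprod.inl ≫ biprod.desc (aug P ≫ S.f) lam = aug P ≫ _
    rw [biprod.inl_desc, ChainComplex.single₀_map_f_zero]
  have cg : g ≫ Q.π = πM ≫ (ChainComplex.single₀ C).map S.g := by
    apply HomologicalComplex.to_single_hom_ext
    change biprod.snd ≫ Q.π.f 0 = πM.f 0 ≫ ((ChainComplex.single₀ C).map S.g).f 0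
    rw [hπM, ChainComplex.single₀_map_f_zero]
    change biprod.snd ≫ aug Q = biprod.desc (aug P ≫ S.f) lam ≫ S.g
    apply biprod.hom_ext'
    · simp
    · simp [hlam]
  have hq : QuasiIso πM := by
    rw [quasiIso_iff]
    rintro (_ | n)
    · rw [quasiIsoAt_iff_isIso_homologyMap]
      let S₁ : ShortComplex C := (ShortComplex.mk f g hfg).map
        (HomologicalComplex.homologyFunctor C _ 0)
      let S₂ : ShortComplex C := S.map ((ChainComplex.single₀ C) ⋙
        HomologicalComplex.homologyFunctor C _ 0)
      let φ : S₁ ⟶ S₂ :=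
        { τ₁ := HomologicalComplex.homologyMap P.π 0
          τ₂ := HomologicalComplex.homologyMap πM 0
          τ₃ := HomologicalComplex.homologyMap Q.π 0
          comm₁₂ := by
            change HomologicalComplex.homologyMap _ 0 ≫ HomologicalComplex.homologyMap _ 0 =
              HomologicalComplex.homologyMap _ 0 ≫ HomologicalComplex.homologyMap _ 0
            rw [← HomologicalComplex.homologyMap_comp, ← HomologicalComplex.homologyMap_comp, cf]
          comm₂₃ := by
            change HomologicalComplex.homologyMap _ 0 ≫ HomologicalComplex.homologyMap _ 0 =
              HomologicalComplex.homologyMap _ 0 ≫ HomologicalComplex.homologyMap _ 0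
            rw [← HomologicalComplex.homologyMap_comp, ← HomologicalComplex.homologyMap_comp, cg] }
      have h₁ : S₁.ShortExact :=
        { exact := hse.homology_exact₂ 0
          mono_f := (hse.homology_exact₁ 1 0 (by simp)).mono_g
            ((homology_isZero Q 0).eq_of_src _ _)
          epi_g := by
            have : ∀ n, Epi (g.f n) := fun n => inferInstanceAs (Epi (biprod.snd))
            exact HomologicalComplex.epi_homologyMap_of_epi_of_not_rel g 0 (by simp) }
      have h₂ : S₂.ShortExact :=
        ShortComplex.shortExact_of_iso (S.mapNatIso
          (HomologicalComplex.homologyFunctorSingleIso C (ComplexShape.down ℕ) 0).symm)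
          (show (S.map (𝟭 C)).ShortExact from hS)
      have i₁ : IsIso φ.τ₁ := inferInstanceAs (IsIso (HomologicalComplex.homologyMap P.π 0))
      have i₃ : IsIso φ.τ₃ := inferInstanceAs (IsIso (HomologicalComplex.homologyMap Q.π 0))
      exact ShortComplex.isIso₂_of_shortExact_of_isIso₁₃ φ h₁ h₂
    · rw [quasiIsoAt_iff_exactAt' _ _ (ChainComplex.exactAt_succ_single_obj _ _)]
      exact hse.exactAt_X₂ _ (P.complex_exactAt_succ n) (Q.complex_exactAt_succ n)
  exact ⟨{
    P₁ := P
    P₂ := { complex := M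
            projective := fun n => inferInstanceAs (Projective (P.complex.X n ⊞ Q.complex.X n))
            π := πM
            quasiIso := hq }
    P₃ := Q
    f := f
    g := g
    comm_f := cf
    comm_g := cg
    zero := hfg
    shortExact := hse }⟩

variable {D : Type w} [Category.{v} D] [Abelian D]

lemma ResolvedSequence.shortExact_map {S : ShortComplex C} (T : ResolvedSequence S) (F : C ⥤ D)
    [F.Additive] : ((ShortComplex.mk T.f T.g T.zero).map
      (F.mapHomologicalComplex (ComplexShape.down ℕ))).ShortExact := by
  apply HomologicalComplex.shortExact_of_degreewise_shortExact
  intro n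
  have h := T.shortExact.map_of_exact (HomologicalComplex.eval C (ComplexShape.down ℕ) n)
  have : Projective ((ShortComplex.mk T.f T.g T.zero).map
    (HomologicalComplex.eval C (ComplexShape.down ℕ) n)).X₃ := T.P₃.projective n
  exact (h.splittingOfProjective.map F).shortExact

/-- The connecting homomorphism `L_{n+1}F(S.X₃) ⟶ L_n F(S.X₁)` computed with a given short exact
sequence of projective resolutions: the snake-lemma map in homology, without further sign. -/
noncomputable def ResolvedSequence.δ [EnoughProjectives C] {S : ShortComplex C} (T : ResolvedSequence S) (F : C ⥤ D)
    [F.Additive] (n : ℕ) : (F.leftDerived (n + 1)).obj S.X₃ ⟶ (F.leftDerived n).obj S.X₁ :=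
  (T.P₃.isoLeftDerivedObj F (n + 1)).hom ≫ (T.shortExact_map F).δ (n + 1) n rfl ≫
    (T.P₁.isoLeftDerivedObj F n).inv

/-- The connecting homomorphism `L_{n+1}F(S.X₃) ⟶ L_n F(S.X₁)` of a left derived functor. -/
noncomputable def leftDerivedδ [EnoughProjectives C] (F : C ⥤ D) [F.Additive] {S : ShortComplex C} (hS : S.ShortExact)
    (n : ℕ) : (F.leftDerived (n + 1)).obj S.X₃ ⟶ (F.leftDerived n).obj S.X₁ :=
  (exists_resolvedSequence hS).some.δ F n

end Horseshoe
end CategoryTheory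

namespace KoszulTor

section Koszul
variable {A : Type*} {M : Type*} [CommRing A] [AddCommGroup M] [Module A M]

/-- The Koszul differential on the exterior algebra: the contraction with the linear form `ξ`, that
is, the unique antiderivation `d` with `d (a ∧ x) = ξ a • x - a ∧ d x` for `a` of degree one. -/
noncomputable def koszulD (ξ : M →ₗ[A] A) : ExteriorAlgebra A M →ₗ[A] ExteriorAlgebra A M :=
  CliffordAlgebra.contractLeft (Q := (0 : QuadraticForm A M)) ξ

lemma koszulD_ι_mul (ξ : M →ₗ[A] A) (a : M) (x : ExteriorAlgebra A M) :
    koszulD ξ (ExteriorAlgebra.ι A a * x) = ξ a • x - ExteriorAlgebra.ι A a * koszulD ξ x :=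
  CliffordAlgebra.contractLeft_ι_mul (Q := (0 : QuadraticForm A M)) ξ a x

lemma koszulD_algebraMap (ξ : M →ₗ[A] A) (a : A) :
    koszulD ξ (algebraMap A _ a) = 0 :=
  CliffordAlgebra.contractLeft_algebraMap (Q := (0 : QuadraticForm A M)) ξ a

lemma koszulD_koszulD (ξ : M →ₗ[A] A) (x : ExteriorAlgebra A M) :
    koszulD ξ (koszulD ξ x) = 0 :=
  CliffordAlgebra.contractLeft_contractLeft (Q := (0 : QuadraticForm A M)) ξ x

lemma koszulD_mem_smul (ξ : M →ₗ[A] A) (I : Ideal A) (hξ : ∀ m, ξ m ∈ I) (p : ℕ) :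
    ∀ x ∈ ⋀[A]^(p + 1) M, koszulD ξ x ∈ I • (⋀[A]^p M) := by
  induction p with
  | zero =>
    intro x hx
    change x ∈ LinearMap.range (ExteriorAlgebra.ι A : M →ₗ[A] ExteriorAlgebra A M) ^ (0 + 1) at hx
    rw [zero_add, pow_one] at hx
    obtain ⟨a, rfl⟩ := hx
    have := koszulD_ι_mul ξ a 1
    rw [mul_one, ← map_one (algebraMap A (ExteriorAlgebra A M)), koszulD_algebraMap,
      mul_zero, sub_zero] at this
    rw [this]
    refine Submodule.smul_mem_smul (hξ a) ?_
    change _ ∈ LinearMap.range (ExteriorAlgebra.ι A : M →ₗ[A] ExteriorAlgebra A M) ^ 0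
    rw [pow_zero, map_one]
    exact Submodule.one_le.1 le_rfl
  | succ p ih =>
    intro x hx
    change x ∈ LinearMap.range (ExteriorAlgebra.ι A : M →ₗ[A] ExteriorAlgebra A M) ^ (p + 1 + 1) at hx
    rw [pow_succ'] at hx
    refine Submodule.mul_induction_on hx ?_ ?_
    · rintro _ ⟨a, rfl⟩ y hy
      rw [koszulD_ι_mul]
      refine sub_mem (Submodule.smul_mem_smul (hξ a) hy) ?_
      refine Submodule.smul_induction_on (ih y hy) ?_ ?_
      · intro c hc z hz
        rw [mul_smul_comm]
        refine Submodule.smul_mem_smul hc ?_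
        change _ ∈ LinearMap.range (ExteriorAlgebra.ι A : M →ₗ[A] ExteriorAlgebra A M) ^ (p + 1)
        rw [pow_succ']
        exact Submodule.mul_mem_mul ⟨a, rfl⟩ hz
      · intro z w hz hw
        rw [mul_add]
        exact add_mem hz hw
    · intro y z hy hz
      rw [map_add]
      exact add_mem hy hz

lemma koszulD_mem (ξ : M →ₗ[A] A) (p : ℕ) :
    ∀ x ∈ ⋀[A]^(p + 1) M, koszulD ξ x ∈ ⋀[A]^p M := fun x hx => by
  have := koszulD_mem_smul ξ ⊤ (fun _ => trivial) p x hx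
  rwa [Submodule.top_smul] at this

/-- The Koszul differential `⋀^{p+1} M → ⋀^p M`. -/
noncomputable def koszulDeg (ξ : M →ₗ[A] A) (p : ℕ) : ⋀[A]^(p + 1) M →ₗ[A] ⋀[A]^p M :=
  (koszulD ξ).restrict (koszulD_mem ξ p)

lemma koszulDeg_mem (ξ : M →ₗ[A] A) (I : Ideal A) (hξ : ∀ m, ξ m ∈ I) (p : ℕ)
    (x : ⋀[A]^(p + 1) M) : koszulDeg ξ p x ∈ I • (⊤ : Submodule A (⋀[A]^p M)) := by
  have h := koszulD_mem_smul ξ I hξ p x x.2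
  have e : Submodule.map (Submodule.subtype (⋀[A]^p M)) (I • ⊤) = I • (⋀[A]^p M) := by
    rw [Submodule.map_smul'', Submodule.map_top, Submodule.range_subtype]
  rw [← e] at h
  obtain ⟨y, hy, hyx⟩ := h
  have : y = koszulDeg ξ p x := Subtype.ext hyx
  exact this ▸ hy

end Koszul

section KoszulComplex
variable {R : Type u} [CommRing R] {U : Type u} [AddCommGroup U] [Module R U]

/-- The Koszul complex `⋯ → ⋀^2 U → ⋀^1 U → ⋀^0 U` of a linear form `ξ` on `U`. -/
noncomputable def koszulComplex (ξ : U →ₗ[R] R) : ChainComplex (ModuleCat.{u} R) ℕ :=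
  ChainComplex.of (fun p => ModuleCat.of R (⋀[R]^p U)) (fun p => ModuleCat.ofHom (koszulDeg ξ p))
    (fun p => by
      refine ModuleCat.hom_ext (LinearMap.ext fun x => Subtype.ext ?_)
      exact koszulD_koszulD ξ x.1)

lemma koszulComplex_d (ξ : U →ₗ[R] R) (p : ℕ) :
    (koszulComplex ξ).d (p + 1) p = ModuleCat.ofHom (koszulDeg ξ p) :=
  ChainComplex.of_d (fun p => ModuleCat.of R (⋀[R]^p U))
    (fun p => ModuleCat.ofHom (koszulDeg ξ p)) p

variable (ξ : U →ₗ[R] R) (I : Ideal R) (hξ : ∀ m, ξ m ∈ I)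

/-- The augmentation of the Koszul complex: in degree zero, `⋀^0 U = R → R ⧸ I`. -/
noncomputable def koszulAug : koszulComplex ξ ⟶
    (ChainComplex.single₀ (ModuleCat.{u} R)).obj (ModuleCat.of R (R ⧸ I)) :=
  (ChainComplex.toSingle₀Equiv _ _).symm
    ⟨ModuleCat.ofHom (I.mkQ ∘ₗ (exteriorPower.zeroEquiv R U).toLinearMap), by
      rw [koszulComplex_d]
      ext x
      have h := koszulDeg_mem ξ I hξ 0 x
      change Submodule.Quotient.mk (exteriorPower.zeroEquiv R U (koszulDeg ξ 0 x)) = 0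
      rw [Submodule.Quotient.mk_eq_zero]
      refine Submodule.smul_induction_on h ?_ ?_
      · intro c hc y _
        rw [map_smul]
        exact I.mul_mem_right _ hc
      · intro y z hy hz
        rw [map_add]
        exact add_mem hy hz⟩

end KoszulComplex

section gr
variable {R : Type u} [CommRing R] (I : Ideal R)

/-- The `R`-module `I^a / I^b`, for `a ≤ b`. -/
abbrev PowQuot (a b : ℕ) : Type u :=
  (I ^ a : Submodule R R) ⧸ (I ^ b : Submodule R R).submoduleOf (I ^ a)

/-- The component `I^s / I^{s+1}` of the associated graded ring of `R`. -/
abbrev Gr (s : ℕ) : Type u := PowQuot I s (s + 1)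

variable {I} in
/-- The residue class in `I^s / I^{s+1}` of an element of `I^s`. -/
def Gr.mk {s : ℕ} (x : R) (hx : x ∈ I ^ s) : Gr I s := Submodule.Quotient.mk ⟨x, hx⟩

lemma Gr.mk_eq {s : ℕ} {x y : R} (hx : x ∈ I ^ s) (hy : y ∈ I ^ s) :
    Gr.mk x hx = Gr.mk y hy ↔ x - y ∈ I ^ (s + 1) :=
  Submodule.Quotient.eq _

lemma Gr.ind {s : ℕ} {P : Gr I s → Prop} (h : ∀ x hx, P (Gr.mk x hx)) (m : Gr I s) : P m := by
  obtain ⟨⟨x, hx⟩, rfl⟩ := Submodule.Quotient.mk_surjective _ m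
  exact h x hx

variable {I}

lemma Gr.mul_mem {s t : ℕ} {x y : R} (hx : x ∈ I ^ s) (hy : y ∈ I ^ t) :
    x * y ∈ I ^ (s + t) := by
  rw [pow_add]; exact Ideal.mul_mem_mul hx hy

/-- The product `I^s/I^{s+1} × I^t/I^{t+1} → I^{s+t}/I^{s+t+1}` induced by that of `R`. -/
def Gr.mul {s t : ℕ} : Gr I s → Gr I t → Gr I (s + t) :=
  Quotient.map₂ (fun x y => ⟨x.1 * y.1, Gr.mul_mem x.2 y.2⟩) (by
    intro x x' hx y y' hy
    have hx' : x.1 - x'.1 ∈ I ^ (s + 1) :=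
      (Submodule.quotientRel_def ((I ^ (s + 1) : Submodule R R).submoduleOf (I ^ s))).1 hx
    have hy' : y.1 - y'.1 ∈ I ^ (t + 1) :=
      (Submodule.quotientRel_def ((I ^ (t + 1) : Submodule R R).submoduleOf (I ^ t))).1 hy
    refine (Submodule.quotientRel_def _).2 ?_
    change x.1 * y.1 - x'.1 * y'.1 ∈ I ^ (s + t + 1)
    have e : x.1 * y.1 - x'.1 * y'.1 = (x.1 - x'.1) * y.1 + x'.1 * (y.1 - y'.1) := by ring
    rw [e]
    have h2 : x'.1 * (y.1 - y'.1) ∈ I ^ (s + t + 1) := Gr.mul_mem (t := t + 1) x'.2 hy'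
    refine add_mem ?_ h2
    have := Gr.mul_mem hx' y.2
    rwa [add_right_comm] at this)

lemma Gr.mk_mul_mk {s t : ℕ} {x y : R} (hx : x ∈ I ^ s) (hy : y ∈ I ^ t) :
    Gr.mul (Gr.mk x hx) (Gr.mk y hy) = Gr.mk (x * y) (Gr.mul_mem hx hy) := rfl

lemma Gr.mk_add_mk {s : ℕ} {x y : R} (hx : x ∈ I ^ s) (hy : y ∈ I ^ s) :
    Gr.mk x hx + Gr.mk y hy = Gr.mk (x + y) (add_mem hx hy) := rfl

lemma Gr.smul_mk {s : ℕ} (r : R) {x : R} (hx : x ∈ I ^ s)  :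
    r • Gr.mk x hx = Gr.mk (r * x) (Ideal.mul_mem_left _ r hx) := rfl

lemma Gr.zero_eq (s : ℕ) : (0 : Gr I s) = Gr.mk 0 (zero_mem _) := rfl

lemma Gr.mem_zero (x : R) : x ∈ I ^ 0 := by simp

lemma Gr.sigma_eq {s t : ℕ} (h : s = t) {x y : R} (hx : x ∈ I ^ s) (hy : y ∈ I ^ t) (hxy : x = y) :
    GradedMonoid.mk (A := Gr I) s (Gr.mk x hx) = GradedMonoid.mk t (Gr.mk y hy) := by
  subst h; subst hxy; rfl

instance instGMulGr : GradedMonoid.GMul (Gr I) := ⟨Gr.mul⟩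

instance instGOneGr : GradedMonoid.GOne (Gr I) := ⟨Gr.mk 1 (Gr.mem_zero 1)⟩

instance instGMonoidGr : GradedMonoid.GMonoid (Gr I) where
  one_mul a := by
    obtain ⟨s, a⟩ := a
    induction a using Gr.ind
    exact Gr.sigma_eq (zero_add s) _ _ (one_mul _)
  mul_one a := by
    obtain ⟨s, a⟩ := a
    induction a using Gr.ind
    exact Gr.sigma_eq (add_zero s) _ _ (mul_one _)
  mul_assoc a b c := by
    obtain ⟨s, a⟩ := a
    obtain ⟨t, b⟩ := b
    obtain ⟨r, c⟩ := c
    induction a using Gr.ind; induction b using Gr.ind; induction c using Gr.ind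
    exact Gr.sigma_eq (add_assoc s t r) _ _ (mul_assoc _ _ _)
instance instGCommRingGr : DirectSum.GCommRing (Gr I) where
  mul_zero a := by
    induction a using Gr.ind
    change Gr.mul _ (Gr.mk 0 (zero_mem _)) = Gr.mk 0 (zero_mem _)
    rw [Gr.mk_mul_mk, Gr.mk_eq]; simp
  zero_mul a := by
    induction a using Gr.ind
    change Gr.mul (Gr.mk 0 (zero_mem _)) _ = Gr.mk 0 (zero_mem _)
    rw [Gr.mk_mul_mk, Gr.mk_eq]; simp
  mul_add a b c := by
    induction a using Gr.ind; induction b using Gr.ind; induction c using Gr.ind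
    change Gr.mul _ (_ + _) = Gr.mul _ _ + Gr.mul _ _
    simp only [Gr.mk_mul_mk, Gr.mk_add_mk, mul_add]
  add_mul a b c := by
    induction a using Gr.ind; induction b using Gr.ind; induction c using Gr.ind
    change Gr.mul (_ + _) _ = Gr.mul _ _ + Gr.mul _ _
    simp only [Gr.mk_mul_mk, Gr.mk_add_mk, add_mul]
  mul_comm a b := by
    obtain ⟨s, a⟩ := a
    obtain ⟨t, b⟩ := b
    induction a using Gr.ind; induction b using Gr.ind
    exact Gr.sigma_eq (add_comm s t) _ _ (mul_comm _ _)
  natCast n := Gr.mk (n : R) (Gr.mem_zero _)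
  natCast_zero := by rw [Gr.zero_eq, Gr.mk_eq]; simp
  natCast_succ n := by
    change _ = Gr.mk _ _ + Gr.mk _ _
    rw [Gr.mk_add_mk, Gr.mk_eq]; simp
  intCast n := Gr.mk (n : R) (Gr.mem_zero _)
  intCast_ofNat n := by rw [Gr.mk_eq]; simp
  intCast_negSucc_ofNat n := by
    change _ = Gr.mk (-((n + 1 : ℕ) : R)) _
    rw [Gr.mk_eq]; simp

instance instGAlgebraGr : DirectSum.GAlgebra R (Gr I) where
  toFun :=
    { toFun := fun r => Gr.mk r (Gr.mem_zero r)
      map_zero' := rfl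
      map_add' := fun _ _ => rfl }
  map_one := rfl
  map_mul r s := Gr.sigma_eq (add_zero 0).symm (Gr.mem_zero (r * s))
    (Gr.mul_mem (Gr.mem_zero r) (Gr.mem_zero s)) rfl
  commutes r a := by
    obtain ⟨s, a⟩ := a
    induction a using Gr.ind
    exact Gr.sigma_eq (add_comm 0 s) (Gr.mul_mem (Gr.mem_zero r) ‹_›)
      (Gr.mul_mem ‹_› (Gr.mem_zero r)) (mul_comm _ _)
  smul_def r a := by
    obtain ⟨s, a⟩ := a
    induction a using Gr.ind
    exact Gr.sigma_eq (zero_add s).symm (Ideal.mul_mem_left _ r ‹_›)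
      (Gr.mul_mem (Gr.mem_zero r) ‹_›) rfl

lemma Gr.ideal_smul {s : ℕ} (r : R) (hr : r ∈ I) (m : Gr I s) : r • m = 0 := by
  induction m using Gr.ind with | h x hx
  rw [Gr.smul_mk, Gr.zero_eq, Gr.mk_eq, sub_zero, pow_succ']
  exact Ideal.mul_mem_mul hr hx

/-- The `R`-linear map `R/I → I^s/I^{s+1}` sending `1` to `m`. -/
noncomputable def Gr.act {s : ℕ} (m : Gr I s) : (R ⧸ I) →ₗ[R] Gr I s :=
  Submodule.liftQ I (LinearMap.toSpanSingleton R _ m) (fun r hr => Gr.ideal_smul r hr m)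


variable (I)
/-- The canonical injection `I^{s+1}/I^{s+2} → I^s/I^{s+2}`. -/
def powMid (s : ℕ) : PowQuot I (s + 1) (s + 2) →ₗ[R] PowQuot I s (s + 2) :=
  Submodule.mapQ _ _ (Submodule.inclusion (Ideal.pow_le_pow_right (Nat.le_succ s)))
    (fun _ h => h)

/-- The canonical projection `I^s/I^{s+2} → I^s/I^{s+1}`. -/
def powProj (s : ℕ) : PowQuot I s (s + 2) →ₗ[R] PowQuot I s (s + 1) :=
  Submodule.factor (fun _ h => Ideal.pow_le_pow_right (Nat.le_succ (s + 1)) h)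

/-- `0 → I^{s+1}/I^{s+2} → I^s/I^{s+2} → I^s/I^{s+1} → 0`. -/
def powSequence (s : ℕ) : ShortComplex (ModuleCat.{u} R) :=
  ShortComplex.mk (X₁ := ModuleCat.of R (Gr I (s + 1))) (X₂ := ModuleCat.of R (PowQuot I s (s + 2)))
    (X₃ := ModuleCat.of R (Gr I s)) (ModuleCat.ofHom (powMid I s)) (ModuleCat.ofHom (powProj I s))
    (by
      refine ModuleCat.hom_ext (LinearMap.ext fun m => ?_)
      induction m using Gr.ind with | h x hx
      exact (Gr.mk_eq I _ (zero_mem _)).2 (by simpa using hx))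

lemma powSequence_shortExact (s : ℕ) : (powSequence I s).ShortExact := by
  apply ModuleCat.shortComplex_shortExact
  · intro m
    obtain ⟨⟨x, hx⟩, rfl⟩ := Submodule.Quotient.mk_surjective _ m
    constructor
    · intro h
      have h' : x ∈ I ^ (s + 1) :=
        (Submodule.Quotient.mk_eq_zero ((I ^ (s + 1) : Submodule R R).submoduleOf (I ^ s))).1 h
      exact ⟨Gr.mk x h', rfl⟩
    · rintro ⟨y, hy⟩
      rw [← hy]
      exact congrArg (fun f => f.hom y) (powSequence I s).zero
  · refine (injective_iff_map_eq_zero _).2 fun m h => ?_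
    obtain ⟨⟨x, hx⟩, rfl⟩ := Submodule.Quotient.mk_surjective _ m
    exact (Submodule.Quotient.mk_eq_zero _).2
      (show x ∈ I ^ (s + 2) from (Submodule.Quotient.mk_eq_zero
        ((I ^ (s + 2) : Submodule R R).submoduleOf (I ^ s))).1 h)
  · intro m
    induction m using Gr.ind with | h x hx
    exact ⟨Submodule.Quotient.mk ⟨x, hx⟩, rfl⟩
end gr


section Main
variable {R : Type u} [CommRing R] (I : Ideal R)

/-- `Tor_p^R(R/I, N)`, computed by projective resolutions of `N`. Its `R/I`-module structure is the
one induced by its `R`-module structure; as `R → R/I` is surjective, `R/I`-linear maps are the same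
as `R`-linear maps. -/
noncomputable abbrev TorQ (N : Type u) [AddCommGroup N] [Module R N] (p : ℕ) : ModuleCat.{u} R :=
  ((Tor (ModuleCat.{u} R) p).obj (ModuleCat.of R (R ⧸ I))).obj (ModuleCat.of R N)

/-- The graded module `Tor_*^R(R/I, N)`. -/
abbrev TorTot (N : Type u) [AddCommGroup N] [Module R N] : Type u := ⨁ p : ℕ, TorQ I N p

/-- The bigraded module `⨁_s Tor_*^R(R/I, I^s/I^{s+1})`. -/
abbrev TorGr : Type u := ⨁ s : ℕ, TorTot I (Gr I s)

/-- The map on `Tor_p^R(R/I, -)` induced by an `R`-linear map. -/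
noncomputable def torMap {N N' : Type u} [AddCommGroup N] [Module R N] [AddCommGroup N']
    [Module R N'] (f : N →ₗ[R] N') (p : ℕ) : TorQ I N p →ₗ[R] TorQ I N' p :=
  (((Tor (ModuleCat.{u} R) p).obj (ModuleCat.of R (R ⧸ I))).map (ModuleCat.ofHom f)).hom

/-- The map on `Tor_*^R(R/I, -)` induced by an `R`-linear map. -/
noncomputable def torTotMap {N N' : Type u} [AddCommGroup N] [Module R N] [AddCommGroup N']
    [Module R N'] (f : N →ₗ[R] N') : TorTot I N →ₗ[R] TorTot I N' :=
  DirectSum.lmap (fun p => torMap I f p)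

/-- The connecting homomorphism `Tor_{p+1}^R(R/I, I^s/I^{s+1}) → Tor_p^R(R/I, I^{s+1}/I^{s+2})`. -/
noncomputable def deltaDeg (s p : ℕ) :
    TorQ I (Gr I s) (p + 1) →ₗ[R] TorQ I (Gr I (s + 1)) p :=
  (leftDerivedδ ((MonoidalCategory.tensoringLeft (ModuleCat.{u} R)).obj (ModuleCat.of R (R ⧸ I)))
    (powSequence_shortExact I s) p).hom

/-- `δ^s : Tor_*^R(R/I, I^s/I^{s+1}) → Tor_{*-1}^R(R/I, I^{s+1}/I^{s+2})`; it is zero on `Tor_0`. -/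
noncomputable def delta (s : ℕ) : TorTot I (Gr I s) →ₗ[R] TorTot I (Gr I (s + 1)) :=
  DirectSum.toModule R ℕ _ fun p => match p with
    | 0 => 0
    | p + 1 => DirectSum.lof R ℕ (fun p => TorQ I (Gr I (s + 1)) p) p ∘ₗ deltaDeg I s p

/-- The direct sum `δ^*` of the connecting homomorphisms `δ^s`. -/
noncomputable def deltaTot : TorGr I →ₗ[R] TorGr I :=
  DirectSum.toModule R ℕ _ fun s =>
    DirectSum.lof R ℕ (fun s => TorTot I (Gr I s)) (s + 1) ∘ₗ delta I s

/-- `η : R/I ≅ Tor_0^R(R/I, R) → Tor_0^R(R/I, R/I)`. -/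
noncomputable def etaZero : (R ⧸ I) →ₗ[R] TorQ I (R ⧸ I) 0 :=
  ((MonoidalCategory.rightUnitor (ModuleCat.of R (R ⧸ I))).inv ≫
    (((MonoidalCategory.tensoringLeft (ModuleCat.{u} R)).obj
      (ModuleCat.of R (R ⧸ I))).leftDerivedZeroIsoSelf.inv.app (ModuleCat.of R R)) ≫
    ((Tor (ModuleCat.{u} R) 0).obj (ModuleCat.of R (R ⧸ I))).map (ModuleCat.ofHom I.mkQ)).hom

/-- The map `η : R/I → Tor_*^R(R/I, R/I)`, with image in degree zero. -/
noncomputable def eta : (R ⧸ I) →ₗ[R] TorTot I (R ⧸ I) :=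
  DirectSum.lof R ℕ (fun p => TorQ I (R ⧸ I) p) 0 ∘ₗ etaZero I

/-- `R/I ≅ I^0/I^1`. -/
noncomputable def unitGr : (R ⧸ I) →ₗ[R] Gr I 0 := Gr.act (Gr.mk 1 (Gr.mem_zero 1))

/-- `δ^0` as a map `Tor_*^R(R/I, R/I) → Tor_{*-1}^R(R/I, I/I^2)`. -/
noncomputable def deltaZero : TorTot I (R ⧸ I) →ₗ[R] TorTot I (Gr I 1) :=
  delta I 0 ∘ₗ torTotMap I (unitGr I)

end Main

section Resolution
variable {R : Type u} [CommRing R] {U : Type u} [AddCommGroup U] [Module R U] {n : ℕ}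
  (r : Fin n → R) (e : Module.Basis (Fin n) R U)

/-- The ideal generated by a finite sequence. -/
abbrev seqIdeal : Ideal R := Ideal.span (Set.range r)

/-- The linear form on `U` with `e_j ↦ r_j`. -/
noncomputable abbrev seqForm : U →ₗ[R] R := e.constr R r

lemma seqForm_mem (u : U) : seqForm r e u ∈ seqIdeal r := by
  rw [seqForm, Module.Basis.constr_apply_fintype]
  exact sum_mem fun j _ => Ideal.mul_mem_left _ _ (Ideal.subset_span ⟨j, rfl⟩)

/-- The Koszul complex `K(r_1, …, r_n)`, augmented over `R/(r_1, …, r_n)`. -/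
noncomputable def koszulSeqAug : koszulComplex (seqForm r e) ⟶
    (ChainComplex.single₀ (ModuleCat.{u} R)).obj (ModuleCat.of R (R ⧸ seqIdeal r)) :=
  koszulAug (seqForm r e) (seqIdeal r) (seqForm_mem r e)

/-- `K(r_1, …, r_n)` as a projective resolution of `R/(r_1, …, r_n)`, provided that its augmentation
is a quasi-isomorphism. -/
noncomputable def koszulResolution (h : QuasiIso (koszulSeqAug r e)) :
    ProjectiveResolution (ModuleCat.of R (R ⧸ seqIdeal r)) where
  complex := koszulComplex (seqForm r e)
  projective p := by
    have : Module.Free R (⋀[R]^p U) := Module.Free.of_basis (e.exteriorPower (R := R) (n := p))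
    exact inferInstanceAs (Projective (ModuleCat.of R (⋀[R]^p U)))
  π := koszulSeqAug r e
  quasiIso := h

/-- The complex `R/I ⊗ K(r_1, …, r_n)`. -/
noncomputable abbrev koszulTensor : ChainComplex (ModuleCat.{u} R) ℕ :=
  (((MonoidalCategory.tensoringLeft (ModuleCat.{u} R)).obj
    (ModuleCat.of R (R ⧸ seqIdeal r))).mapHomologicalComplex (ComplexShape.down ℕ)).obj
    (koszulComplex (seqForm r e))

/-- The map `x ↦ 1 ⊗ x` from `⋀^p U` to the degree `p` part of `R/I ⊗ K(r_1, …, r_n)`. -/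
noncomputable def oneTensor (p : ℕ) :
    ModuleCat.of R (⋀[R]^p U) ⟶ (koszulTensor r e).X p :=
  ModuleCat.ofHom (TensorProduct.mk R (R ⧸ seqIdeal r) (⋀[R]^p U) 1)

lemma one_tmul_eq_zero {I : Ideal R} {N : Type*} [AddCommGroup N] [Module R N] {x : N}
    (hx : x ∈ I • (⊤ : Submodule R N)) : (1 : R ⧸ I) ⊗ₜ[R] x = 0 := by
  refine Submodule.smul_induction_on hx ?_ ?_
  · intro c hc y _
    have : c • (1 : R ⧸ I) = 0 := by
      rw [Algebra.smul_def, mul_one]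
      exact Ideal.Quotient.eq_zero_iff_mem.2 hc
    rw [← TensorProduct.smul_tmul, this, TensorProduct.zero_tmul]
  · intro y z hy hz
    rw [TensorProduct.tmul_add, hy, hz, add_zero]

lemma oneTensor_d (p q : ℕ) : oneTensor r e p ≫ (koszulTensor r e).d p q = 0 := by
  by_cases h : q + 1 = p
  · subst h
    refine ModuleCat.hom_ext (LinearMap.ext fun x => ?_)
    have hx := koszulDeg_mem (seqForm r e) (seqIdeal r) (seqForm_mem r e) q x
    have hd : (koszulTensor r e).d (q + 1) q =
        ((MonoidalCategory.tensoringLeft (ModuleCat.{u} R)).obj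
          (ModuleCat.of R (R ⧸ seqIdeal r))).map (ModuleCat.ofHom (koszulDeg (seqForm r e) q)) :=
      congrArg (fun g => ((MonoidalCategory.tensoringLeft (ModuleCat.{u} R)).obj
        (ModuleCat.of R (R ⧸ seqIdeal r))).map g) (koszulComplex_d (seqForm r e) q)
    rw [hd]
    exact one_tmul_eq_zero hx
  · rw [(koszulTensor r e).shape p q h, comp_zero]

/-- The map `⋀^p U → Tor_p^R(R/I, R/I)` sending `x` to the homology class of the cycle `1 ⊗ x` of
`R/I ⊗ K(r_1, …, r_n)`. -/
noncomputable def koszulClass (h : QuasiIso (koszulSeqAug r e)) (p : ℕ) :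
    ⋀[R]^p U →ₗ[R] TorQ (seqIdeal r) (R ⧸ seqIdeal r) p :=
  ((koszulTensor r e).liftCycles (oneTensor r e p) _ rfl (oneTensor_d r e p _) ≫
    (koszulTensor r e).homologyπ p ≫
    ((koszulResolution r e h).isoLeftDerivedObj
      ((MonoidalCategory.tensoringLeft (ModuleCat.{u} R)).obj
        (ModuleCat.of R (R ⧸ seqIdeal r))) p).inv).hom

end Resolution

section Model
variable {R : Type u} [CommRing R] (I : Ideal R) (W : Type w) [AddCommGroup W] [Module (R ⧸ I) W]
  (U : Type u) [AddCommGroup U] [Module R U]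

/-- `Sym_{R/I}(W)` as an `R`-algebra. -/
noncomputable instance instAlgebraSym : Algebra R (SymmetricAlgebra (R ⧸ I) W) :=
  Algebra.compHom _ (Ideal.Quotient.mk I)

/-- `Λ^{Sym_{R/I}(W)}(Sym_{R/I}(W) ⊗_R U)`. -/
abbrev ModelKoszul : Type (max u w) :=
  ExteriorAlgebra (SymmetricAlgebra (R ⧸ I) W) (SymmetricAlgebra (R ⧸ I) W ⊗[R] U)

/-- The homogeneous component `Sym^s_{R/I}(W)`. -/
noncomputable def symPiece (s : ℕ) : Submodule (R ⧸ I) (SymmetricAlgebra (R ⧸ I) W) :=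
  LinearMap.range (SymmetricAlgebra.ι (R ⧸ I) W) ^ s

/-- The component `Sym^s_{R/I}(W) ⊗ ⋀^p U` of `Λ^{Sym_{R/I}(W)}(Sym_{R/I}(W) ⊗_R U)`. -/
noncomputable def modelPiece (s p : ℕ) : Submodule R (ModelKoszul I W U) :=
  Submodule.span R {x | ∃ a ∈ symPiece I W s, ∃ u : Fin p → U,
    x = a • ExteriorAlgebra.ιMulti (SymmetricAlgebra (R ⧸ I) W) p (fun i => 1 ⊗ₜ[R] u i)}

variable {I W U}
/-- The Koszul differential of the sequence `f_1, …, f_n` of elements of `Sym_{R/I}(W)`: the graded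
`Sym_{R/I}(W)`-derivation with `1 ⊗ e_j ↦ f_j`. -/
noncomputable def modelD {n : ℕ} (e : Module.Basis (Fin n) R U)
    (f : Module.Basis (Fin n) (R ⧸ I) W) :
    ModelKoszul I W U →ₗ[SymmetricAlgebra (R ⧸ I) W] ModelKoszul I W U :=
  koszulD ((e.baseChange (SymmetricAlgebra (R ⧸ I) W)).constr (SymmetricAlgebra (R ⧸ I) W)
    (fun j => SymmetricAlgebra.ι (R ⧸ I) W (f j)))
end Model

end KoszulTor

open KoszulTor

/-!
A regular sequence is quasi-regular: a form of degree `s` in the `r_j` lies in `I^{s+1}` only if its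
coefficients lie in `I`. Hence `gr_I(R)` is a polynomial ring over `S = R/I`, each `I^s/I^{s+1}` is
free over `S`, and additivity of Tor reduces `Tor(S, I^s/I^{s+1})` to `Tor(S, S)`. The latter is the
exterior algebra `S ⊗ Λ(U)`, because the Koszul complex resolves `S` and its differential vanishes
modulo `I`.

For `x ∈ I^s` the map `S → I^s/I^{s+1}`, `1 ↦ x`, lifts along the Koszul resolution to a chain map
into `I^s/I^{s+2}` only up to the terms `r_j x ∈ I^{s+1}`, so the connecting homomorphism sends
`x_* κ(y)` to `-∑_j (r_j x)_* κ(ι_j y)`, where `ι_j` is the contraction with the `j`-th coordinate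
form. As `φ` sends the class of `r_j` to `-f_j`, this is the Koszul differential of the variables
`f_j`, which form a regular sequence in `Sym(W)`; its cycles are therefore the sums of a boundary
and a constant from `S`, which gives the exactness.
-/

namespace KoszulTor

/-! ### Regular families and quasi-regularity -/

section RegularFamily
variable {ι A : Type*} [CommRing A]

/-- A family of ring elements indexed by an ordered type is regular if each member is a
non-zero-divisor modulo the ideal generated by the earlier ones. The quotient by the whole family
is allowed to vanish. -/
def IsRegularFamily [Preorder ι] (r : ι → A) : Prop :=
  ∀ i b, r i * b ∈ Ideal.span (r '' Set.Iio i) → b ∈ Ideal.span (r '' Set.Iio i)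

lemma ofList_take_ofFn {n : ℕ} (r : Fin n → A) (i : Fin n) :
    Ideal.ofList ((List.ofFn r).take i) = Ideal.span (r '' Set.Iio i) := by
  rw [Ideal.ofList]
  congr 1
  ext x
  simp only [Set.mem_ofPred_eq, List.mem_take_iff_getElem, List.getElem_ofFn, List.length_ofFn,
    Set.mem_image, Set.mem_Iio]
  constructor
  · rintro ⟨j, hj, rfl⟩
    exact ⟨⟨j, by omega⟩, Fin.lt_def.2 (by simp; omega), rfl⟩
  · rintro ⟨j, hj, rfl⟩
    exact ⟨j, lt_min (Fin.lt_def.1 hj) j.isLt, rfl⟩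

lemma IsRegularFamily.of_isWeaklyRegular {n : ℕ} {r : Fin n → A}
    (hr : RingTheory.Sequence.IsWeaklyRegular A (List.ofFn r)) : IsRegularFamily r := by
  intro i b hb
  have hreg := hr.regular_mod_prev i (by simp)
  rw [ofList_take_ofFn, smul_eq_mul, Ideal.mul_top, List.getElem_ofFn] at hreg
  have hb' : r i • (Submodule.Quotient.mk b : A ⧸ Ideal.span (r '' Set.Iio i)) = r i • 0 := by
    rw [← Submodule.Quotient.mk_smul, smul_zero, Submodule.Quotient.mk_eq_zero]
    exact hb
  exact (Submodule.Quotient.mk_eq_zero _).1 (hreg hb')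

lemma IsRegularFamily.map_ringEquiv [Preorder ι] {B : Type*} [CommRing B] {r : ι → A}
    (hr : IsRegularFamily r) (E : A ≃+* B) : IsRegularFamily (E ∘ r) := by
  have span_eq (T : Set ι) : Ideal.span ((E ∘ r) '' T) = (Ideal.span (r '' T)).map E := by
    rw [Ideal.map_span, Set.image_comp]
  intro i b hb
  obtain ⟨c, rfl⟩ := E.surjective b
  rw [span_eq, Function.comp_apply, ← map_mul, Ideal.mem_map_of_equiv] at hb
  obtain ⟨x, hx, hxe⟩ := hb
  rw [span_eq]
  exact Ideal.mem_map_of_mem _ (hr i c (E.injective hxe ▸ hx))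

lemma isRegularFamily_X [Preorder ι] :
    IsRegularFamily (MvPolynomial.X : ι → MvPolynomial ι A) := by
  intro i b hb
  rw [MvPolynomial.mem_ideal_span_X_image] at hb ⊢
  intro m hm
  obtain ⟨j, hj, hj0⟩ := hb (Finsupp.single i 1 + m) (by
    rw [MvPolynomial.mem_support_iff, MvPolynomial.coeff_X_mul]
    exact MvPolynomial.mem_support_iff.1 hm)
  refine ⟨j, hj, ?_⟩
  have hij : i ≠ j := (ne_of_lt hj).symm
  simpa [Finsupp.single_apply, hij] using hj0

lemma set_univ_induction_Iio [LinearOrder ι] [Finite ι] {P : Set ι → Prop} (hempty : P ∅)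
    (hinsert : ∀ i, P (Set.Iio i) → P (insert i (Set.Iio i))) : P Set.univ := by
  classical
  have := Fintype.ofFinite ι
  suffices ∀ s : Finset ι, IsLowerSet (s : Set ι) → P s by
    simpa using this Finset.univ (by simpa using isLowerSet_univ)
  intro s
  induction s using Finset.induction_on_max with
  | empty => intro _; simpa using hempty
  | insert a s hs ih =>
    intro hlower
    have hsa : (s : Set ι) = Set.Iio a := by
      ext j
      refine ⟨fun hj => hs j hj, fun hj => ?_⟩
      have := hlower (le_of_lt hj) (Finset.mem_coe.2 (Finset.mem_insert_self a s))
      exact (Finset.mem_insert.1 this).resolve_left (ne_of_lt hj)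
    rw [hsa] at ih
    rw [Finset.coe_insert, hsa]
    exact hinsert a (ih (isLowerSet_Iio a))

end RegularFamily

section QuasiRegular
open MvPolynomial
variable {σ A : Type*} [CommRing A] {r : σ → A} {K K' : Ideal A} {T T' : Set σ} {s : ℕ}
  {F : MvPolynomial σ A}

/-- The forms of degree `s` in the variables of `T` whose coefficients lie in the ideal `K`. -/
noncomputable def formsIn (K : Ideal A) (T : Set σ) (s : ℕ) : Submodule A (MvPolynomial σ A) :=
  restrictSupport A {m | m.degree = s ∧ ↑m.support ⊆ T} ⊓ (K.map C).restrictScalars A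

lemma mem_formsIn : F ∈ formsIn K T s ↔
    (∀ m, F.coeff m ≠ 0 → m.degree = s ∧ ↑m.support ⊆ T) ∧ ∀ m, F.coeff m ∈ K := by
  simp only [formsIn, Submodule.mem_inf, mem_restrictSupport_iff, Set.subset_def, Finset.mem_coe,
    mem_support_iff, Set.mem_ofPred_eq, Submodule.restrictScalars_mem, mem_map_C_iff]

lemma formsIn_mono (hK : K ≤ K') (hT : T ⊆ T') : formsIn K T s ≤ formsIn K' T' s := by
  intro F hF
  rw [mem_formsIn] at hF ⊢
  exact ⟨fun m hm => ⟨(hF.1 m hm).1, (hF.1 m hm).2.trans hT⟩, fun m => hK (hF.2 m)⟩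

lemma mem_formsIn_top_univ : F ∈ formsIn ⊤ Set.univ s ↔ F.IsHomogeneous s := by
  simp only [mem_formsIn, IsHomogeneous, IsWeightedHomogeneous, Set.subset_univ, and_true,
    Submodule.mem_top, implies_true, Finsupp.degree_eq_weight_one, Pi.one_def]

lemma X_mul_mem_formsIn (hF : F ∈ formsIn K T s) {j : σ} (hj : j ∈ T) :
    X j * F ∈ formsIn K T (s + 1) := by
  classical
  rw [mem_formsIn] at hF ⊢
  refine ⟨fun m hm => ?_, fun m => ?_⟩
  · rw [coeff_X_mul'] at hm
    split_ifs at hm with hjm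
    · obtain ⟨m, rfl⟩ : ∃ m', m = Finsupp.single j 1 + m' :=
        ⟨_, (add_tsub_cancel_of_le (Finsupp.single_le_iff.2
          (Nat.one_le_iff_ne_zero.2 (Finsupp.mem_support_iff.1 hjm)))).symm⟩
      rw [add_tsub_cancel_left] at hm
      refine ⟨by rw [map_add, (hF.1 m hm).1, Finsupp.degree_single, add_comm], fun k hk => ?_⟩
      rcases Finset.mem_union.1 (Finsupp.support_add hk) with hk | hk
      · rwa [Finset.mem_singleton.1 (Finsupp.support_single_subset hk)]
      · exact (hF.1 m hm).2 hk
    · exact absurd rfl hm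
  · rw [coeff_X_mul']
    split_ifs
    exacts [hF.2 _, zero_mem _]

lemma C_mem_formsIn {c : A} (hc : c ∈ K) : C c ∈ formsIn K T 0 := by
  classical
  rw [mem_formsIn]
  refine ⟨fun m hm => ?_, fun m => ?_⟩
  · rw [coeff_C] at hm
    obtain rfl : 0 = m := by by_contra h; simp [h] at hm
    simp
  · rw [coeff_C]
    split_ifs
    exacts [hc, zero_mem _]

lemma aeval_mem_of_mem_formsIn (hF : F ∈ formsIn K T s) :
    aeval r F ∈ K * Ideal.span (r '' T) ^ s := by
  rw [mem_formsIn] at hF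
  rw [aeval_def, eval₂_eq]
  refine sum_mem fun m hm => Ideal.mul_mem_mul (hF.2 m) ?_
  obtain ⟨hdeg, hsupp⟩ := hF.1 m (mem_support_iff.1 hm)
  rw [← hdeg, Finsupp.degree_apply, ← Finset.prod_pow_eq_pow_sum]
  exact Ideal.prod_mem_prod fun j hj =>
    Ideal.pow_mem_pow (Ideal.subset_span (Set.mem_image_of_mem r (hsupp hj))) _

lemma map_aeval_formsIn (r : σ → A) (K : Ideal A) (T : Set σ) (s : ℕ) :
    (formsIn K T s).map (aeval r).toLinearMap = K * Ideal.span (r '' T) ^ s := by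
  refine le_antisymm (Submodule.map_le_iff_le_comap.2 fun F => aeval_mem_of_mem_formsIn) ?_
  induction s with
  | zero =>
    intro c hc
    rw [pow_zero, mul_one] at hc
    exact Submodule.mem_map.2 ⟨C c, C_mem_formsIn hc, aeval_C r c⟩
  | succ s ih =>
    rw [pow_succ, ← mul_assoc]
    refine (Ideal.mul_mono_left ih).trans (Ideal.mul_le.2 ?_)
    rintro _ ⟨F, hF, rfl⟩ y hy
    suffices Ideal.span (r '' T) ≤ ((formsIn K T (s + 1)).map (aeval r).toLinearMap).comap
      (LinearMap.mulLeft A (aeval r F)) from this hy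
    rw [Ideal.span, Submodule.span_le]
    rintro _ ⟨j, hj, rfl⟩
    have hjF : (aeval r).toLinearMap (X j * F) = aeval r F * r j := by simp [mul_comm]
    rw [SetLike.mem_coe, Submodule.mem_comap, LinearMap.mulLeft_apply, ← hjF]
    exact Submodule.mem_map_of_mem (X_mul_mem_formsIn hF hj)

lemma exists_mem_formsIn_aeval_eq {a : A} (ha : a ∈ K * Ideal.span (r '' T) ^ s) :
    ∃ F ∈ formsIn K T s, aeval r F = a := by
  rw [← map_aeval_formsIn] at ha
  exact ha

lemma exists_mem_formsIn_top_aeval_eq {a : A} (ha : a ∈ Ideal.span (r '' T) ^ s) :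
    ∃ F ∈ formsIn (⊤ : Ideal A) T s, aeval r F = a :=
  exists_mem_formsIn_aeval_eq (by rwa [Ideal.top_mul])

lemma exists_eq_X_mul_add_of_mem_formsIn_insert {i : σ}
    (hF : F ∈ formsIn K (insert i T) (s + 1)) :
    ∃ H ∈ formsIn K (insert i T) s, ∃ G ∈ formsIn K T (s + 1), F = X i * H + G := by
  rw [mem_formsIn] at hF
  refine ⟨F.divMonomial (Finsupp.single i 1), mem_formsIn.2 ⟨fun m hm => ?_, fun m => ?_⟩,
    F.modMonomial (Finsupp.single i 1), mem_formsIn.2 ⟨fun m hm => ?_, fun m => ?_⟩,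
    (divMonomial_add_modMonomial_single F i).symm⟩
  · rw [coeff_divMonomial] at hm
    obtain ⟨hdeg, hsupp⟩ := hF.1 _ hm
    rw [map_add, Finsupp.degree_single] at hdeg
    refine ⟨by omega, fun j hj => hsupp ?_⟩
    rw [Finset.mem_coe, Finsupp.mem_support_iff] at hj ⊢
    rw [Finsupp.add_apply]
    omega
  · rw [coeff_divMonomial]
    exact hF.2 _
  · by_cases him : Finsupp.single i 1 ≤ m
    · exact absurd (coeff_modMonomial_of_le _ him) hm
    · rw [coeff_modMonomial_of_not_le _ him] at hm
      refine ⟨(hF.1 m hm).1, fun j hj => ((hF.1 m hm).2 hj).resolve_left ?_⟩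
      rintro rfl
      exact him (Finsupp.single_le_iff.2
        (Nat.one_le_iff_ne_zero.2 (Finsupp.mem_support_iff.1 hj)))
  · by_cases him : Finsupp.single i 1 ≤ m
    · rw [coeff_modMonomial_of_le _ him]
      exact zero_mem _
    · rw [coeff_modMonomial_of_not_le _ him]
      exact hF.2 m

/-- Quasi-regularity of the elements `r j`, `j ∈ T`: a homogeneous relation among them has
coefficients in the ideal that they generate. -/
def QuasiRegularOn (r : σ → A) (T : Set σ) : Prop :=
  ∀ s, ∀ F ∈ formsIn ⊤ T s, aeval r F = 0 → F ∈ formsIn (Ideal.span (r '' T)) T s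

lemma QuasiRegularOn.mem_formsIn_of_aeval_mem (h : QuasiRegularOn r T) (hF : F ∈ formsIn ⊤ T s)
    (hFr : aeval r F ∈ Ideal.span (r '' T) ^ (s + 1)) :
    F ∈ formsIn (Ideal.span (r '' T)) T s := by
  rw [pow_succ'] at hFr
  obtain ⟨G, hG, hGF⟩ := exists_mem_formsIn_aeval_eq hFr
  have hFG := h s (F - G) (sub_mem hF (formsIn_mono le_top subset_rfl hG))
    (by rw [map_sub, hGF, sub_self])
  simpa using add_mem hFG hG

lemma QuasiRegularOn.mem_pow_of_mul_mem_pow (h : QuasiRegularOn r T) {a : A}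
    (ha : ∀ b, a * b ∈ Ideal.span (r '' T) → b ∈ Ideal.span (r '' T)) {b : A}
    (hab : a * b ∈ Ideal.span (r '' T) ^ s) : b ∈ Ideal.span (r '' T) ^ s := by
  induction s with
  | zero => simp
  | succ s ih =>
    have hb := ih (Ideal.pow_le_pow_right (Nat.le_succ s) hab)
    obtain ⟨G, hG, rfl⟩ := exists_mem_formsIn_top_aeval_eq hb
    have haG := h.mem_formsIn_of_aeval_mem (Submodule.smul_mem _ a hG) (by rwa [map_smul])
    rw [pow_succ']
    refine aeval_mem_of_mem_formsIn (mem_formsIn.2 ⟨(mem_formsIn.1 hG).1, fun m => ha _ ?_⟩)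
    rw [← smul_eq_mul, ← coeff_smul]
    exact (mem_formsIn.1 haG).2 m

lemma mem_formsIn_of_aeval_eq_zero (hF : ∀ m, F.coeff m ≠ 0 → m = 0) (hFr : aeval r F = 0) :
    F ∈ formsIn K T s := by
  obtain ⟨c, rfl⟩ : ∃ c, algebraMap A _ c = F := by
    rw [← Submodule.mem_one, ← restrictSupport_zero, mem_restrictSupport_iff]
    exact fun m hm => hF m (mem_support_iff.1 hm)
  rw [AlgHom.commutes, Algebra.algebraMap_self_apply] at hFr
  rw [hFr, map_zero]
  exact zero_mem _

lemma quasiRegularOn_empty (r : σ → A) : QuasiRegularOn r ∅ := fun _ _ hF hFr =>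
  mem_formsIn_of_aeval_eq_zero (fun m hm => by simpa using ((mem_formsIn.1 hF).1 m hm).2) hFr

lemma QuasiRegularOn.insert (h : QuasiRegularOn r T) {i : σ}
    (hi : ∀ b, r i * b ∈ Ideal.span (r '' T) → b ∈ Ideal.span (r '' T)) :
    QuasiRegularOn r (insert i T) := by
  have hT : T ⊆ Insert.insert i T := Set.subset_insert i T
  have hle : Ideal.span (r '' T) ≤ Ideal.span (r '' Insert.insert i T) :=
    Ideal.span_mono (Set.image_mono hT)
  intro s
  induction s with
  | zero =>
    exact fun F hF => mem_formsIn_of_aeval_eq_zero fun m hm =>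
      (Finsupp.degree_eq_zero_iff m).1 ((mem_formsIn.1 hF).1 m hm).1
  | succ s ih =>
    intro F hF hFr
    obtain ⟨H, hH, G, hG, rfl⟩ := exists_eq_X_mul_add_of_mem_formsIn_insert hF
    rw [map_add, map_mul, aeval_X] at hFr
    have hHr : aeval r H ∈ Ideal.span (r '' T) ^ (s + 1) := by
      refine h.mem_pow_of_mul_mem_pow hi ?_
      rw [eq_neg_of_add_eq_zero_left hFr]
      simpa [Ideal.top_mul] using aeval_mem_of_mem_formsIn (r := r) hG
    have hHI : H ∈ formsIn (Ideal.span (r '' Insert.insert i T)) (Insert.insert i T) s := by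
      obtain ⟨H', hH', hH'r⟩ := exists_mem_formsIn_aeval_eq
        (K := Ideal.span (r '' T)) (r := r) (T := T) (s := s) (by rwa [← pow_succ'])
      have hHH' := ih (H - H') (sub_mem hH (formsIn_mono le_top hT hH'))
        (by rw [map_sub, hH'r, sub_self])
      simpa using add_mem hHH' (formsIn_mono hle hT hH')
    -- Replacing `X i * H` by `r i • L` yields a relation among the `r j`, `j ∈ T`, alone.
    obtain ⟨L, hL, hLr⟩ := exists_mem_formsIn_top_aeval_eq hHr
    have hLG := h (s + 1) (r i • L + G) (add_mem (Submodule.smul_mem _ _ hL) hG)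
      (by rw [map_add, map_smul, hLr, smul_eq_mul, hFr])
    have hriL : r i • L ∈ formsIn (Ideal.span (r '' Insert.insert i T)) (Insert.insert i T)
        (s + 1) := by
      refine mem_formsIn.2 ⟨(mem_formsIn.1 (Submodule.smul_mem _ _
        (formsIn_mono le_rfl hT hL))).1, fun m => ?_⟩
      rw [coeff_smul]
      exact Ideal.mul_mem_right _ _ (Ideal.subset_span ⟨i, Set.mem_insert i T, rfl⟩)
    refine add_mem (X_mul_mem_formsIn hHI (Set.mem_insert i T)) ?_
    simpa using sub_mem (formsIn_mono hle hT hLG) hriL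

lemma IsRegularFamily.quasiRegularOn_univ [LinearOrder σ] [Finite σ] (hr : IsRegularFamily r) :
    QuasiRegularOn r Set.univ :=
  set_univ_induction_Iio (quasiRegularOn_empty r) fun i h => h.insert (hr i)

lemma IsRegularFamily.coeff_mem [LinearOrder σ] [Finite σ] (hr : IsRegularFamily r)
    (hF : F.IsHomogeneous s) (hFr : aeval r F ∈ Ideal.span (Set.range r) ^ (s + 1))
    (m : σ →₀ ℕ) : F.coeff m ∈ Ideal.span (Set.range r) := by
  rw [← Set.image_univ] at hFr ⊢
  exact (mem_formsIn.1 (hr.quasiRegularOn_univ.mem_formsIn_of_aeval_mem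
    (mem_formsIn_top_univ.2 hF) hFr)).2 m

end QuasiRegular

/-! ### Acyclicity of the Koszul complex -/

section KoszulAcyclic
variable {A M : Type*} [CommRing A] [AddCommGroup M] [Module A M]
  {ξ ζ : M →ₗ[A] A} {N : Submodule A M} {a : M} {p : ℕ} {x : ExteriorAlgebra A M}

lemma koszulD_ι (ξ : M →ₗ[A] A) (a : M) :
    koszulD ξ (ExteriorAlgebra.ι A a) = algebraMap A _ (ξ a) :=
  CliffordAlgebra.contractLeft_ι _ _ _

lemma koszulD_comm (ξ ζ : M →ₗ[A] A) (x : ExteriorAlgebra A M) :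
    koszulD ξ (koszulD ζ x) = -koszulD ζ (koszulD ξ x) :=
  CliffordAlgebra.contractLeft_comm _ _ _

lemma koszulD_constr {κ : Type*} [Fintype κ] (e : Module.Basis κ A M) (g : κ → A)
    (x : ExteriorAlgebra A M) :
    koszulD (e.constr A g) x = ∑ j, g j • koszulD (e.coord j) x := by
  have constr_eq : e.constr A g = ∑ j, g j • e.coord j := by
    refine LinearMap.ext fun v => ?_
    simp only [Module.Basis.constr_apply_fintype, LinearMap.sum_apply, LinearMap.smul_apply,
      Module.Basis.coord_apply, Module.Basis.equivFun_apply, smul_eq_mul, mul_comm]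
  rw [constr_eq]
  simp only [koszulD, map_sum, map_smul, LinearMap.sum_apply, LinearMap.smul_apply]

lemma decompose_koszulD (ξ : M →ₗ[A] A) (x : ExteriorAlgebra A M) (p : ℕ) :
    (decompose (fun i => ⋀[A]^i M) (koszulD ξ x) p : ExteriorAlgebra A M) =
      koszulD ξ (decompose (fun i => ⋀[A]^i M) x (p + 1)) := by
  induction x using DirectSum.Decomposition.inductionOn (fun i => ⋀[A]^i M) with
  | zero => simp only [map_zero, decompose_zero, DirectSum.zero_apply, ZeroMemClass.coe_zero]
  | add x y hx hy =>
    simp only [map_add, decompose_add, DirectSum.add_apply, Submodule.coe_add, hx, hy]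
  | @homogeneous i x =>
    cases i with
    | zero =>
      obtain ⟨c, hc⟩ := Submodule.mem_one.1 ((pow_zero (LinearMap.range (ExteriorAlgebra.ι A))).le
        x.2)
      rw [decompose_of_mem_ne (fun i => ⋀[A]^i M) x.2 (Nat.succ_ne_zero p).symm, map_zero, ← hc,
        koszulD_algebraMap, decompose_zero]
      rfl
    | succ i =>
      have hx := koszulD_mem ξ i _ x.2
      obtain rfl | hip := eq_or_ne i p
      · rw [decompose_of_mem_same (fun i => ⋀[A]^i M) x.2,
          decompose_of_mem_same (fun i => ⋀[A]^i M) hx]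
      · rw [decompose_of_mem_ne (fun i => ⋀[A]^i M) x.2 (mt Nat.succ.inj hip),
          decompose_of_mem_ne (fun i => ⋀[A]^i M) hx hip, map_zero]

lemma koszulD_eq_zero_of_mem_map_ι_pow (hξ : ∀ a ∈ N, ξ a = 0)
    (hx : x ∈ N.map (ExteriorAlgebra.ι A) ^ p) : koszulD ξ x = 0 := by
  induction p generalizing x with
  | zero =>
    rw [pow_zero] at hx
    obtain ⟨c, rfl⟩ := Submodule.mem_one.1 hx
    exact koszulD_algebraMap ξ c
  | succ p ih =>
    rw [pow_succ'] at hx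
    refine Submodule.mul_induction_on hx ?_ fun y z hy hz => by rw [map_add, hy, hz, add_zero]
    rintro _ ⟨a, ha, rfl⟩ y hy
    rw [koszulD_ι_mul, hξ a ha, ih hy, zero_smul, mul_zero, sub_zero]

lemma sup_pow_succ_le {B : Type*} [Ring B] [Algebra A B] {V L : Submodule A B}
    (hVL : V * L ≤ L * V) (hL : L * L = ⊥) (p : ℕ) :
    (V ⊔ L) ^ (p + 1) ≤ V ^ (p + 1) ⊔ L * V ^ p := by
  induction p with
  | zero => simp
  | succ p ih =>
    have hVLV : V * (L * V ^ p) ≤ L * V ^ (p + 1) := by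
      rw [← mul_assoc, pow_succ', ← mul_assoc]
      exact mul_le_mul_left hVL _
    calc (V ⊔ L) ^ (p + 2) ≤ (V ⊔ L) * (V ^ (p + 1) ⊔ L * V ^ p) := by
          rw [pow_succ']
          exact mul_le_mul_right ih _
      _ = V ^ (p + 2) ⊔ V * (L * V ^ p) ⊔ L * V ^ (p + 1) := by
          rw [Submodule.sup_mul, Submodule.mul_sup, Submodule.mul_sup, ← mul_assoc L L, hL,
            Submodule.bot_mul, sup_bot_eq, ← pow_succ']
      _ ≤ V ^ (p + 2) ⊔ L * V ^ (p + 1) :=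
          sup_le (sup_le le_sup_left (hVLV.trans le_sup_right)) le_sup_right

lemma exists_add_ι_mul_of_mem_map_ι_pow
    (hx : x ∈ (N ⊔ Submodule.span A {a}).map (ExteriorAlgebra.ι A) ^ (p + 1)) :
    ∃ y ∈ N.map (ExteriorAlgebra.ι A) ^ (p + 1), ∃ b ∈ N.map (ExteriorAlgebra.ι A) ^ p,
      x = y + ExteriorAlgebra.ι A a * b := by
  rw [Submodule.map_sup, Submodule.map_span, Set.image_singleton] at hx
  have hx' := sup_pow_succ_le (V := N.map (ExteriorAlgebra.ι A))
    (L := Submodule.span A {ExteriorAlgebra.ι A a}) ?_ ?_ p hx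
  · obtain ⟨y, hy, z, hz, rfl⟩ := Submodule.mem_sup.1 hx'
    obtain ⟨b, hb, rfl⟩ := Submodule.mem_span_singleton_mul.1 hz
    exact ⟨y, hy, b, hb, rfl⟩
  · rw [Submodule.mul_le]
    rintro _ ⟨v, hv, rfl⟩ w hw
    obtain ⟨c, rfl⟩ := Submodule.mem_span_singleton.1 hw
    rw [mul_smul_comm, eq_neg_of_add_eq_zero_left (ExteriorAlgebra.ι_add_mul_swap v a)]
    exact Submodule.smul_mem _ _ (neg_mem
      (Submodule.mul_mem_mul (Submodule.mem_span_singleton_self _) (Submodule.mem_map_of_mem hv)))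
  · rw [Submodule.span_mul_span, Set.singleton_mul_singleton, ExteriorAlgebra.ι_sq_zero,
      Submodule.span_zero_singleton]

/-- Acyclicity, in positive degrees, of the Koszul complex of the restriction of `ξ` to the
submodule `N`. The exterior powers of `N` are replaced by the powers of its image in the exterior
algebra of the ambient module. -/
def KoszulAcyclicOn (ξ : M →ₗ[A] A) (N : Submodule A M) : Prop :=
  ∀ p, ∀ x ∈ N.map (ExteriorAlgebra.ι A) ^ (p + 1), koszulD ξ x = 0 →
    ∃ y ∈ N.map (ExteriorAlgebra.ι A) ^ (p + 2), koszulD ξ y = x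

lemma koszulAcyclicOn_bot (ξ : M →ₗ[A] A) : KoszulAcyclicOn ξ ⊥ := by
  intro p x hx _
  rw [Submodule.map_bot, pow_succ, Submodule.mul_bot, Submodule.mem_bot] at hx
  exact ⟨0, zero_mem _, by rw [hx, map_zero]⟩

lemma KoszulAcyclicOn.exists_eq_of_mem_pow (h : KoszulAcyclicOn ξ N)
    (ha : ∀ b, ξ a * b ∈ N.map ξ → b ∈ N.map ξ) {y b : ExteriorAlgebra A M}
    (hy : y ∈ N.map (ExteriorAlgebra.ι A) ^ (p + 1)) (hb : b ∈ N.map (ExteriorAlgebra.ι A) ^ p)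
    (hb0 : koszulD ξ b = 0) (hyb : koszulD ξ y + ξ a • b = 0) :
    ∃ c ∈ N.map (ExteriorAlgebra.ι A) ^ (p + 1), koszulD ξ c = b := by
  cases p with
  | succ p => exact h p b hb hb0
  | zero =>
    rw [pow_zero] at hb
    rw [zero_add, pow_one] at hy ⊢
    obtain ⟨b, rfl⟩ := Submodule.mem_one.1 hb
    obtain ⟨v, hv, rfl⟩ := Submodule.mem_map.1 hy
    rw [koszulD_ι, Algebra.smul_def, ← map_mul, ← map_add,
      ExteriorAlgebra.algebraMap_eq_zero_iff] at hyb
    obtain ⟨w, hw, rfl⟩ := ha b (by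
      rw [eq_neg_of_add_eq_zero_right hyb]
      exact neg_mem (Submodule.mem_map_of_mem hv))
    exact ⟨_, Submodule.mem_map_of_mem hw, koszulD_ι ξ w⟩

/- Write a cycle as `x = y + a b`, where `y` and `b` come from `N`. Then `b` is the contraction of
`x` with `ζ`, hence again a cycle, so `b = d c`, and `x = d (y' - a c)` where
`d y' = y + ξ(a) c`. -/
lemma KoszulAcyclicOn.sup_span_singleton (h : KoszulAcyclicOn ξ N) (hζa : ζ a = 1)
    (hζN : ∀ v ∈ N, ζ v = 0) (ha : ∀ b, ξ a * b ∈ N.map ξ → b ∈ N.map ξ) :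
    KoszulAcyclicOn ξ (N ⊔ Submodule.span A {a}) := by
  intro p x hx hx0
  obtain ⟨y, hy, b, hb, rfl⟩ := exists_add_ι_mul_of_mem_map_ι_pow hx
  have contract_eq : koszulD ζ (y + ExteriorAlgebra.ι A a * b) = b := by
    rw [map_add, koszulD_ι_mul, koszulD_eq_zero_of_mem_map_ι_pow hζN hy,
      koszulD_eq_zero_of_mem_map_ι_pow hζN hb, hζa, one_smul, mul_zero, sub_zero, zero_add]
  have hb0 : koszulD ξ b = 0 := by
    rw [← contract_eq, koszulD_comm, hx0, map_zero, neg_zero]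
  rw [map_add, koszulD_ι_mul, hb0, mul_zero, sub_zero] at hx0
  obtain ⟨c, hc, rfl⟩ := h.exists_eq_of_mem_pow ha hy hb hb0 hx0
  obtain ⟨y', hy', hy'y⟩ := h p (y + ξ a • c) (add_mem hy (Submodule.smul_mem _ _ hc))
    (by rw [map_add, map_smul, hx0])
  have hN : N.map (ExteriorAlgebra.ι A) ≤ (N ⊔ Submodule.span A {a}).map (ExteriorAlgebra.ι A) :=
    Submodule.map_mono le_sup_left
  refine ⟨y' - ExteriorAlgebra.ι A a * c, sub_mem (pow_le_pow_left' hN _ hy') ?_, ?_⟩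
  · rw [pow_succ']
    exact Submodule.mul_mem_mul (Submodule.mem_map_of_mem
      (Submodule.mem_sup_right (Submodule.mem_span_singleton_self a))) (pow_le_pow_left' hN _ hc)
  · rw [map_sub, hy'y, koszulD_ι_mul]
    abel

variable {κ : Type*} [LinearOrder κ] [Finite κ]

lemma IsRegularFamily.koszulAcyclicOn_top {r : κ → A} (hr : IsRegularFamily r)
    (e : Module.Basis κ A M) : KoszulAcyclicOn (e.constr A r) ⊤ := by
  have map_span (T : Set κ) :
      (Submodule.span A (e '' T)).map (e.constr A r) = Ideal.span (r '' T) := by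
    rw [Submodule.map_span, Set.image_image]
    simp only [Module.Basis.constr_basis, Ideal.span]
  rw [← e.span_eq, ← Set.image_univ]
  refine set_univ_induction_Iio (P := fun T => KoszulAcyclicOn _ (Submodule.span A (e '' T)))
    (by simpa using koszulAcyclicOn_bot _) fun i hi => ?_
  rw [Set.image_insert_eq, Submodule.span_insert, sup_comm]
  refine hi.sup_span_singleton (ζ := e.coord i) (by simp) (fun v hv => ?_) fun b => ?_
  · rw [Module.Basis.coord_apply, ← Finsupp.notMem_support_iff]
    exact fun h => lt_irrefl i (e.repr_support_subset_of_mem_span _ hv h)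
  · rw [map_span, Module.Basis.constr_basis]
    exact hr i b

lemma IsRegularFamily.exists_koszulD_eq {r : κ → A} (hr : IsRegularFamily r)
    (e : Module.Basis κ A M) (hx : x ∈ ⋀[A]^(p + 1) M) (hx0 : koszulD (e.constr A r) x = 0) :
    ∃ y ∈ ⋀[A]^(p + 2) M, koszulD (e.constr A r) y = x := by
  simpa only [Submodule.map_top] using
    hr.koszulAcyclicOn_top e p x (by rwa [Submodule.map_top]) hx0

lemma IsRegularFamily.exists_eq_koszulD_add_algebraMap {r : κ → A} (hr : IsRegularFamily r)
    (e : Module.Basis κ A M) (hx : koszulD (e.constr A r) x = 0) :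
    ∃ y c, x = koszulD (e.constr A r) y + algebraMap A _ c := by
  suffices hx' : x ∈ LinearMap.range (koszulD (e.constr A r)) ⊔
      LinearMap.range (Algebra.linearMap A (ExteriorAlgebra A M)) by
    obtain ⟨_, ⟨y, rfl⟩, _, ⟨c, rfl⟩, hyc⟩ := Submodule.mem_sup.1 hx'
    exact ⟨y, c, hyc.symm⟩
  classical
  rw [← sum_support_decompose (fun i => ⋀[A]^i M) x]
  refine sum_mem fun p _ => ?_
  cases p with
  | zero =>
    obtain ⟨c, hc⟩ := Submodule.mem_one.1 ((pow_zero (LinearMap.range (ExteriorAlgebra.ι A))).le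
      (decompose (fun i => ⋀[A]^i M) x 0).2)
    exact Submodule.mem_sup_right ⟨c, hc⟩
  | succ p =>
    obtain ⟨y, -, hy⟩ := hr.exists_koszulD_eq e (decompose (fun i => ⋀[A]^i M) x (p + 1)).2
      (by rw [← decompose_koszulD, hx, decompose_zero]; rfl)
    exact Submodule.mem_sup_left ⟨y, hy⟩

lemma exists_koszulD_eq_algebraMap {c : A} (hc : c ∈ LinearMap.range ξ) :
    ∃ y ∈ ⋀[A]^1 M, koszulD ξ y = algebraMap A _ c := by
  obtain ⟨a, rfl⟩ := hc
  exact ⟨ExteriorAlgebra.ι A a, (pow_one (LinearMap.range (ExteriorAlgebra.ι A))).ge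
    (LinearMap.mem_range_self _ a), koszulD_ι ξ a⟩

end KoszulAcyclic

/-! ### Classes of cycles in Tor and the Koszul resolution -/

section Resolution
variable {R : Type u} [CommRing R] {U : Type u} [AddCommGroup U] [Module R U] {n : ℕ}

lemma coe_zeroEquiv_symm (a : R) :
    (((exteriorPower.zeroEquiv R U).symm a : ⋀[R]^0 U) : ExteriorAlgebra R U) =
      algebraMap R _ a := by
  have hsmul : (exteriorPower.zeroEquiv R U).symm a =
      a • exteriorPower.ιMulti R 0 (fun _ => 0) := by
    rw [LinearEquiv.symm_apply_eq, map_smul, exteriorPower.zeroEquiv_ιMulti, smul_eq_mul, mul_one]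
  rw [hsmul, Submodule.coe_smul, exteriorPower.ιMulti_apply_coe, ExteriorAlgebra.ιMulti_zero_apply,
    Algebra.algebraMap_eq_smul_one]

lemma algebraMap_zeroEquiv (x : ⋀[R]^0 U) :
    algebraMap R _ (exteriorPower.zeroEquiv R U x) = (x : ExteriorAlgebra R U) := by
  rw [← coe_zeroEquiv_symm, LinearEquiv.symm_apply_apply]

variable (r : Fin n → R) (e : Module.Basis (Fin n) R U)

lemma koszulSeqAug_f_zero : (koszulSeqAug r e).f 0 =
    ModuleCat.ofHom ((seqIdeal r).mkQ ∘ₗ (exteriorPower.zeroEquiv R U).toLinearMap) :=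
  ChainComplex.toSingle₀Equiv_symm_apply_f_zero _ _

lemma quasiIsoAt_koszulSeqAug_zero : QuasiIsoAt (koszulSeqAug r e) 0 := by
  rw [ChainComplex.quasiIsoAt₀_iff, ShortComplex.quasiIso_iff_of_zeros' _
    ((koszulComplex (seqForm r e)).shape 0 0 (by simp)) rfl rfl]
  constructor
  · rw [ShortComplex.moduleCat_exact_iff]
    intro (x : ⋀[R]^0 U) hx
    change (koszulSeqAug r e).f 0 x = 0 at hx
    rw [koszulSeqAug_f_zero] at hx
    have hxI : exteriorPower.zeroEquiv R U x ∈ seqIdeal r :=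
      (Submodule.Quotient.mk_eq_zero _).1 hx
    obtain ⟨y, hy, hyx⟩ := exists_koszulD_eq_algebraMap (ξ := seqForm r e)
      (by rwa [Module.Basis.constr_range])
    refine ⟨(⟨y, hy⟩ : ⋀[R]^1 U), ?_⟩
    change (koszulComplex (seqForm r e)).d (0 + 1) 0 (⟨y, hy⟩ : ⋀[R]^1 U) = _
    rw [koszulComplex_d]
    exact Subtype.ext (hyx.trans (algebraMap_zeroEquiv x))
  · change Epi ((koszulSeqAug r e).f 0)
    rw [koszulSeqAug_f_zero]
    exact (ModuleCat.epi_iff_surjective (ModuleCat.ofHom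
      ((seqIdeal r).mkQ ∘ₗ (exteriorPower.zeroEquiv R U).toLinearMap))).2
      ((Submodule.mkQ_surjective _).comp (exteriorPower.zeroEquiv R U).surjective)

variable {r}

lemma IsRegularFamily.quasiIsoAt_koszulSeqAug_succ (hr : IsRegularFamily r) (p : ℕ) :
    QuasiIsoAt (koszulSeqAug r e) (p + 1) := by
  rw [quasiIsoAt_iff_exactAt' _ _ (ChainComplex.exactAt_succ_single_obj _ _),
    HomologicalComplex.exactAt_iff' _ (p + 2) (p + 1) p (by simp) (by simp),
    ShortComplex.moduleCat_exact_iff]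
  intro (x : ⋀[R]^(p + 1) U) hx
  change (koszulComplex (seqForm r e)).d (p + 1) p x = 0 at hx
  rw [koszulComplex_d] at hx
  obtain ⟨y, hy, hyx⟩ := hr.exists_koszulD_eq e x.2 (congrArg Subtype.val hx)
  refine ⟨(⟨y, hy⟩ : ⋀[R]^(p + 2) U), ?_⟩
  change (koszulComplex (seqForm r e)).d (p + 1 + 1) (p + 1) (⟨y, hy⟩ : ⋀[R]^(p + 2) U) = _
  rw [koszulComplex_d]
  exact Subtype.ext hyx

theorem IsRegularFamily.quasiIso_koszulSeqAug (hr : IsRegularFamily r) :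
    QuasiIso (koszulSeqAug r e) := by
  rw [quasiIso_iff]
  rintro (_ | p)
  · exact quasiIsoAt_koszulSeqAug_zero r e
  · exact hr.quasiIsoAt_koszulSeqAug_succ e p

end Resolution

lemma homologyMap_smul {R C κ : Type*} [Ring R] [Category* C] [Preadditive C] [Linear R C]
    {c : ComplexShape κ} {K L : HomologicalComplex C c} (a : R) (φ : K ⟶ L) (i : κ)
    [K.HasHomology i] [L.HasHomology i] :
    HomologicalComplex.homologyMap (a • φ) i = a • HomologicalComplex.homologyMap φ i :=
  ShortComplex.homologyMap_smul (φ := (HomologicalComplex.shortComplexFunctor C c i).map φ) a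

section LeftDerived
variable {C D : Type*} [Category* C] [Category* D] [Abelian C] [Abelian D]
  (F : C ⥤ D) [F.Additive]

lemma comp_map_f_d {K L : ChainComplex C ℕ} (φ : K ⟶ L) {p q : ℕ} {A : D}
    (x : A ⟶ ((F.mapHomologicalComplex (ComplexShape.down ℕ)).obj K).X p)
    (hx : x ≫ ((F.mapHomologicalComplex (ComplexShape.down ℕ)).obj K).d p q = 0) :
    (x ≫ ((F.mapHomologicalComplex (ComplexShape.down ℕ)).map φ).f p) ≫
      ((F.mapHomologicalComplex (ComplexShape.down ℕ)).obj L).d p q = 0 := by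
  rw [Category.assoc, HomologicalComplex.Hom.comm, ← Category.assoc, hx, zero_comp]

variable [EnoughProjectives C]

/-- `ProjectiveResolution.isoLeftDerivedObj`, with its target stated as a homology object instead of
a value of the homology functor, so that it composes with `HomologicalComplex.homologyπ`. -/
noncomputable def leftDerivedIsoHomology {Y : C} (P : ProjectiveResolution Y) (p : ℕ) :
    (F.leftDerived p).obj Y ≅
      ((F.mapHomologicalComplex (ComplexShape.down ℕ)).obj P.complex).homology p :=
  P.isoLeftDerivedObj F p

/-- The class in `L_p F(Y)` of a `p`-cycle of `F(P)`, where `P` is a projective resolution of `Y`.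
Cycles are generalized elements `x : A ⟶ F(P_p)`. -/
noncomputable def cycleClass {Y : C} (P : ProjectiveResolution Y) {p : ℕ} {A : D}
    (x : A ⟶ ((F.mapHomologicalComplex (ComplexShape.down ℕ)).obj P.complex).X p)
    (hx : ∀ q, x ≫ ((F.mapHomologicalComplex (ComplexShape.down ℕ)).obj P.complex).d p q = 0) :
    A ⟶ (F.leftDerived p).obj Y :=
  ((F.mapHomologicalComplex _).obj P.complex).liftCycles x _ rfl (hx _) ≫
    ((F.mapHomologicalComplex _).obj P.complex).homologyπ p ≫ (leftDerivedIsoHomology F P p).inv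

section CycleClass
variable {X Y : C} (P : ProjectiveResolution X) (Q : ProjectiveResolution Y) {p : ℕ} {A B : D}
  (x : A ⟶ ((F.mapHomologicalComplex (ComplexShape.down ℕ)).obj P.complex).X p)
  (hx : ∀ q, x ≫ ((F.mapHomologicalComplex (ComplexShape.down ℕ)).obj P.complex).d p q = 0)

lemma comp_cycleClass (b : B ⟶ A) :
    b ≫ cycleClass F P x hx = cycleClass F P (b ≫ x) fun q => by
      rw [Category.assoc, hx, comp_zero] := by
  rw [cycleClass, cycleClass, ← Category.assoc]
  congr 1
  rw [← cancel_mono (((F.mapHomologicalComplex _).obj P.complex).iCycles p), Category.assoc,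
    HomologicalComplex.liftCycles_i, HomologicalComplex.liftCycles_i]

lemma cycleClass_neg :
    cycleClass F P (-x) (fun q => by rw [Preadditive.neg_comp, hx, neg_zero]) =
      -cycleClass F P x hx := by
  rw [cycleClass, cycleClass, ← Preadditive.neg_comp]
  congr 1
  rw [← cancel_mono (((F.mapHomologicalComplex _).obj P.complex).iCycles p), Preadditive.neg_comp,
    HomologicalComplex.liftCycles_i, HomologicalComplex.liftCycles_i]

lemma cycleClass_sum {κ : Type*} (s : Finset κ)
    (y : κ → (A ⟶ ((F.mapHomologicalComplex (ComplexShape.down ℕ)).obj P.complex).X p))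
    (hy : ∀ j q, y j ≫ ((F.mapHomologicalComplex (ComplexShape.down ℕ)).obj P.complex).d p q = 0) :
    cycleClass F P (∑ j ∈ s, y j) (fun q => by
      rw [Preadditive.sum_comp, Finset.sum_eq_zero fun j _ => hy j q]) =
        ∑ j ∈ s, cycleClass F P (y j) (hy j) := by
  simp only [cycleClass]
  rw [← Preadditive.sum_comp]
  congr 1
  rw [← cancel_mono (((F.mapHomologicalComplex _).obj P.complex).iCycles p), Preadditive.sum_comp]
  simp only [HomologicalComplex.liftCycles_i]

lemma cycleClass_comp_leftDerivedIsoHomology_hom :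
    cycleClass F P x hx ≫ (leftDerivedIsoHomology F P p).hom =
      ((F.mapHomologicalComplex _).obj P.complex).liftCycles x _ rfl (hx _) ≫
        ((F.mapHomologicalComplex _).obj P.complex).homologyπ p := by
  rw [cycleClass, Category.assoc, Category.assoc, Iso.inv_hom_id, Category.comp_id]

lemma cycleClass_comp_map (f : X ⟶ Y) (φ : P.complex ⟶ Q.complex)
    (hφ : φ.f 0 ≫ Q.π.f 0 = P.π.f 0 ≫ f) :
    cycleClass F P x hx ≫ (F.leftDerived p).map f =
      cycleClass F Q (x ≫ ((F.mapHomologicalComplex _).map φ).f p)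
        fun q => comp_map_f_d F φ x (hx q) := by
  have naturality : (F.leftDerived p).map f ≫ (leftDerivedIsoHomology F Q p).hom =
      (leftDerivedIsoHomology F P p).hom ≫
        HomologicalComplex.homologyMap ((F.mapHomologicalComplex _).map φ) p :=
    ProjectiveResolution.isoLeftDerivedObj_hom_naturality f P Q φ hφ F p
  rw [← cancel_mono (leftDerivedIsoHomology F Q p).hom, cycleClass_comp_leftDerivedIsoHomology_hom,
    Category.assoc, naturality, ← Category.assoc, cycleClass_comp_leftDerivedIsoHomology_hom,
    Category.assoc, HomologicalComplex.homologyπ_naturality, ← Category.assoc,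
    HomologicalComplex.liftCycles_comp_cyclesMap]

lemma cycleClass_comp_fromLeftDerivedZero
    (x : A ⟶ ((F.mapHomologicalComplex (ComplexShape.down ℕ)).obj P.complex).X 0)
    (hx : ∀ q, x ≫ ((F.mapHomologicalComplex (ComplexShape.down ℕ)).obj P.complex).d 0 q = 0) :
    cycleClass F P x hx ≫ F.fromLeftDerivedZero.app X = x ≫ F.map (P.π.f 0) := by
  have fromLeftDerivedZero_eq : F.fromLeftDerivedZero.app X = (leftDerivedIsoHomology F P 0).hom ≫
      ((F.mapHomologicalComplex _).obj P.complex).homologyι 0 ≫ P.fromLeftDerivedZero' F :=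
    P.fromLeftDerivedZero_eq F
  rw [fromLeftDerivedZero_eq, ← Category.assoc, cycleClass_comp_leftDerivedIsoHomology_hom,
    Category.assoc, HomologicalComplex.homology_π_ι_assoc, HomologicalComplex.liftCycles_i_assoc]
  exact congrArg _ (P.pOpcycles_comp_fromLeftDerivedZero' F)

end CycleClass

lemma leftDerived_map_add (p : ℕ) {X Y : C} (f g : X ⟶ Y) :
    (F.leftDerived p).map (f + g) = (F.leftDerived p).map f + (F.leftDerived p).map g := by
  have hf := ProjectiveResolution.lift_commutes f (projectiveResolution X) (projectiveResolution Y)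
  have hg := ProjectiveResolution.lift_commutes g (projectiveResolution X) (projectiveResolution Y)
  rw [F.leftDerived_map_eq p f _ hf, F.leftDerived_map_eq p g _ hg,
    F.leftDerived_map_eq p (f + g) _ (by
      rw [Functor.map_add, Preadditive.comp_add, ← hf, ← hg, ← Preadditive.add_comp]),
    Functor.map_add, Preadditive.add_comp, Preadditive.comp_add]

lemma leftDerived_map_smul {R : Type*} [Ring R] [Linear R C] [Linear R D] [F.Linear R] (p : ℕ)
    {X Y : C} (a : R) (f : X ⟶ Y) :
    (F.leftDerived p).map (a • f) = a • (F.leftDerived p).map f := by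
  have hf := ProjectiveResolution.lift_commutes f (projectiveResolution X) (projectiveResolution Y)
  rw [F.leftDerived_map_eq p f _ hf, F.leftDerived_map_eq p (a • f)
    (a • ProjectiveResolution.lift f (projectiveResolution X) (projectiveResolution Y)) (by
      refine HomologicalComplex.to_single_hom_ext ?_
      have hf₀ := congrArg (fun φ => φ.f 0) hf
      simp only [HomologicalComplex.comp_f, ChainComplex.single₀_map_f_zero,
        HomologicalComplex.smul_f_apply, Linear.smul_comp] at hf₀ ⊢
      rw [hf₀]
      exact (Linear.comp_smul _ _ _ _ _ _).symm), ← Linear.comp_smul, ← Linear.smul_comp]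
  congr 2
  change HomologicalComplex.homologyMap _ p = _ • HomologicalComplex.homologyMap _ p
  rw [Functor.map_smul]
  exact homologyMap_smul a _ p

end LeftDerived

section TorMap
variable {R : Type u} [CommRing R] (I : Ideal R) {N N' N'' : Type u} [AddCommGroup N] [Module R N]
  [AddCommGroup N'] [Module R N'] [AddCommGroup N''] [Module R N'']

lemma torMap_comp (g : N' →ₗ[R] N'') (f : N →ₗ[R] N') (p : ℕ) :
    torMap I (g ∘ₗ f) p = torMap I g p ∘ₗ torMap I f p :=
  congrArg ModuleCat.Hom.hom (Functor.map_comp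
    ((Tor (ModuleCat.{u} R) p).obj (ModuleCat.of R (R ⧸ I))) (ModuleCat.ofHom f)
    (ModuleCat.ofHom g))

lemma torMap_id (p : ℕ) : torMap I (LinearMap.id : N →ₗ[R] N) p = LinearMap.id :=
  congrArg ModuleCat.Hom.hom (CategoryTheory.Functor.map_id
    ((Tor (ModuleCat.{u} R) p).obj (ModuleCat.of R (R ⧸ I))) (ModuleCat.of R N))

variable (N N') in
/-- The linear map `f ↦ Tor_p^R(R/I, f)`. -/
noncomputable def torMapHom (p : ℕ) :
    (N →ₗ[R] N') →ₗ[R] (TorQ I N p →ₗ[R] TorQ I N' p) where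
  toFun f := torMap I f p
  map_add' f g := congrArg ModuleCat.Hom.hom (leftDerived_map_add
    ((MonoidalCategory.tensoringLeft (ModuleCat.{u} R)).obj (ModuleCat.of R (R ⧸ I))) p
    (ModuleCat.ofHom f) (ModuleCat.ofHom g))
  map_smul' a f := congrArg ModuleCat.Hom.hom (leftDerived_map_smul
    ((MonoidalCategory.tensoringLeft (ModuleCat.{u} R)).obj (ModuleCat.of R (R ⧸ I))) p a
    (ModuleCat.ofHom f))

lemma torMapHom_apply (p : ℕ) (f : N →ₗ[R] N') : torMapHom I N N' p f = torMap I f p := rfl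

end TorMap

section KoszulClass
variable {R : Type u} [CommRing R] {U : Type u} [AddCommGroup U] [Module R U] {n : ℕ}
  {r : Fin n → R} {e : Module.Basis (Fin n) R U} (hK : QuasiIso (koszulSeqAug r e))

/-- The functor `R/I ⊗ -` for `I = (r_1, …, r_n)`. -/
noncomputable abbrev tensorFunctor (r : Fin n → R) : ModuleCat.{u} R ⥤ ModuleCat.{u} R :=
  (MonoidalCategory.tensoringLeft (ModuleCat.{u} R)).obj (ModuleCat.of R (R ⧸ seqIdeal r))

/-- The functor `R/I ⊗ -` on chain complexes, for `I = (r_1, …, r_n)`. -/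
noncomputable abbrev tensorComplex (r : Fin n → R) :
    ChainComplex (ModuleCat.{u} R) ℕ ⥤ ChainComplex (ModuleCat.{u} R) ℕ :=
  (tensorFunctor r).mapHomologicalComplex (ComplexShape.down ℕ)

lemma torMap_koszulClass {N : Type u} [AddCommGroup N] [Module R N]
    (P : ProjectiveResolution (ModuleCat.of R N)) (g : (R ⧸ seqIdeal r) →ₗ[R] N)
    (c : koszulComplex (seqForm r e) ⟶ P.complex)
    (hc : c.f 0 ≫ P.π.f 0 = (koszulSeqAug r e).f 0 ≫ ModuleCat.ofHom g) (p : ℕ) :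
    ModuleCat.ofHom (koszulClass r e hK p) ≫ ModuleCat.ofHom (torMap (seqIdeal r) g p) =
      cycleClass (tensorFunctor r) P (oneTensor r e p ≫ ((tensorComplex r).map c).f p)
        fun q => comp_map_f_d (tensorFunctor r) c (oneTensor r e p) (oneTensor_d r e p q) :=
  cycleClass_comp_map (tensorFunctor r) (koszulResolution r e hK) P (oneTensor r e p)
    (oneTensor_d r e p) (ModuleCat.ofHom g) c hc

end KoszulClass

section KoszulTensor
variable {R : Type u} [CommRing R] {U : Type u} [AddCommGroup U] [Module R U] {n : ℕ}

lemma koszulTensor_d (r : Fin n → R) (e : Module.Basis (Fin n) R U) (p q : ℕ) :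
    (koszulTensor r e).d p q = 0 := by
  refine ModuleCat.hom_ext (TensorProduct.ext' fun a x => ?_)
  obtain ⟨a, rfl⟩ := Ideal.Quotient.mk_surjective a
  have ha : Ideal.Quotient.mk (seqIdeal r) a = a • (1 : R ⧸ seqIdeal r) := by
    rw [Algebra.smul_def, mul_one]; rfl
  have h_one : (koszulTensor r e).d p q ((1 : R ⧸ seqIdeal r) ⊗ₜ[R] x) = 0 :=
    congrArg (fun f => f.hom x) (oneTensor_d r e p q)
  rw [ha, ← TensorProduct.smul_tmul']
  exact (map_smul ((koszulTensor r e).d p q).hom a _).trans (by rw [h_one, smul_zero]; rfl)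

variable {r : Fin n → R} {e : Module.Basis (Fin n) R U} (hK : QuasiIso (koszulSeqAug r e))

/-- The differential of `R/I ⊗ K(r_1, …, r_n)` vanishes, so its degree `p` part is
`Tor_p^R(R/I, R/I)`. -/
noncomputable def koszulTensorEquiv (p : ℕ) :
    ((R ⧸ seqIdeal r) ⊗[R] ⋀[R]^p U) ≃ₗ[R] TorQ (seqIdeal r) (R ⧸ seqIdeal r) p :=
  (((koszulTensor r e).iCyclesIso p _ rfl (koszulTensor_d r e _ _)).symm ≪≫
    ((koszulTensor r e).isoHomologyπ _ p rfl (koszulTensor_d r e _ _)) ≪≫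
    ((koszulResolution r e hK).isoLeftDerivedObj (tensorFunctor r) p).symm).toLinearEquiv

lemma koszulTensorEquiv_one_tmul (p : ℕ) (x : ⋀[R]^p U) :
    koszulTensorEquiv hK p (1 ⊗ₜ x) = koszulClass r e hK p x := by
  have h_cycles : oneTensor r e p ≫
      ((koszulTensor r e).iCyclesIso p _ rfl (koszulTensor_d r e _ _)).inv =
      (koszulTensor r e).liftCycles (oneTensor r e p) _ rfl (oneTensor_d r e p _) := by
    rw [← cancel_mono ((koszulTensor r e).iCycles p), HomologicalComplex.liftCycles_i,
      Category.assoc, HomologicalComplex.iCyclesIso_inv_hom_id, Category.comp_id]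
  exact congrArg (fun f => (f ≫ (koszulTensor r e).homologyπ p ≫
    ((koszulResolution r e hK).isoLeftDerivedObj (tensorFunctor r) p).inv).hom x) h_cycles

end KoszulTensor

section QuotHom
variable {R : Type*} [CommRing R] {I : Ideal R} {N : Type*} [AddCommGroup N] [Module R N]

/-- Homomorphisms from `R/I` to a module `N` killed by `I` correspond to elements of `N`, by
evaluation at `1`. -/
noncomputable def quotHomEquiv (hN : ∀ a ∈ I, ∀ x : N, a • x = 0) :
    ((R ⧸ I) →ₗ[R] N) ≃ₗ[R] N where
  toFun g := g 1
  map_add' _ _ := rfl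
  map_smul' _ _ := rfl
  invFun x := Submodule.liftQ I (LinearMap.toSpanSingleton R N x) fun a ha => hN a ha x
  left_inv g := by
    refine Submodule.linearMap_qext _ (LinearMap.ext_ring ?_)
    exact one_smul R (g 1)
  right_inv x := one_smul R x

end QuotHom

section Pairing
variable {R : Type u} [CommRing R] {U : Type u} [AddCommGroup U] [Module R U] {n : ℕ}
  {r : Fin n → R} {e : Module.Basis (Fin n) R U} (hK : QuasiIso (koszulSeqAug r e))
  (N : Type u) [AddCommGroup N] [Module R N]

/-- The pairing `g ⊗ x ↦ g_* κ(x)`, natural in `N`. -/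
noncomputable def torPairing (p : ℕ) :
    (((R ⧸ seqIdeal r) →ₗ[R] N) ⊗[R] ⋀[R]^p U) →ₗ[R] TorQ (seqIdeal r) N p :=
  TensorProduct.lift
    ((torMapHom (seqIdeal r) (R ⧸ seqIdeal r) N p).compl₂ (koszulClass r e hK p))

lemma torPairing_tmul (p : ℕ) (g : (R ⧸ seqIdeal r) →ₗ[R] N) (x : ⋀[R]^p U) :
    torPairing hK N p (g ⊗ₜ x) = torMap (seqIdeal r) g p (koszulClass r e hK p x) := rfl

variable {N}

lemma torPairing_rTensor_compRight {N' : Type u} [AddCommGroup N'] [Module R N'] (h : N →ₗ[R] N')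
    (p : ℕ) (y : ((R ⧸ seqIdeal r) →ₗ[R] N) ⊗[R] ⋀[R]^p U) :
    torPairing hK N' p ((h.compRight R).rTensor _ y) =
      torMap (seqIdeal r) h p (torPairing hK N p y) := by
  induction y with
  | zero => simp only [map_zero]
  | add y z hy hz => simp only [map_add, hy, hz]
  | tmul g x =>
    rw [LinearMap.rTensor_tmul, torPairing_tmul, torPairing_tmul, LinearMap.compRight_apply,
      torMap_comp, LinearMap.comp_apply]

lemma torPairing_quot_bijective (p : ℕ) :
    Function.Bijective (torPairing hK (R ⧸ seqIdeal r) p) := by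
  let E : ((R ⧸ seqIdeal r) →ₗ[R] (R ⧸ seqIdeal r)) ≃ₗ[R] (R ⧸ seqIdeal r) :=
    quotHomEquiv fun a ha x => by
      rw [Algebra.smul_def, Ideal.Quotient.algebraMap_eq, Ideal.Quotient.eq_zero_iff_mem.2 ha,
        zero_mul]
  have h_eq : torPairing hK (R ⧸ seqIdeal r) p =
      ((E.rTensor (⋀[R]^p U)) ≪≫ₗ koszulTensorEquiv hK p).toLinearMap := by
    refine TensorProduct.ext' fun g x => ?_
    obtain ⟨a, ha⟩ := Ideal.Quotient.mk_surjective (g 1)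
    have hg_one : g 1 = a • (1 : R ⧸ seqIdeal r) := by
      rw [← ha, Algebra.smul_def, mul_one, Ideal.Quotient.algebraMap_eq]
    have hg : g = a • LinearMap.id := E.injective hg_one
    calc torPairing hK (R ⧸ seqIdeal r) p (g ⊗ₜ x) = a • koszulClass r e hK p x := by
          rw [torPairing_tmul, hg, ← torMapHom_apply, map_smul, torMapHom_apply, torMap_id,
            LinearMap.smul_apply, LinearMap.id_apply]
      _ = koszulTensorEquiv hK p ((a • (1 : R ⧸ seqIdeal r)) ⊗ₜ x) := by
          rw [← TensorProduct.smul_tmul', map_smul, koszulTensorEquiv_one_tmul]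
      _ = koszulTensorEquiv hK p (g 1 ⊗ₜ x) := by rw [hg_one]
  rw [h_eq]
  exact LinearEquiv.bijective _

section Projective
variable {κ : Type*} [Fintype κ] {i : κ → (R ⧸ seqIdeal r) →ₗ[R] N}
  {q : κ → N →ₗ[R] (R ⧸ seqIdeal r)}

lemma torPairing_injective (hiq : ∑ k, i k ∘ₗ q k = LinearMap.id) (p : ℕ) :
    Function.Injective (torPairing hK N p) := by
  refine (injective_iff_map_eq_zero _).2 fun y hy => ?_
  have hq (k : κ) : ((q k).compRight R).rTensor (⋀[R]^p U) y = 0 := by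
    refine (torPairing_quot_bijective hK p).1 ?_
    rw [torPairing_rTensor_compRight, hy, map_zero, map_zero]
  have hsum : ∑ k, (i k).compRight R ∘ₗ (q k).compRight R =
      (LinearMap.id : ((R ⧸ seqIdeal r) →ₗ[R] N) →ₗ[R] _) := by
    refine LinearMap.ext fun g => ?_
    rw [LinearMap.sum_apply]
    refine Eq.trans (LinearMap.ext fun a => ?_) (congrArg (· ∘ₗ g) hiq)
    simp only [LinearMap.sum_apply, LinearMap.comp_apply, LinearMap.compRight_apply]
  calc y = LinearMap.rTensor (⋀[R]^p U) (∑ k, (i k).compRight R ∘ₗ (q k).compRight R) y := by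
        rw [hsum, LinearMap.rTensor_id, LinearMap.id_apply]
    _ = ∑ k, ((i k).compRight R).rTensor (⋀[R]^p U) (((q k).compRight R).rTensor _ y) := by
        rw [← LinearMap.coe_rTensorHom, map_sum, LinearMap.sum_apply]
        simp only [LinearMap.coe_rTensorHom, LinearMap.rTensor_comp, LinearMap.comp_apply]
    _ = 0 := Finset.sum_eq_zero fun k _ => by rw [hq, map_zero]

lemma torPairing_surjective (hiq : ∑ k, i k ∘ₗ q k = LinearMap.id) (p : ℕ) :
    Function.Surjective (torPairing hK N p) := by
  intro t
  choose y hy using fun k => (torPairing_quot_bijective hK p).2 (torMap (seqIdeal r) (q k) p t)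
  refine ⟨∑ k, ((i k).compRight R).rTensor (⋀[R]^p U) (y k), ?_⟩
  calc torPairing hK N p (∑ k, ((i k).compRight R).rTensor (⋀[R]^p U) (y k))
      = ∑ k, torMap (seqIdeal r) (i k ∘ₗ q k) p t := by
        simp only [map_sum, torPairing_rTensor_compRight, hy, torMap_comp, LinearMap.comp_apply]
    _ = t := by
        simp only [← torMapHom_apply]
        rw [← LinearMap.sum_apply, ← map_sum, hiq, torMapHom_apply, torMap_id, LinearMap.id_apply]

end Projective

end Pairing

/-! ### The connecting homomorphism -/

section TwistedLift
variable {C : Type u} [Category.{v} C] [Abelian C] {K : ChainComplex C ℕ}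
  [∀ p, Projective (K.X p)]

open Horseshoe

lemma exists_twisted_lift {Y : C}
    (P : ProjectiveResolution Y) (θ : ∀ p, K.X (p + 1) ⟶ P.complex.X p)
    (hθ : ∀ p, θ (p + 1) ≫ P.complex.d (p + 1) p + K.d (p + 2) (p + 1) ≫ θ p = 0)
    (ε : K.X 0 ⟶ Y) (hε : K.d 1 0 ≫ ε + θ 0 ≫ aug P = 0) :
    ∃ h : ∀ p, K.X p ⟶ P.complex.X p, h 0 ≫ aug P = ε ∧
      ∀ p, h (p + 1) ≫ P.complex.d (p + 1) p = K.d (p + 1) p ≫ h p + θ p := by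
  let lift₀ : K.X 0 ⟶ P.complex.X 0 := Projective.factorThru ε (aug P)
  have lift₀_aug : lift₀ ≫ aug P = ε := Projective.factorThru_comp _ _
  have obstruction₀ : (K.d 1 0 ≫ lift₀ + θ 0) ≫ aug P = 0 := by
    rw [Preadditive.add_comp, Category.assoc, lift₀_aug, hε]
  let Square (p : ℕ) := {h : (K.X p ⟶ P.complex.X p) × (K.X (p + 1) ⟶ P.complex.X (p + 1)) //
    h.2 ≫ P.complex.d (p + 1) p = K.d (p + 1) p ≫ h.1 + θ p}
  have obstruction {p : ℕ} (h : Square p) :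
      (K.d (p + 2) (p + 1) ≫ h.1.2 + θ (p + 1)) ≫ P.complex.d (p + 1) p = 0 := by
    rw [Preadditive.add_comp, Category.assoc, h.2, Preadditive.comp_add,
      HomologicalComplex.d_comp_d_assoc, zero_comp, zero_add]
    exact (add_comm _ _).trans (hθ p)
  let next (p : ℕ) (h : Square p) : Square (p + 1) :=
    ⟨(h.1.2, (P.exact_succ p).liftFromProjective _ (obstruction h)),
      (P.exact_succ p).liftFromProjective_comp _ _⟩
  let squares (p : ℕ) : Square p := Nat.rec
    ⟨(lift₀, (aug_exact P).liftFromProjective _ obstruction₀),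
      (aug_exact P).liftFromProjective_comp _ _⟩ next p
  exact ⟨fun p => (squares p).1.1, lift₀_aug, fun p => (squares p).2⟩

variable {S : ShortComplex C} (T : ResolvedSequence S)

lemma resolvedSequence_f_aug : T.f.f 0 ≫ aug T.P₂ = aug T.P₁ ≫ S.f := by
  have := congrArg (fun φ => φ.f 0) T.comm_f
  rwa [HomologicalComplex.comp_f, HomologicalComplex.comp_f,
    ChainComplex.single₀_map_f_zero] at this

lemma resolvedSequence_g_aug : T.g.f 0 ≫ aug T.P₃ = aug T.P₂ ≫ S.g := by
  have := congrArg (fun φ => φ.f 0) T.comm_g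
  rwa [HomologicalComplex.comp_f, HomologicalComplex.comp_f,
    ChainComplex.single₀_map_f_zero] at this

lemma exists_lift_of_twist (θ : ∀ p, K.X (p + 1) ⟶ T.P₁.complex.X p)
    (hθ : ∀ p, θ (p + 1) ≫ T.P₁.complex.d (p + 1) p + K.d (p + 2) (p + 1) ≫ θ p = 0)
    (ε : K.X 0 ⟶ S.X₂) (hε : K.d 1 0 ≫ ε + θ 0 ≫ aug T.P₁ ≫ S.f = 0) :
    ∃ (h : ∀ p, K.X p ⟶ T.P₂.complex.X p) (k : K ⟶ T.P₃.complex),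
      (∀ p, h (p + 1) ≫ T.P₂.complex.d (p + 1) p = K.d (p + 1) p ≫ h p + θ p ≫ T.f.f p) ∧
      (∀ p, h p ≫ T.g.f p = k.f p) ∧ k.f 0 ≫ aug T.P₃ = ε ≫ S.g := by
  obtain ⟨h, h_aug, h_d⟩ := exists_twisted_lift T.P₂ (fun p => θ p ≫ T.f.f p)
    (fun p => by
      rw [Category.assoc, HomologicalComplex.Hom.comm, ← Category.assoc, ← Category.assoc,
        ← Preadditive.add_comp, hθ, zero_comp]) ε
    (by rw [Category.assoc, resolvedSequence_f_aug, hε])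
  have f_comp_g (p : ℕ) : T.f.f p ≫ T.g.f p = 0 := congrArg (fun φ => φ.f p) T.zero
  -- `h` fails to be a chain map only by `θ`, which has values in `P₁` and vanishes in `P₃`.
  let k : K ⟶ T.P₃.complex :=
    { f := fun p => h p ≫ T.g.f p
      comm' := by
        rintro _ p rfl
        rw [Category.assoc, HomologicalComplex.Hom.comm, ← Category.assoc, h_d,
          Preadditive.add_comp, Category.assoc, Category.assoc, f_comp_g, comp_zero, add_zero] }
  refine ⟨h, k, h_d, fun _ => rfl, ?_⟩
  change (h 0 ≫ T.g.f 0) ≫ aug T.P₃ = _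
  rw [Category.assoc, resolvedSequence_g_aug, ← Category.assoc, h_aug]

end TwistedLift

section ConnectingHomomorphism
variable {C : Type u} [Category.{v} C] [Abelian C] [EnoughProjectives C] {D : Type w}
  [Category.{v} D] [Abelian D] (F : C ⥤ D) [F.Additive]
  {S : ShortComplex C} (T : ResolvedSequence S)

lemma cycleClass_comp_δ {A : D} {p : ℕ}
    {z : A ⟶ ((F.mapHomologicalComplex (ComplexShape.down ℕ)).obj T.P₃.complex).X (p + 1)}
    {y : A ⟶ ((F.mapHomologicalComplex (ComplexShape.down ℕ)).obj T.P₂.complex).X (p + 1)}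
    {x : A ⟶ ((F.mapHomologicalComplex (ComplexShape.down ℕ)).obj T.P₁.complex).X p}
    (hyz : y ≫ ((F.mapHomologicalComplex _).map T.g).f (p + 1) = z)
    (hxy : x ≫ ((F.mapHomologicalComplex _).map T.f).f p =
      y ≫ ((F.mapHomologicalComplex _).obj T.P₂.complex).d (p + 1) p)
    (hz : ∀ q, z ≫ ((F.mapHomologicalComplex _).obj T.P₃.complex).d (p + 1) q = 0)
    (hx : ∀ q, x ≫ ((F.mapHomologicalComplex _).obj T.P₁.complex).d p q = 0) :
    cycleClass F T.P₃ z hz ≫ T.δ F p = cycleClass F T.P₁ x hx := by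
  obtain ⟨δ, hδ⟩ : ∃ δ : ((F.mapHomologicalComplex _).obj T.P₃.complex).homology (p + 1) ⟶
      ((F.mapHomologicalComplex _).obj T.P₁.complex).homology p,
    δ = (T.shortExact_map F).δ (p + 1) p rfl := ⟨_, rfl⟩
  have T_δ : T.δ F p = (leftDerivedIsoHomology F T.P₃ (p + 1)).hom ≫ δ ≫
    (leftDerivedIsoHomology F T.P₁ p).inv := by rw [hδ]; rfl
  have snake : ((F.mapHomologicalComplex _).obj T.P₃.complex).liftCycles z p
        (ChainComplex.next_nat_succ p) (hz p) ≫
      ((F.mapHomologicalComplex _).obj T.P₃.complex).homologyπ (p + 1) ≫ δ =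
      ((F.mapHomologicalComplex _).obj T.P₁.complex).liftCycles x _ rfl (hx _) ≫
        ((F.mapHomologicalComplex _).obj T.P₁.complex).homologyπ p := by
    rw [hδ]
    exact (T.shortExact_map F).δ_eq (p + 1) p rfl z (hz p) y hyz x hxy _ rfl
  rw [T_δ, ← Category.assoc, cycleClass_comp_leftDerivedIsoHomology_hom, Category.assoc,
    ← Category.assoc _ δ, ← Category.assoc _ _ (leftDerivedIsoHomology F T.P₁ p).inv,
    Iso.comp_inv_eq, cycleClass_comp_leftDerivedIsoHomology_hom, ← snake]
  congr 1

lemma cycleClass_comp_δ_of_twist {K : ChainComplex C ℕ} {h : ∀ p, K.X p ⟶ T.P₂.complex.X p}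
    {θ : ∀ p, K.X (p + 1) ⟶ T.P₁.complex.X p} {k : K ⟶ T.P₃.complex}
    (h_d : ∀ p, h (p + 1) ≫ T.P₂.complex.d (p + 1) p = K.d (p + 1) p ≫ h p + θ p ≫ T.f.f p)
    (h_g : ∀ p, h p ≫ T.g.f p = k.f p) {A : D} {p : ℕ} {x : A ⟶ F.obj (K.X (p + 1))}
    (hx : x ≫ F.map (K.d (p + 1) p) = 0)
    (hxk : ∀ q, (x ≫ F.map (k.f (p + 1))) ≫ F.map (T.P₃.complex.d (p + 1) q) = 0)
    (hxθ : ∀ q, (x ≫ F.map (θ p)) ≫ F.map (T.P₁.complex.d p q) = 0) :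
    cycleClass F T.P₃ (p := p + 1) (x ≫ F.map (k.f (p + 1))) hxk ≫ T.δ F p =
      cycleClass F T.P₁ (p := p) (x ≫ F.map (θ p)) hxθ := by
  have lift_g : (x ≫ F.map (h (p + 1))) ≫ F.map (T.g.f (p + 1)) = x ≫ F.map (k.f (p + 1)) := by
    rw [Category.assoc, ← F.map_comp, h_g]
  have lift_d : (x ≫ F.map (θ p)) ≫ F.map (T.f.f p) =
      (x ≫ F.map (h (p + 1))) ≫ F.map (T.P₂.complex.d (p + 1) p) := by
    rw [Category.assoc, Category.assoc, ← F.map_comp, ← F.map_comp, h_d, F.map_add,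
      Preadditive.comp_add, F.map_comp (K.d _ _), reassoc_of% hx, zero_comp, zero_add]
  exact cycleClass_comp_δ F T (p := p) lift_g lift_d _ _

end ConnectingHomomorphism

section KoszulTwist
variable {R : Type u} [CommRing R] {U : Type u} [AddCommGroup U] [Module R U] {n : ℕ}
  (r : Fin n → R) (e : Module.Basis (Fin n) R U)

lemma koszulDeg_seqForm (p : ℕ) (x : ⋀[R]^(p + 1) U) :
    koszulDeg (seqForm r e) p x = ∑ j, r j • koszulDeg (e.coord j) p x := by
  refine Subtype.ext ?_
  rw [Submodule.coe_sum]
  exact koszulD_constr e r x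

/-- The contraction `⋀^{p+1} U → ⋀^p U` with the `j`-th coordinate form, as a morphism between terms
of the Koszul complex. -/
noncomputable def koszulContract (j : Fin n) (p : ℕ) :
    (koszulComplex (seqForm r e)).X (p + 1) ⟶ (koszulComplex (seqForm r e)).X p :=
  ModuleCat.ofHom (koszulDeg (e.coord j) p)

lemma koszulContract_d (j : Fin n) (p : ℕ) :
    koszulContract r e j (p + 1) ≫ (koszulComplex (seqForm r e)).d (p + 1) p =
      -((koszulComplex (seqForm r e)).d (p + 2) (p + 1) ≫ koszulContract r e j p) := by
  rw [koszulComplex_d, koszulComplex_d]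
  exact ModuleCat.hom_ext (LinearMap.ext fun x => Subtype.ext
    (koszulD_comm (seqForm r e) (e.coord j) x.1))

variable {r e}

/-- The map `-∑ⱼ cⱼ ∘ ιⱼ` of degree `-1`, where `ιⱼ` is the contraction with the `j`-th coordinate
form. It anticommutes with the differentials. -/
noncomputable def koszulTwist {L : ChainComplex (ModuleCat.{u} R) ℕ}
    (c : Fin n → (koszulComplex (seqForm r e) ⟶ L)) (p : ℕ) :
    (koszulComplex (seqForm r e)).X (p + 1) ⟶ L.X p :=
  -∑ j, koszulContract r e j p ≫ (c j).f p

lemma koszulTwist_d {L : ChainComplex (ModuleCat.{u} R) ℕ}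
    (c : Fin n → (koszulComplex (seqForm r e) ⟶ L)) (p : ℕ) :
    koszulTwist c (p + 1) ≫ L.d (p + 1) p +
      (koszulComplex (seqForm r e)).d (p + 2) (p + 1) ≫ koszulTwist c p = 0 := by
  simp only [koszulTwist, Preadditive.neg_comp, Preadditive.comp_neg, Preadditive.sum_comp,
    Preadditive.comp_sum, Category.assoc, HomologicalComplex.Hom.comm]
  simp only [← Category.assoc, koszulContract_d, Preadditive.neg_comp, Finset.sum_neg_distrib,
    neg_neg, add_neg_cancel]

variable {N : Type u} [AddCommGroup N] [Module R N] {P : ProjectiveResolution (ModuleCat.of R N)}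
  {c : Fin n → (koszulComplex (seqForm r e) ⟶ P.complex)} {g : Fin n → (R ⧸ seqIdeal r) →ₗ[R] N}

lemma koszulTwist_zero_comp_π
    (hc : ∀ j, (c j).f 0 ≫ P.π.f 0 = (koszulSeqAug r e).f 0 ≫ ModuleCat.ofHom (g j)) :
    koszulTwist c 0 ≫ P.π.f 0 = ModuleCat.ofHom
      (-∑ j, g j ∘ₗ (seqIdeal r).mkQ ∘ₗ (exteriorPower.zeroEquiv R U).toLinearMap ∘ₗ
        koszulDeg (e.coord j) 0) := by
  simp only [koszulTwist, Preadditive.neg_comp, Preadditive.sum_comp, Category.assoc, hc,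
    koszulSeqAug_f_zero]
  refine ModuleCat.hom_ext ?_
  rw [ModuleCat.hom_neg, ModuleCat.hom_sum]
  rfl

lemma oneTensor_koszulTwist (p : ℕ) :
    oneTensor r e (p + 1) ≫ (tensorFunctor r).map (koszulTwist c p) =
      -∑ j, ModuleCat.ofHom (koszulDeg (e.coord j) p) ≫ oneTensor r e p ≫
        ((tensorComplex r).map (c j)).f p := by
  have map_twist : (tensorFunctor r).map (koszulTwist c p) =
      -∑ j, (tensorFunctor r).map (koszulContract r e j p) ≫ (tensorFunctor r).map ((c j).f p) := by
    simp only [koszulTwist, Functor.map_neg, Functor.map_sum, Functor.map_comp]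
  exact (congrArg (oneTensor r e (p + 1) ≫ ·) map_twist).trans
    ((Preadditive.comp_neg _ _).trans (congrArg Neg.neg (Preadditive.comp_sum _ _ _)))

lemma koszulDeg_comp_oneTensor_map_d (j : Fin n) (p q : ℕ) :
    (ModuleCat.ofHom (koszulDeg (e.coord j) p) ≫ oneTensor r e p ≫
      ((tensorComplex r).map (c j)).f p) ≫ ((tensorComplex r).obj P.complex).d p q = 0 := by
  rw [Category.assoc, comp_map_f_d (tensorFunctor r) (c j) (oneTensor r e p)
    (oneTensor_d r e p q), comp_zero]

lemma oneTensor_koszulTwist_d (p q : ℕ) :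
    (oneTensor r e (p + 1) ≫ (tensorFunctor r).map (koszulTwist c p)) ≫
      ((tensorComplex r).obj P.complex).d p q = 0 := by
  refine (congrArg (· ≫ ((tensorComplex r).obj P.complex).d p q)
    (oneTensor_koszulTwist p)).trans ?_
  rw [Preadditive.neg_comp, Preadditive.sum_comp,
    Finset.sum_eq_zero fun j _ => koszulDeg_comp_oneTensor_map_d j p q, neg_zero]

lemma cycleClass_koszulTwist (hK : QuasiIso (koszulSeqAug r e))
    (hc : ∀ j, (c j).f 0 ≫ P.π.f 0 = (koszulSeqAug r e).f 0 ≫ ModuleCat.ofHom (g j)) (p : ℕ) :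
    cycleClass (tensorFunctor r) P (p := p)
        (oneTensor r e (p + 1) ≫ (tensorFunctor r).map (koszulTwist c p))
        (oneTensor_koszulTwist_d p) =
      ModuleCat.ofHom (-∑ j, torMap (seqIdeal r) (g j) p ∘ₗ koszulClass r e hK p ∘ₗ
        koszulDeg (e.coord j) p) := by
  have sum_cycle (q : ℕ) : (∑ j, ModuleCat.ofHom (koszulDeg (e.coord j) p) ≫ oneTensor r e p ≫
      ((tensorComplex r).map (c j)).f p) ≫ ((tensorComplex r).obj P.complex).d p q = 0 := by
    rw [Preadditive.sum_comp, Finset.sum_eq_zero fun j _ => koszulDeg_comp_oneTensor_map_d j p q]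
  have contract_class (j : Fin n) : cycleClass (tensorFunctor r) P (p := p)
      (ModuleCat.ofHom (koszulDeg (e.coord j) p) ≫ oneTensor r e p ≫
        ((tensorComplex r).map (c j)).f p) (koszulDeg_comp_oneTensor_map_d j p) =
      ModuleCat.ofHom (torMap (seqIdeal r) (g j) p ∘ₗ koszulClass r e hK p ∘ₗ
        koszulDeg (e.coord j) p) :=
    (comp_cycleClass (tensorFunctor r) P _ _ _).symm.trans
      (congrArg (ModuleCat.ofHom (koszulDeg (e.coord j) p) ≫ ·)
        (torMap_koszulClass hK P (g j) (c j) (hc j) p).symm)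
  have twist_class : cycleClass (tensorFunctor r) P (p := p)
      (oneTensor r e (p + 1) ≫ (tensorFunctor r).map (koszulTwist c p))
      (oneTensor_koszulTwist_d p) =
      cycleClass (tensorFunctor r) P (p := p) (-∑ j, ModuleCat.ofHom (koszulDeg (e.coord j) p) ≫
        oneTensor r e p ≫ ((tensorComplex r).map (c j)).f p)
        (fun q => by rw [Preadditive.neg_comp, sum_cycle, neg_zero]) := by
    congr 1
    exact oneTensor_koszulTwist p
  refine twist_class.trans ?_
  rw [cycleClass_neg _ _ _ sum_cycle, cycleClass_sum _ _ _ _ (koszulDeg_comp_oneTensor_map_d · p),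
    Finset.sum_congr rfl fun j _ => contract_class j]
  exact ModuleCat.hom_ext (congrArg Neg.neg (ModuleCat.hom_sum _ _))

end KoszulTwist

section Delta
variable {R : Type u} [CommRing R] {U : Type u} [AddCommGroup U] [Module R U] {n : ℕ}
  {r : Fin n → R} {e : Module.Basis (Fin n) R U} {s : ℕ} {x : R}

/-- The map `⋀^0 U = R → I^s/I^{s+2}` sending `1` to the class of `x`. -/
noncomputable def koszulPowLift (r : Fin n → R) (e : Module.Basis (Fin n) R U)
    (hx : x ∈ seqIdeal r ^ s) :
    (koszulComplex (seqForm r e)).X 0 ⟶ (powSequence (seqIdeal r) s).X₂ :=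
  ModuleCat.ofHom ((LinearMap.toSpanSingleton R (PowQuot (seqIdeal r) s (s + 2))
    (Submodule.Quotient.mk ⟨x, hx⟩)) ∘ₗ (exteriorPower.zeroEquiv R U).toLinearMap)

lemma koszulTwist_zero_comp_powMid (hx : x ∈ seqIdeal r ^ s)
    (hrx : ∀ j, r j * x ∈ seqIdeal r ^ (s + 1))
    {P : ProjectiveResolution (ModuleCat.of R (Gr (seqIdeal r) (s + 1)))}
    {c : Fin n → (koszulComplex (seqForm r e) ⟶ P.complex)}
    (hc : ∀ j, (c j).f 0 ≫ P.π.f 0 =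
      (koszulSeqAug r e).f 0 ≫ ModuleCat.ofHom (Gr.act (Gr.mk (r j * x) (hrx j)))) :
    (koszulComplex (seqForm r e)).d 1 0 ≫ koszulPowLift r e hx +
      koszulTwist c 0 ≫ P.π.f 0 ≫ (powSequence (seqIdeal r) s).f = 0 := by
  have twist_comp := congrArg (· ≫ (powSequence (seqIdeal r) s).f) (koszulTwist_zero_comp_π hc)
  refine (congrArg _ ((Category.assoc _ _ _).symm.trans twist_comp)).trans ?_
  rw [koszulComplex_d]
  refine ModuleCat.hom_ext (LinearMap.ext fun (z : ⋀[R]^1 U) => ?_)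
  change exteriorPower.zeroEquiv R U (koszulDeg (seqForm r e) 0 z) •
      (Submodule.Quotient.mk ⟨x, hx⟩ : PowQuot (seqIdeal r) s (s + 2)) +
    powMid (seqIdeal r) s ((-∑ j, Gr.act (Gr.mk (r j * x) (hrx j)) ∘ₗ (seqIdeal r).mkQ ∘ₗ
      (exteriorPower.zeroEquiv R U).toLinearMap ∘ₗ koszulDeg (e.coord j) 0) z) = 0
  rw [koszulDeg_seqForm, LinearMap.neg_apply, map_neg, ← sub_eq_add_neg, sub_eq_zero,
    LinearMap.sum_apply, map_sum, map_sum, Finset.sum_smul]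
  refine Finset.sum_congr rfl fun j _ => ?_
  rw [map_smul, smul_eq_mul, mul_comm, mul_smul]
  exact (map_smul (powMid (seqIdeal r) s)
    (exteriorPower.zeroEquiv R U (koszulDeg (e.coord j) 0 z)) (Gr.mk (r j * x) (hrx j))).symm

variable (hK : QuasiIso (koszulSeqAug r e))

include hK in
lemma exists_koszul_lift {N : Type u} [AddCommGroup N] [Module R N]
    (P : ProjectiveResolution (ModuleCat.of R N)) (g : (R ⧸ seqIdeal r) →ₗ[R] N) :
    ∃ c : koszulComplex (seqForm r e) ⟶ P.complex,
      c.f 0 ≫ P.π.f 0 = (koszulSeqAug r e).f 0 ≫ ModuleCat.ofHom g :=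
  ⟨ProjectiveResolution.lift (ModuleCat.ofHom g) (koszulResolution r e hK) P,
    congrArg (fun φ => φ.f 0)
      (ProjectiveResolution.lift_commutes (ModuleCat.ofHom g) (koszulResolution r e hK) P)⟩

/-- The map `R/I → I^s/I^{s+1}`, `1 ↦ x`, lifts to `I^s/I^{s+2}` only on the Koszul resolution. The
lift fails to be a chain map by exactly `koszulTwist`, and this failure is the connecting map. -/
theorem deltaDeg_torMap_koszulClass (hx : x ∈ seqIdeal r ^ s)
    (hrx : ∀ j, r j * x ∈ seqIdeal r ^ (s + 1)) (p : ℕ) (y : ⋀[R]^(p + 1) U) :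
    deltaDeg (seqIdeal r) s p
      (torMap (seqIdeal r) (Gr.act (Gr.mk x hx)) (p + 1) (koszulClass r e hK (p + 1) y)) =
    -∑ j, torMap (seqIdeal r) (Gr.act (Gr.mk (r j * x) (hrx j))) p
      (koszulClass r e hK p (koszulDeg (e.coord j) p y)) := by
  have (p : ℕ) : Projective ((koszulComplex (seqForm r e)).X p) :=
    (koszulResolution r e hK).projective p
  let T := (exists_resolvedSequence (powSequence_shortExact (seqIdeal r) s)).some
  choose c hc using fun j =>
    exists_koszul_lift (e := e) hK T.P₁ (Gr.act (Gr.mk (r j * x) (hrx j)))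
  obtain ⟨h, k, h_d, h_g, k_aug⟩ := exists_lift_of_twist T (koszulTwist c) (koszulTwist_d c)
    (koszulPowLift r e hx) (koszulTwist_zero_comp_powMid hx hrx hc)
  have k_lift : k.f 0 ≫ T.P₃.π.f 0 =
      (koszulSeqAug r e).f 0 ≫ ModuleCat.ofHom (Gr.act (Gr.mk x hx)) := by
    refine k_aug.trans ?_
    rw [koszulSeqAug_f_zero]
    rfl
  have δ_class := cycleClass_comp_δ_of_twist (tensorFunctor r) T h_d h_g
    (x := oneTensor r e (p + 1)) (oneTensor_d r e (p + 1) p)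
    (comp_map_f_d (tensorFunctor r) k _ <| oneTensor_d r e (p + 1) ·)
    (oneTensor_koszulTwist_d p)
  have δ_koszulClass : (ModuleCat.ofHom (koszulClass r e hK (p + 1)) ≫
      ModuleCat.ofHom (torMap (seqIdeal r) (Gr.act (Gr.mk x hx)) (p + 1))) ≫
        T.δ (tensorFunctor r) p = _ :=
    (congrArg (· ≫ T.δ (tensorFunctor r) p)
      (torMap_koszulClass hK T.P₃ (Gr.act (Gr.mk x hx)) k k_lift (p + 1))).trans
        (δ_class.trans (cycleClass_koszulTwist hK hc p))
  refine (congrArg (fun φ => φ.hom y) δ_koszulClass).trans ?_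
  change (-∑ j, torMap (seqIdeal r) (Gr.act (Gr.mk (r j * x) (hrx j))) p ∘ₗ
    koszulClass r e hK p ∘ₗ koszulDeg (e.coord j) p) y = _
  rw [LinearMap.neg_apply, LinearMap.sum_apply]
  rfl

end Delta

/-! ### The associated graded ring -/

section GradedEval
open MvPolynomial

lemma aeval_mem_graded {σ A B : Type*} [CommRing A] [CommRing B] [Algebra A B]
    (𝒜 : ℕ → Submodule A B) [SetLike.GradedMonoid 𝒜] {x : σ → B} (hx : ∀ j, x j ∈ 𝒜 1)
    {F : MvPolynomial σ A} {s : ℕ} (hF : F.IsHomogeneous s) : aeval x F ∈ 𝒜 s := by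
  rw [aeval_def, eval₂_eq]
  refine sum_mem fun m hm => ?_
  rw [← Algebra.smul_def]
  have prod_mem := SetLike.prod_pow_mem_graded 𝒜 (F := m.support) (fun _ => 1) x m fun j _ => hx j
  have degree_eq : ∑ j ∈ m.support, m j • 1 = s := by
    simpa only [smul_eq_mul, mul_one] using (hF.degree_eq_sum_deg_support hm).symm
  exact (𝒜 s).smul_mem _ (degree_eq ▸ prod_mem)

variable {R : Type u} [CommRing R] {I : Ideal R}

lemma of_mk_congr {s t : ℕ} (hst : s = t) {x y : R} (hx : x ∈ I ^ s) (hy : y ∈ I ^ t)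
    (hxy : x = y) : DirectSum.of (Gr I) s (Gr.mk x hx) = DirectSum.of (Gr I) t (Gr.mk y hy) :=
  DirectSum.of_eq_of_gradedMonoid_eq (Gr.sigma_eq hst hx hy hxy)

lemma of_mk_mul_of_mk {s t : ℕ} {x y : R} (hx : x ∈ I ^ s) (hy : y ∈ I ^ t) :
    DirectSum.of (Gr I) s (Gr.mk x hx) * DirectSum.of (Gr I) t (Gr.mk y hy) =
      DirectSum.of (Gr I) (s + t) (Gr.mk (x * y) (Gr.mul_mem hx hy)) :=
  DirectSum.of_mul_of _ _

/-- The graph of the residue class map `I^s → I^s/I^{s+1}`, inside `R × gr_I(R)`. -/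
noncomputable def grGraph (I : Ideal R) (s : ℕ) : Submodule R (R × ⨁ s, Gr I s) :=
  LinearMap.range (LinearMap.prod (I ^ s : Submodule R R).subtype
    (DirectSum.lof R ℕ (Gr I) s ∘ₗ Submodule.mkQ _))

lemma mem_grGraph {s : ℕ} {z : R × ⨁ s, Gr I s} :
    z ∈ grGraph I s ↔ ∃ hz : z.1 ∈ I ^ s, DirectSum.of (Gr I) s (Gr.mk z.1 hz) = z.2 := by
  refine ⟨?_, fun ⟨hz, hz'⟩ => ⟨⟨z.1, hz⟩, Prod.ext rfl hz'⟩⟩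
  rintro ⟨x, rfl⟩
  exact ⟨x.2, rfl⟩

instance grGraph_gradedMonoid : SetLike.GradedMonoid (grGraph I) where
  one_mem := mem_grGraph.2 ⟨Gr.mem_zero 1, rfl⟩
  mul_mem s t y z hy hz := by
    obtain ⟨hy, hy'⟩ := mem_grGraph.1 hy
    obtain ⟨hz, hz'⟩ := mem_grGraph.1 hz
    refine mem_grGraph.2 ⟨Gr.mul_mem hy hz, ?_⟩
    rw [Prod.snd_mul, ← hy', ← hz', of_mk_mul_of_mk]
    rfl

/-- The ring homomorphism from `R/I` to the degree zero part of the associated graded ring. -/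
noncomputable def quotToGr (I : Ideal R) : (R ⧸ I) →+* ⨁ s, Gr I s :=
  Ideal.Quotient.lift I (algebraMap R (⨁ s, Gr I s)) fun a ha => by
    have mk_eq_zero : Gr.mk a (Gr.mem_zero a) = (0 : Gr I 0) := by
      rw [Gr.zero_eq, Gr.mk_eq, sub_zero, zero_add, pow_one]
      exact ha
    exact (congrArg (DirectSum.of (Gr I) 0) mk_eq_zero).trans (map_zero _)

variable {n : ℕ} (r : Fin n → R)

lemma mem_seqIdeal_pow_one (j : Fin n) : r j ∈ seqIdeal r ^ 1 := by
  rw [pow_one]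
  exact Ideal.subset_span ⟨j, rfl⟩

/-- The ring homomorphism from the polynomial ring over `R/I` to the associated graded ring that
sends the variables to the classes of the `r j` in `I/I²`. -/
noncomputable def gradedEval : MvPolynomial (Fin n) (R ⧸ seqIdeal r) →+* ⨁ s, Gr (seqIdeal r) s :=
  eval₂Hom (quotToGr (seqIdeal r))
    fun j => DirectSum.of (Gr (seqIdeal r)) 1 (Gr.mk (r j) (mem_seqIdeal_pow_one r j))

lemma gradedEval_X (j : Fin n) : gradedEval r (X j) =
    DirectSum.of (Gr (seqIdeal r)) 1 (Gr.mk (r j) (mem_seqIdeal_pow_one r j)) :=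
  eval₂Hom_X' _ _ j

lemma gradedEval_map (F : MvPolynomial (Fin n) R) :
    gradedEval r (map (Ideal.Quotient.mk (seqIdeal r)) F) =
      aeval (fun j => DirectSum.of (Gr (seqIdeal r)) 1 (Gr.mk (r j) (mem_seqIdeal_pow_one r j)))
        F :=
  eval₂Hom_map_hom _ _ _ F

variable {s : ℕ} {F : MvPolynomial (Fin n) R}

lemma aeval_prod_mem_grGraph (hF : F.IsHomogeneous s) :
    (aeval r F, gradedEval r (map (Ideal.Quotient.mk (seqIdeal r)) F)) ∈
      grGraph (seqIdeal r) s := by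
  rw [gradedEval_map]
  let x (j : Fin n) : R × ⨁ s, Gr (seqIdeal r) s :=
    (r j, DirectSum.of (Gr (seqIdeal r)) 1 (Gr.mk (r j) (mem_seqIdeal_pow_one r j)))
  have aeval_mem := aeval_mem_graded (grGraph (seqIdeal r)) (x := x)
    (fun j => mem_grGraph.2 ⟨mem_seqIdeal_pow_one r j, rfl⟩) hF
  have aeval_eq : aeval x F = (aeval r F, aeval (fun j => (x j).2) F) :=
    Prod.ext (comp_aeval_apply x (AlgHom.fst R R _) F) (comp_aeval_apply x (AlgHom.snd R R _) F)
  rwa [aeval_eq] at aeval_mem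

lemma aeval_mem_pow (hF : F.IsHomogeneous s) : aeval r F ∈ seqIdeal r ^ s :=
  (mem_grGraph.1 (aeval_prod_mem_grGraph r hF)).1

lemma gradedEval_map_of_isHomogeneous (hF : F.IsHomogeneous s) :
    gradedEval r (map (Ideal.Quotient.mk _) F) =
      DirectSum.of (Gr (seqIdeal r)) s (Gr.mk (aeval r F) (aeval_mem_pow r hF)) :=
  (mem_grGraph.1 (aeval_prod_mem_grGraph r hF)).2.symm

lemma gradedEval_map_apply (F : MvPolynomial (Fin n) R) (s : ℕ) :
    gradedEval r (map (Ideal.Quotient.mk _) F) s = Gr.mk (aeval r (homogeneousComponent s F))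
      (aeval_mem_pow r (homogeneousComponent_isHomogeneous s F)) := by
  conv_lhs => rw [← sum_homogeneousComponent F]
  rw [map_sum, map_sum, DFinsupp.finsetSum_apply]
  simp only [gradedEval_map_of_isHomogeneous r (homogeneousComponent_isHomogeneous _ F)]
  rw [Finset.sum_eq_single s fun i _ hi => DirectSum.of_eq_of_ne _ _ _ hi.symm]
  · exact DirectSum.of_eq_same _ _
  · intro hs
    rw [Finset.mem_range, not_lt] at hs
    refine (DirectSum.of_eq_same _ _).trans ?_
    rw [Gr.zero_eq, Gr.mk_eq, homogeneousComponent_eq_zero _ _ hs, map_zero, sub_zero]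
    exact zero_mem _

variable {r}

lemma gradedEval_injective (hr : IsRegularFamily r) : Function.Injective (gradedEval r) := by
  refine (injective_iff_map_eq_zero _).2 fun P hP => ?_
  obtain ⟨F, rfl⟩ := map_surjective _ Ideal.Quotient.mk_surjective P
  ext m
  rw [coeff_map, coeff_zero, Ideal.Quotient.eq_zero_iff_mem]
  have component_eq_zero := gradedEval_map_apply r F m.degree
  rw [hP, DirectSum.zero_apply, Gr.zero_eq, eq_comm, Gr.mk_eq, sub_zero] at component_eq_zero
  have coeff_mem := hr.coeff_mem (homogeneousComponent_isHomogeneous m.degree F)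
    component_eq_zero m
  rwa [coeff_homogeneousComponent, if_pos rfl] at coeff_mem

variable (r)

lemma exists_isHomogeneous_gradedEval_map_eq (m : Gr (seqIdeal r) s) :
    ∃ F : MvPolynomial (Fin n) R, F.IsHomogeneous s ∧
      gradedEval r (map (Ideal.Quotient.mk _) F) = DirectSum.of (Gr (seqIdeal r)) s m := by
  induction m using Gr.ind with | h x hx
  obtain ⟨F, hF, rfl⟩ := (Ideal.mem_span_pow_iff_exists_isHomogeneous r x).1 hx
  exact ⟨F, hF, gradedEval_map_of_isHomogeneous r hF⟩

lemma gradedEval_surjective : Function.Surjective (gradedEval r) := by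
  intro y
  induction y using DirectSum.induction_on with
  | zero => exact ⟨0, map_zero _⟩
  | of s m =>
    obtain ⟨F, -, hF⟩ := exists_isHomogeneous_gradedEval_map_eq r m
    exact ⟨_, hF⟩
  | add y z hy hz =>
    obtain ⟨P, rfl⟩ := hy
    obtain ⟨Q, rfl⟩ := hz
    exact ⟨P + Q, map_add _ _ _⟩

lemma exists_isHomogeneous_map_eq {A B : Type*} [CommRing A] [CommRing B] {f : A →+* B}
    (hf : Function.Surjective f) {σ : Type*} {P : MvPolynomial σ B} (hP : P.IsHomogeneous s) :
    ∃ F : MvPolynomial σ A, F.IsHomogeneous s ∧ map f F = P := by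
  obtain ⟨F, rfl⟩ := map_surjective f hf P
  refine ⟨homogeneousComponent s F, homogeneousComponent_isHomogeneous s F, ?_⟩
  ext m
  rw [coeff_map, coeff_map, coeff_homogeneousComponent]
  split_ifs with hm
  · rfl
  · rw [map_zero, ← coeff_map, hP.coeff_eq_zero hm]

lemma image_gradedEval (s : ℕ) :
    gradedEval r '' (homogeneousSubmodule (Fin n) (R ⧸ seqIdeal r) s) =
      Set.range (DirectSum.of (Gr (seqIdeal r)) s) := by
  refine Set.Subset.antisymm ?_ ?_
  · rintro - ⟨P, hP, rfl⟩
    obtain ⟨F, hF, rfl⟩ := exists_isHomogeneous_map_eq Ideal.Quotient.mk_surjective hP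
    exact ⟨_, (gradedEval_map_of_isHomogeneous r hF).symm⟩
  · rintro - ⟨m, rfl⟩
    obtain ⟨F, hF, hFm⟩ := exists_isHomogeneous_gradedEval_map_eq r m
    exact ⟨_, hF.map _, hFm⟩

variable {r}

/-- The isomorphism of the polynomial ring over `R/I` with the associated graded ring of `R`, for
the ideal `I` generated by a regular family. -/
noncomputable def gradedEquiv (hr : IsRegularFamily r) :
    MvPolynomial (Fin n) (R ⧸ seqIdeal r) ≃ₐ[R] ⨁ s, Gr (seqIdeal r) s :=
  AlgEquiv.ofBijective { gradedEval r with commutes' := fun _ => eval₂Hom_C _ _ _ }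
    ⟨gradedEval_injective hr, gradedEval_surjective r⟩

lemma isHomogeneous_gradedEquiv_symm_lof (hr : IsRegularFamily r) (m : Gr (seqIdeal r) s) :
    ((gradedEquiv hr).symm (DirectSum.lof R ℕ (Gr (seqIdeal r)) s m)).IsHomogeneous s := by
  obtain ⟨F, hF, hFm⟩ := exists_isHomogeneous_gradedEval_map_eq r m
  have symm_eq : (gradedEquiv hr).symm (DirectSum.lof R ℕ (Gr (seqIdeal r)) s m) =
      MvPolynomial.map (Ideal.Quotient.mk (seqIdeal r)) F :=
    (gradedEquiv hr).symm_apply_eq.2 hFm.symm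
  rw [symm_eq]
  exact hF.map _

/-- The coefficients at the monomials of degree `s` exhibit `I^s/I^{s+1}` as a direct summand of a
finite power of `R/I`. -/
lemma exists_sum_comp_eq_id (hr : IsRegularFamily r) (s : ℕ) :
    ∃ (κ : Type) (_ : Fintype κ) (i : κ → (R ⧸ seqIdeal r) →ₗ[R] Gr (seqIdeal r) s)
      (q : κ → Gr (seqIdeal r) s →ₗ[R] R ⧸ seqIdeal r), ∑ k, i k ∘ₗ q k = LinearMap.id := by
  let T : Finset (Fin n →₀ ℕ) := (Finsupp.finite_of_degree_eq s).toFinset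
  refine ⟨T, inferInstance,
    fun m => DirectSum.component R ℕ (Gr (seqIdeal r)) s ∘ₗ (gradedEquiv hr).toLinearMap ∘ₗ
      (monomial m.1).restrictScalars R,
    fun m => (lcoeff (R ⧸ seqIdeal r) m.1).restrictScalars R ∘ₗ
      (gradedEquiv hr).symm.toLinearMap ∘ₗ DirectSum.lof R ℕ (Gr (seqIdeal r)) s,
    LinearMap.ext fun x => ?_⟩
  set P := (gradedEquiv hr).symm (DirectSum.lof R ℕ (Gr (seqIdeal r)) s x) with hP
  have support_subset : P.support ⊆ T := fun m hm => by
    by_contra hmT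
    rw [Set.Finite.mem_toFinset] at hmT
    exact mem_support_iff.1 hm ((isHomogeneous_gradedEquiv_symm_lof hr x).coeff_eq_zero hmT)
  calc
    _ = DirectSum.component R ℕ (Gr (seqIdeal r)) s
          (gradedEquiv hr (∑ m ∈ T, monomial m (P.coeff m))) := by
        rw [map_sum, map_sum, LinearMap.sum_apply]
        exact Finset.sum_coe_sort T fun m => DirectSum.component R ℕ (Gr (seqIdeal r)) s
          (gradedEquiv hr (monomial m (P.coeff m)))
    _ = DirectSum.component R ℕ (Gr (seqIdeal r)) s (gradedEquiv hr P) := by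
        rw [← Finset.sum_subset support_subset fun m _ hm => by
          rw [notMem_support_iff.1 hm, monomial_zero], support_sum_monomial_coeff]
    _ = x := by rw [hP, AlgEquiv.apply_symm_apply, DirectSum.component.lof_self]

end GradedEval

section SymmetricAlgebra
variable {κ S W : Type*} [CommRing S] [AddCommGroup W] [Module S W]

lemma map_equivMvPolynomial_range_ι_pow (f : Module.Basis κ S W) (s : ℕ) :
    (LinearMap.range (SymmetricAlgebra.ι S W) ^ s).map
      (SymmetricAlgebra.equivMvPolynomial f).toLinearMap =
        MvPolynomial.homogeneousSubmodule κ S s := by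
  refine (Submodule.map_pow (LinearMap.range (SymmetricAlgebra.ι S W))
    (SymmetricAlgebra.equivMvPolynomial f).toAlgHom s).trans ?_
  rw [← MvPolynomial.homogeneousSubmodule_one_pow,
    MvPolynomial.homogeneousSubmodule_one_eq_span_X, LinearMap.range_eq_map, ← f.span_eq,
    Submodule.map_span, Submodule.map_span, ← Set.range_comp, ← Set.range_comp]
  exact congrArg (fun x => Submodule.span S (Set.range x) ^ s)
    (funext fun j => SymmetricAlgebra.equivMvPolynomial_ι_apply f j)

lemma isRegularFamily_ι [LinearOrder κ] (f : Module.Basis κ S W) :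
    IsRegularFamily (fun j => SymmetricAlgebra.ι S W (f j)) := by
  have hX := (isRegularFamily_X (A := S) (ι := κ)).map_ringEquiv
    (SymmetricAlgebra.equivMvPolynomial f).symm.toRingEquiv
  exact (funext fun j => SymmetricAlgebra.equivMvPolynomial_symm_X f j :
    (SymmetricAlgebra.equivMvPolynomial f).symm.toRingEquiv ∘ MvPolynomial.X = _) ▸ hX

lemma exists_eq_algebraMap_add_mem_span_ι (f : Module.Basis κ S W) (c : SymmetricAlgebra S W) :
    ∃ a, ∃ b ∈ Ideal.span (Set.range fun j => SymmetricAlgebra.ι S W (f j)),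
      c = algebraMap S _ a + b := by
  induction c using SymmetricAlgebra.induction with
  | algebraMap a => exact ⟨a, 0, zero_mem _, (add_zero _).symm⟩
  | ι w =>
    refine ⟨0, _, ?_, by rw [map_zero, zero_add]⟩
    rw [← f.linearCombination_repr w, Finsupp.linearCombination_apply, map_finsuppSum]
    refine sum_mem fun j _ => ?_
    simp only [map_smul, Algebra.smul_def]
    exact Ideal.mul_mem_left _ _ (Ideal.subset_span ⟨j, rfl⟩)
  | mul x y hx hy =>
    obtain ⟨a, b, hb, rfl⟩ := hx
    obtain ⟨a', b', hb', rfl⟩ := hy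
    refine ⟨a * a', algebraMap S _ a * b' + b * (algebraMap S _ a' + b'),
      add_mem (Ideal.mul_mem_left _ _ hb') (Ideal.mul_mem_right _ _ hb), ?_⟩
    rw [map_mul]
    ring
  | add x y hx hy =>
    obtain ⟨a, b, hb, rfl⟩ := hx
    obtain ⟨a', b', hb', rfl⟩ := hy
    exact ⟨a + a', b + b', add_mem hb hb', by rw [map_add, add_add_add_comm]⟩

end SymmetricAlgebra

section GrSym
variable {R : Type u} [CommRing R] {n : ℕ} {r : Fin n → R}
  {W : Type w} [AddCommGroup W] [Module (R ⧸ seqIdeal r) W]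
  (hr : IsRegularFamily r) (f : Module.Basis (Fin n) (R ⧸ seqIdeal r) W)

/-- The isomorphism `φ` of `gr_I(R)` with the symmetric algebra of `W` over `R/I`, sending the class
of `r j` to `-f j`. -/
noncomputable def grSymEquiv :
    (⨁ s, Gr (seqIdeal r) s) ≃ₐ[R] SymmetricAlgebra (R ⧸ seqIdeal r) W :=
  AlgEquiv.ofRingEquiv (f := (gradedEquiv hr).symm.toRingEquiv.trans
    (SymmetricAlgebra.equivMvPolynomial (f.map (LinearEquiv.neg _))).symm.toRingEquiv) fun a =>
      (congrArg (SymmetricAlgebra.equivMvPolynomial (f.map (LinearEquiv.neg _))).symm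
        ((gradedEquiv hr).symm.commutes a)).trans
      ((SymmetricAlgebra.equivMvPolynomial (f.map (LinearEquiv.neg _))).symm.commutes
        (Ideal.Quotient.mk _ a))

lemma grSymEquiv_gradedEval (P : MvPolynomial (Fin n) (R ⧸ seqIdeal r)) :
    grSymEquiv hr f (gradedEval r P) =
      (SymmetricAlgebra.equivMvPolynomial (f.map (LinearEquiv.neg _))).symm P :=
  congrArg (SymmetricAlgebra.equivMvPolynomial (f.map (LinearEquiv.neg _))).symm
    ((gradedEquiv hr).symm_apply_apply P)

lemma grSymEquiv_of_one (j : Fin n) (hj : r j ∈ seqIdeal r ^ 1) :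
    grSymEquiv hr f (DirectSum.of (Gr (seqIdeal r)) 1 (Gr.mk (r j) hj)) =
      -SymmetricAlgebra.ι (R ⧸ seqIdeal r) W (f j) := by
  rw [← gradedEval_X, grSymEquiv_gradedEval, SymmetricAlgebra.equivMvPolynomial_symm_X,
    Module.Basis.map_apply, LinearEquiv.neg_apply, map_neg]

lemma grSymEquiv_of_mk_mul (j : Fin n) {s : ℕ} {x : R} (hx : x ∈ seqIdeal r ^ s)
    (hrx : r j * x ∈ seqIdeal r ^ (s + 1)) :
    grSymEquiv hr f (DirectSum.of (Gr (seqIdeal r)) (s + 1) (Gr.mk (r j * x) hrx)) =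
      -(SymmetricAlgebra.ι (R ⧸ seqIdeal r) W (f j) *
        grSymEquiv hr f (DirectSum.of (Gr (seqIdeal r)) s (Gr.mk x hx))) := by
  refine Eq.trans ?_ (neg_mul (SymmetricAlgebra.ι (R ⧸ seqIdeal r) W (f j)) _)
  rw [← grSymEquiv_of_one hr f j (mem_seqIdeal_pow_one r j), ← map_mul, of_mk_mul_of_mk]
  exact congrArg _ (of_mk_congr (add_comm s 1) _ _ rfl)

lemma image_grSymEquiv (s : ℕ) :
    grSymEquiv hr f '' Set.range (DirectSum.of (Gr (seqIdeal r)) s) =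
      symPiece (seqIdeal r) W s := by
  rw [← image_gradedEval, Set.image_image]
  simp only [grSymEquiv_gradedEval]
  rw [← map_equivMvPolynomial_range_ι_pow (f.map (LinearEquiv.neg (R ⧸ seqIdeal r))),
    Submodule.map_coe, Set.image_image]
  exact (Set.image_congr fun x _ => AlgEquiv.symm_apply_apply _ x).trans (Set.image_id _)

lemma grSymEquiv_of_zero (a : R) :
    grSymEquiv hr f (DirectSum.of (Gr (seqIdeal r)) 0 (Gr.mk a (Gr.mem_zero a))) =
      algebraMap (R ⧸ seqIdeal r) _ (Ideal.Quotient.mk _ a) :=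
  (grSymEquiv hr f).commutes a

end GrSym

/-! ### Base change of exterior algebras -/

section ExteriorBaseChange
variable {R : Type*} [CommRing R] {U : Type*} [AddCommGroup U] [Module R U]
  (A : Type*) [CommRing A] [Algebra R A]

/-- The algebra homomorphism from the exterior algebra of `U` over `R` to that of `A ⊗ U` over `A`,
induced by `u ↦ 1 ⊗ u`. -/
noncomputable def exteriorBase : ExteriorAlgebra R U →ₐ[R] ExteriorAlgebra A (A ⊗[R] U) :=
  ExteriorAlgebra.lift R
    ⟨(ExteriorAlgebra.ι A).restrictScalars R ∘ₗ TensorProduct.mk R A U 1,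
      fun u => ExteriorAlgebra.ι_sq_zero (R := A) ((1 : A) ⊗ₜ[R] u)⟩

lemma exteriorBase_algebraMap (a : R) :
    exteriorBase A (algebraMap R (ExteriorAlgebra R U) a) = algebraMap A _ (algebraMap R A a) :=
  (exteriorBase A).commutes a

lemma exteriorBase_ι (u : U) : exteriorBase A (ExteriorAlgebra.ι R u) =
    ExteriorAlgebra.ι A ((1 : A) ⊗ₜ[R] u) :=
  ExteriorAlgebra.lift_ι_apply R _ _ u

lemma exteriorBase_ιMulti {p : ℕ} (v : Fin p → U) :
    exteriorBase A (ExteriorAlgebra.ιMulti R p v) =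
      ExteriorAlgebra.ιMulti A p (fun i => (1 : A) ⊗ₜ[R] v i) := by
  simp only [ExteriorAlgebra.ιMulti_apply, map_list_prod, List.map_ofFn, Function.comp_def,
    exteriorBase_ι]

lemma koszulD_liftBaseChange_exteriorBase (ξ : U →ₗ[R] R) (y : ExteriorAlgebra R U) :
    koszulD ((Algebra.linearMap R A ∘ₗ ξ).liftBaseChange A) (exteriorBase A y) =
      exteriorBase A (koszulD ξ y) := by
  induction y using CliffordAlgebra.left_induction with
  | algebraMap a =>
    change koszulD _ (exteriorBase A (algebraMap R (ExteriorAlgebra R U) a)) =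
      exteriorBase A (koszulD ξ (algebraMap R (ExteriorAlgebra R U) a))
    rw [exteriorBase_algebraMap, koszulD_algebraMap, koszulD_algebraMap, map_zero]
  | add x y hx hy => simp only [map_add, hx, hy]
  | ι_mul x u hx =>
    change koszulD _ (exteriorBase A (ExteriorAlgebra.ι R u * x)) =
      exteriorBase A (koszulD ξ (ExteriorAlgebra.ι R u * x))
    rw [map_mul, exteriorBase_ι, koszulD_ι_mul, koszulD_ι_mul, hx, map_sub, map_smul, map_mul,
      exteriorBase_ι, LinearMap.liftBaseChange_tmul, one_smul, LinearMap.comp_apply,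
      Algebra.linearMap_apply, algebraMap_smul]

variable {κ : Type*} (e : Module.Basis κ R U)

lemma coord_baseChange (j : κ) :
    (e.baseChange A).coord j = (Algebra.linearMap R A ∘ₗ e.coord j).liftBaseChange A := by
  classical
  refine (e.baseChange A).ext fun i => ?_
  rw [Module.Basis.coord_apply, Module.Basis.repr_self, Module.Basis.baseChange_apply,
    LinearMap.liftBaseChange_tmul, one_smul, LinearMap.comp_apply, Module.Basis.coord_apply,
    Module.Basis.repr_self, Finsupp.single_apply, Finsupp.single_apply]
  split_ifs
  · exact (map_one (algebraMap R A)).symm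
  · exact (map_zero (algebraMap R A)).symm

lemma koszulD_constr_exteriorBase [Fintype κ] (g : κ → A) (y : ExteriorAlgebra R U) :
    koszulD ((e.baseChange A).constr A g) (exteriorBase A y) =
      ∑ j, g j • exteriorBase A (koszulD (e.coord j) y) := by
  simp only [koszulD_constr, coord_baseChange, koszulD_liftBaseChange_exteriorBase]

variable [LinearOrder κ]

lemma liftBaseChange_exteriorBase_eq_equiv :
    ((exteriorBase A).toLinearMap.liftBaseChange A :
      A ⊗[R] ExteriorAlgebra R U →ₗ[A] ExteriorAlgebra A (A ⊗[R] U)) =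
      ((e.ExteriorAlgebra.baseChange A).equiv (e.baseChange A).ExteriorAlgebra
        (Equiv.refl _)).toLinearMap := by
  refine (e.ExteriorAlgebra.baseChange A).ext fun s => ?_
  rw [LinearEquiv.coe_coe, Module.Basis.equiv_apply, Module.Basis.baseChange_apply,
    LinearMap.liftBaseChange_tmul, one_smul, Equiv.refl_apply, ExteriorAlgebra.basis_apply,
    ExteriorAlgebra.basis_apply]
  exact (exteriorBase_ιMulti A _).trans (congrArg (ExteriorAlgebra.ιMulti A s.card)
    (funext fun i => (Module.Basis.baseChange_apply A e _).symm))

/-- The isomorphism of `A ⊗ Λ(U)` with the exterior algebra of `A ⊗ U` over `A`, for a module `U`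
with a basis. -/
noncomputable def exteriorBaseEquiv :
    A ⊗[R] ExteriorAlgebra R U ≃ₗ[A] ExteriorAlgebra A (A ⊗[R] U) :=
  LinearEquiv.ofBijective ((exteriorBase A).toLinearMap.liftBaseChange A) <| by
    rw [liftBaseChange_exteriorBase_eq_equiv A e]
    exact LinearEquiv.bijective _

lemma exteriorBaseEquiv_tmul (a : A) (x : ExteriorAlgebra R U) :
    exteriorBaseEquiv A e (a ⊗ₜ x) = a • exteriorBase A x :=
  LinearMap.liftBaseChange_tmul A (exteriorBase A).toLinearMap a x

end ExteriorBaseChange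

/-! ### The bigraded Tor module -/

section DirectSumCongr
variable {R κ : Type*} [Semiring R] {M N : κ → Type*} [∀ i, AddCommMonoid (M i)]
  [∀ i, Module R (M i)] [∀ i, AddCommMonoid (N i)] [∀ i, Module R (N i)]

/-- The direct sum of a family of linear equivalences. -/
noncomputable def directSumCongr (f : ∀ i, M i ≃ₗ[R] N i) : (⨁ i, M i) ≃ₗ[R] ⨁ i, N i :=
  DFinsupp.mapRange.linearEquiv f

lemma directSumCongr_lof [DecidableEq κ] (f : ∀ i, M i ≃ₗ[R] N i) (i : κ) (x : M i) :
    directSumCongr f (DirectSum.lof R κ M i x) = DirectSum.lof R κ N i (f i x) :=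
  DFinsupp.mapRange_single (hf := fun i => map_zero (f i))

end DirectSumCongr

section GrTensor
variable {R : Type u} [CommRing R] {U : Type u} [AddCommGroup U] [Module R U] {n : ℕ}
  {r : Fin n → R} {e : Module.Basis (Fin n) R U} (hK : QuasiIso (koszulSeqAug r e))
  (hr : IsRegularFamily r) (s p : ℕ)

/-- The isomorphism of `I^s/I^{s+1} ⊗ ⋀^p U` with `Tor_p(R/I, I^s/I^{s+1})`, sending `m ⊗ x` to
`m_* κ(x)`. -/
noncomputable def grTensorEquiv :
    Gr (seqIdeal r) s ⊗[R] ⋀[R]^p U ≃ₗ[R] TorQ (seqIdeal r) (Gr (seqIdeal r) s) p :=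
  (quotHomEquiv Gr.ideal_smul).symm.rTensor (⋀[R]^p U) ≪≫ₗ
    LinearEquiv.ofBijective (torPairing hK (Gr (seqIdeal r) s) p) (by
      obtain ⟨κ, _, i, q, hiq⟩ := exists_sum_comp_eq_id hr s
      exact ⟨torPairing_injective hK hiq p, torPairing_surjective hK hiq p⟩)

lemma grTensorEquiv_tmul {s p : ℕ} (m : Gr (seqIdeal r) s) (x : ⋀[R]^p U) :
    grTensorEquiv hK hr s p (m ⊗ₜ x) =
      torMap (seqIdeal r) (Gr.act m) p (koszulClass r e hK p x) := rfl

include hr in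
lemma span_torMap_koszulClass_ιMulti :
    Submodule.span R (Set.image2
      (fun (m : Gr (seqIdeal r) s) v =>
        torMap (seqIdeal r) (Gr.act m) p (koszulClass r e hK p (exteriorPower.ιMulti R p v)))
      Set.univ Set.univ) = ⊤ := by
  have span_tmul : Submodule.span R (Set.image2
      (fun (m : Gr (seqIdeal r) s) (v : Fin p → U) => m ⊗ₜ[R] exteriorPower.ιMulti R p v)
      Set.univ Set.univ) = ⊤ := by
    rw [← TensorProduct.map₂_mk_top_top_eq_top, ← exteriorPower.ιMulti_span,
      ← Submodule.span_univ (R := R) (M := Gr (seqIdeal r) s), Submodule.map₂_span_span,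
      ← Set.image_univ, Set.image2_image_right]
    rfl
  have map_span := congrArg (Submodule.map (grTensorEquiv hK hr s p).toLinearMap) span_tmul
  rw [Submodule.map_span, Set.image_image2, Submodule.map_top, LinearEquiv.range] at map_span
  exact map_span

/-- The component in bidegree `(s, p)` of `⨁_s Tor_*(R/I, I^s/I^{s+1})`. -/
noncomputable def torIncl (I : Ideal R) (s p : ℕ) : TorQ I (Gr I s) p →ₗ[R] TorGr I :=
  DirectSum.lof R ℕ (fun s => TorTot I (Gr I s)) s ∘ₗ
    DirectSum.lof R ℕ (fun p => TorQ I (Gr I s) p) p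

include hr in
lemma torGr_hom_ext {N : Type*} [AddCommMonoid N] [Module R N]
    {φ ψ : TorGr (seqIdeal r) →ₗ[R] N}
    (h : ∀ s p (m : Gr (seqIdeal r) s) (x : ⋀[R]^p U),
      φ (torIncl _ s p (torMap _ (Gr.act m) p (koszulClass r e hK p x))) =
        ψ (torIncl _ s p (torMap _ (Gr.act m) p (koszulClass r e hK p x)))) : φ = ψ := by
  refine DirectSum.linearMap_ext R fun s => DirectSum.linearMap_ext R fun p => ?_
  exact (LinearMap.cancel_right (grTensorEquiv hK hr s p).surjective).1
    (TensorProduct.ext' fun m x => h s p m x)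

/-- The isomorphism of `gr_I(R) ⊗ Λ(U)` with `⨁_s Tor_*(R/I, I^s/I^{s+1})`, assembled from the
isomorphisms `grTensorEquiv`. -/
noncomputable def torGrEquiv :
    (⨁ s, Gr (seqIdeal r) s) ⊗[R] ExteriorAlgebra R U ≃ₗ[R] TorGr (seqIdeal r) :=
  (DirectSum.decomposeLinearEquiv (fun p => ⋀[R]^p U)).lTensor _ ≪≫ₗ
  TensorProduct.directSumLeft R R (Gr (seqIdeal r)) (⨁ p, ⋀[R]^p U) ≪≫ₗ
  directSumCongr fun s =>
    TensorProduct.directSumRight R R (Gr (seqIdeal r) s) (fun p => ⋀[R]^p U) ≪≫ₗ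
      directSumCongr fun p => grTensorEquiv hK hr s p

lemma torGrEquiv_of_tmul {s p : ℕ} (m : Gr (seqIdeal r) s) (x : ⋀[R]^p U) :
    torGrEquiv hK hr (DirectSum.of (Gr (seqIdeal r)) s m ⊗ₜ (x : ExteriorAlgebra R U)) =
      torIncl _ s p (torMap _ (Gr.act m) p (koszulClass r e hK p x)) := by
  have decompose_x : DirectSum.decomposeLinearEquiv (fun p => ⋀[R]^p U) (x : ExteriorAlgebra R U) =
      DirectSum.lof R ℕ (fun p => ⋀[R]^p U) p x :=
    DirectSum.decompose_coe (fun p => ⋀[R]^p U) x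
  rw [torGrEquiv, LinearEquiv.trans_apply, LinearEquiv.trans_apply, LinearEquiv.lTensor_tmul,
    decompose_x, ← DirectSum.lof_eq_of R, TensorProduct.directSumLeft_tmul_lof, directSumCongr_lof,
    LinearEquiv.trans_apply, TensorProduct.directSumRight_tmul_lof, directSumCongr_lof,
    grTensorEquiv_tmul]
  rfl

end GrTensor

section TorModel
variable {R : Type u} [CommRing R] {U : Type u} [AddCommGroup U] [Module R U] {n : ℕ}
  {r : Fin n → R} {e : Module.Basis (Fin n) R U} (hK : QuasiIso (koszulSeqAug r e))
  {W : Type w} [AddCommGroup W] [Module (R ⧸ seqIdeal r) W]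
  (hr : IsRegularFamily r) (f : Module.Basis (Fin n) (R ⧸ seqIdeal r) W)

/-- The isomorphism `ψ` of `⨁_s Tor_*(R/I, I^s/I^{s+1})` with the exterior algebra of `Sym(W) ⊗ U`
over `Sym(W)`. -/
noncomputable def torModelEquiv :
    TorGr (seqIdeal r) ≃ₗ[R] ModelKoszul (seqIdeal r) W U :=
  (torGrEquiv hK hr).symm ≪≫ₗ (grSymEquiv hr f).toLinearEquiv.rTensor (ExteriorAlgebra R U) ≪≫ₗ
    (exteriorBaseEquiv (SymmetricAlgebra (R ⧸ seqIdeal r) W) e).restrictScalars R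

lemma torModelEquiv_torIncl {s p : ℕ} (m : Gr (seqIdeal r) s) (x : ⋀[R]^p U) :
    torModelEquiv hK hr f
        (torIncl _ s p (torMap _ (Gr.act m) p (koszulClass r e hK p x))) =
      grSymEquiv hr f (DirectSum.of (Gr (seqIdeal r)) s m) •
        exteriorBase (SymmetricAlgebra (R ⧸ seqIdeal r) W) (x : ExteriorAlgebra R U) := by
  rw [← torGrEquiv_of_tmul hK hr, torModelEquiv, LinearEquiv.trans_apply,
    LinearEquiv.trans_apply, LinearEquiv.symm_apply_apply, LinearEquiv.rTensor_tmul]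
  exact exteriorBaseEquiv_tmul _ e _ _

lemma torModelEquiv_torIncl_ιMulti {s p : ℕ} (m : Gr (seqIdeal r) s) (v : Fin p → U) :
    torModelEquiv hK hr f (torIncl _ s p
        (torMap _ (Gr.act m) p (koszulClass r e hK p (exteriorPower.ιMulti R p v)))) =
      grSymEquiv hr f (DirectSum.of (Gr (seqIdeal r)) s m) •
        ExteriorAlgebra.ιMulti (SymmetricAlgebra (R ⧸ seqIdeal r) W) p fun i => 1 ⊗ₜ[R] v i := by
  rw [torModelEquiv_torIncl, exteriorPower.ιMulti_apply_coe, exteriorBase_ιMulti]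

lemma torModelEquiv_map_range (s p : ℕ) :
    (LinearMap.range (torIncl (seqIdeal r) s p)).map
      (torModelEquiv hK hr f : TorGr (seqIdeal r) →ₗ[R] ModelKoszul (seqIdeal r) W U) =
        modelPiece (seqIdeal r) W U s p := by
  rw [LinearMap.range_eq_map, ← span_torMap_koszulClass_ιMulti hK hr s p, Submodule.map_span,
    Submodule.map_span, Set.image_image2, Set.image_image2]
  refine congrArg (Submodule.span R) (Set.ext fun z => ⟨?_, ?_⟩)
  · rintro ⟨m, -, v, -, rfl⟩
    refine ⟨_, ?_, v, torModelEquiv_torIncl_ιMulti hK hr f m v⟩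
    rw [← SetLike.mem_coe, ← image_grSymEquiv hr f s]
    exact Set.mem_image_of_mem _ ⟨m, rfl⟩
  · rintro ⟨a, ha, v, rfl⟩
    rw [← SetLike.mem_coe, ← image_grSymEquiv hr f s] at ha
    obtain ⟨_, ⟨m, rfl⟩, rfl⟩ := ha
    exact ⟨m, trivial, v, trivial, torModelEquiv_torIncl_ιMulti hK hr f m v⟩

end TorModel

lemma comp_leftDerivedZero_map_comp_fromLeftDerivedZero {C D : Type*} [Category* C] [Category* D]
    [Abelian C] [Abelian D] [EnoughProjectives C] (F : C ⥤ D) [F.Additive]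
    [PreservesFiniteColimits F] {X Y : C} {A : D} (g : X ⟶ Y) (x : A ⟶ F.obj X) :
    (x ≫ F.leftDerivedZeroIsoSelf.inv.app X ≫ (F.leftDerived 0).map g) ≫
      F.fromLeftDerivedZero.app Y = x ≫ F.map g := by
  rw [Category.assoc, Category.assoc, F.fromLeftDerivedZero.naturality,
    F.leftDerivedZeroIsoSelf_inv_hom_id_app_assoc]

section Eta
variable {R : Type u} [CommRing R] {U : Type u} [AddCommGroup U] [Module R U] {n : ℕ}
  {r : Fin n → R} {e : Module.Basis (Fin n) R U} (hK : QuasiIso (koszulSeqAug r e))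

lemma fromLeftDerivedZero_etaZero_one :
    ((tensorFunctor r).fromLeftDerivedZero.app (ModuleCat.of R (R ⧸ seqIdeal r))).hom
      (etaZero (seqIdeal r) 1) = (1 : R ⧸ seqIdeal r) ⊗ₜ[R] (1 : R ⧸ seqIdeal r) :=
  congrArg (fun g => g.hom (1 : R ⧸ seqIdeal r))
    (comp_leftDerivedZero_map_comp_fromLeftDerivedZero (tensorFunctor r)
      (ModuleCat.ofHom (seqIdeal r).mkQ)
      (MonoidalCategory.rightUnitor (ModuleCat.of R (R ⧸ seqIdeal r))).inv)

lemma fromLeftDerivedZero_koszulClass (x : ⋀[R]^0 U) :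
    ((tensorFunctor r).fromLeftDerivedZero.app (ModuleCat.of R (R ⧸ seqIdeal r))).hom
      (koszulClass r e hK 0 x) = (1 : R ⧸ seqIdeal r) ⊗ₜ[R]
        (seqIdeal r).mkQ (exteriorPower.zeroEquiv R U x) :=
  (congrArg (fun g => g.hom x) (cycleClass_comp_fromLeftDerivedZero (tensorFunctor r)
    (koszulResolution r e hK) (oneTensor r e 0) (oneTensor_d r e 0))).trans <|
  congrArg (fun g : (koszulComplex (seqForm r e)).X 0 ⟶ ModuleCat.of R (R ⧸ seqIdeal r) =>
    (1 : R ⧸ seqIdeal r) ⊗ₜ[R] g.hom x) (koszulSeqAug_f_zero r e)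

lemma etaZero_mk (a : R) : etaZero (seqIdeal r) (Ideal.Quotient.mk _ a) =
    koszulClass r e hK 0 ((exteriorPower.zeroEquiv R U).symm a) := by
  have etaZero_one : etaZero (seqIdeal r) 1 =
      koszulClass r e hK 0 ((exteriorPower.zeroEquiv R U).symm 1) := by
    apply (asIso ((tensorFunctor r).fromLeftDerivedZero.app
      (ModuleCat.of R (R ⧸ seqIdeal r)))).toLinearEquiv.injective
    refine fromLeftDerivedZero_etaZero_one.trans
      (Eq.trans ?_ (fromLeftDerivedZero_koszulClass hK _).symm)
    rw [LinearEquiv.apply_symm_apply]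
    rfl
  have mk_eq_smul : Ideal.Quotient.mk (seqIdeal r) a = a • (1 : R ⧸ seqIdeal r) :=
    Algebra.algebraMap_eq_smul_one a
  have symm_eq_smul : (exteriorPower.zeroEquiv R U).symm a =
      a • (exteriorPower.zeroEquiv R U).symm 1 := by
    rw [← map_smul, smul_eq_mul, mul_one]
  rw [mk_eq_smul, symm_eq_smul, map_smul, map_smul, etaZero_one]

variable {W : Type w} [AddCommGroup W] [Module (R ⧸ seqIdeal r) W]

lemma torModelEquiv_eta (hr : IsRegularFamily r)
    (f : Module.Basis (Fin n) (R ⧸ seqIdeal r) W) (a : R ⧸ seqIdeal r) :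
    torModelEquiv hK hr f (DirectSum.lof R ℕ (fun s => TorTot (seqIdeal r) (Gr (seqIdeal r) s)) 0
      (torTotMap (seqIdeal r) (unitGr (seqIdeal r)) (eta (seqIdeal r) a))) =
        algebraMap (SymmetricAlgebra (R ⧸ seqIdeal r) W) _
          (algebraMap (R ⧸ seqIdeal r) _ a) := by
  obtain ⟨a, rfl⟩ := Ideal.Quotient.mk_surjective a
  have torTotMap_eta : torTotMap (seqIdeal r) (unitGr (seqIdeal r))
      (eta (seqIdeal r) (Ideal.Quotient.mk _ a)) =
      DirectSum.lof R ℕ (fun p => TorQ (seqIdeal r) (Gr (seqIdeal r) 0) p) 0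
        (torMap (seqIdeal r) (unitGr (seqIdeal r)) 0
          (koszulClass r e hK 0 ((exteriorPower.zeroEquiv R U).symm a))) := by
    rw [← etaZero_mk]
    exact DirectSum.lmap_lof (fun p => torMap (seqIdeal r) (unitGr (seqIdeal r)) p) 0 _
  rw [torTotMap_eta]
  refine (torModelEquiv_torIncl hK hr f _ _).trans ?_
  rw [grSymEquiv_of_zero, map_one, map_one, one_smul, coe_zeroEquiv_symm,
    exteriorBase_algebraMap]
  rfl

end Eta

section Delta
variable {R : Type u} [CommRing R] (I : Ideal R)

lemma delta_lof_zero (s : ℕ) (y) :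
    delta I s (DirectSum.lof R ℕ (fun p => TorQ I (Gr I s) p) 0 y) = 0 := by
  rw [delta, DirectSum.toModule_lof]; rfl

lemma delta_lof_succ (s p : ℕ) (y) :
    delta I s (DirectSum.lof R ℕ (fun p => TorQ I (Gr I s) p) (p + 1) y) =
      DirectSum.lof R ℕ (fun p => TorQ I (Gr I (s + 1)) p) p (deltaDeg I s p y) := by
  rw [delta, DirectSum.toModule_lof]; rfl

lemma deltaTot_lof (s : ℕ) (x : TorTot I (Gr I s)) :
    deltaTot I (DirectSum.lof R ℕ (fun s => TorTot I (Gr I s)) s x) =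
      DirectSum.lof R ℕ (fun s => TorTot I (Gr I s)) (s + 1) (delta I s x) := by
  rw [deltaTot, DirectSum.toModule_lof]; rfl

lemma deltaTot_torIncl_zero (s : ℕ) (y) : deltaTot I (torIncl I s 0 y) = 0 :=
  (deltaTot_lof I s _).trans ((congrArg _ (delta_lof_zero I s y)).trans (map_zero _))

lemma deltaTot_torIncl_succ (s p : ℕ) (y) :
    deltaTot I (torIncl I s (p + 1) y) = torIncl I (s + 1) p (deltaDeg I s p y) :=
  (deltaTot_lof I s _).trans (congrArg _ (delta_lof_succ I s p y))

end Delta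

section Comparison
variable {R : Type u} [CommRing R] {U : Type u} [AddCommGroup U] [Module R U] {n : ℕ}
  {r : Fin n → R} {e : Module.Basis (Fin n) R U} (hK : QuasiIso (koszulSeqAug r e))
  {W : Type w} [AddCommGroup W] [Module (R ⧸ seqIdeal r) W]
  (hr : IsRegularFamily r) (f : Module.Basis (Fin n) (R ⧸ seqIdeal r) W)

lemma modelD_smul_exteriorBase (a : SymmetricAlgebra (R ⧸ seqIdeal r) W)
    (y : ExteriorAlgebra R U) :
    modelD e f (a • exteriorBase (SymmetricAlgebra (R ⧸ seqIdeal r) W) y) =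
      a • ∑ j, SymmetricAlgebra.ι (R ⧸ seqIdeal r) W (f j) •
        exteriorBase (SymmetricAlgebra (R ⧸ seqIdeal r) W) (koszulD (e.coord j) y) :=
  (map_smul (modelD e f) a _).trans (congrArg (a • ·) (koszulD_constr_exteriorBase _ e _ y))

lemma modelD_torModelEquiv_torIncl_zero {s : ℕ} (m : Gr (seqIdeal r) s) (x : ⋀[R]^0 U) :
    modelD e f (torModelEquiv hK hr f
      (torIncl _ s 0 (torMap _ (Gr.act m) 0 (koszulClass r e hK 0 x)))) = 0 := by
  rw [torModelEquiv_torIncl, modelD_smul_exteriorBase, ← algebraMap_zeroEquiv]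
  simp only [koszulD_algebraMap, map_zero, smul_zero, Finset.sum_const_zero]

lemma torModelEquiv_torIncl_deltaDeg {s p : ℕ} (m : Gr (seqIdeal r) s) (x : ⋀[R]^(p + 1) U) :
    torModelEquiv hK hr f (torIncl _ (s + 1) p (deltaDeg _ s p
      (torMap _ (Gr.act m) (p + 1) (koszulClass r e hK (p + 1) x)))) =
    modelD e f (torModelEquiv hK hr f
      (torIncl _ s (p + 1) (torMap _ (Gr.act m) (p + 1) (koszulClass r e hK (p + 1) x)))) := by
  induction m using Gr.ind with | h a ha
  have hra (j : Fin n) : r j * a ∈ seqIdeal r ^ (s + 1) := by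
    rw [pow_succ']
    exact Ideal.mul_mem_mul (Ideal.subset_span ⟨j, rfl⟩) ha
  rw [torModelEquiv_torIncl, modelD_smul_exteriorBase, deltaDeg_torMap_koszulClass hK ha hra p x,
    map_neg, map_neg, map_sum, map_sum, Finset.smul_sum, ← Finset.sum_neg_distrib]
  refine Finset.sum_congr rfl fun j _ => ?_
  rw [torModelEquiv_torIncl, grSymEquiv_of_mk_mul hr f j ha (hra j)]
  -- The sign of `δ` is absorbed by `φ`, which sends the class of `r_j` to `-f_j`.
  refine (neg_eq_iff_eq_neg.2 (neg_smul (SymmetricAlgebra.ι (R ⧸ seqIdeal r) W (f j) *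
    grSymEquiv hr f (DirectSum.of (Gr (seqIdeal r)) s (Gr.mk a ha))) _)).trans ?_
  rw [mul_comm, mul_smul]
  rfl

lemma torModelEquiv_deltaTot (x : TorGr (seqIdeal r)) :
    torModelEquiv hK hr f (deltaTot (seqIdeal r) x) = modelD e f (torModelEquiv hK hr f x) := by
  suffices (torModelEquiv hK hr f).toLinearMap ∘ₗ deltaTot (seqIdeal r) =
      (modelD e f).restrictScalars R ∘ₗ (torModelEquiv hK hr f).toLinearMap from
    LinearMap.congr_fun this x
  refine torGr_hom_ext hK hr fun s p m x => ?_
  change torModelEquiv hK hr f (deltaTot _ _) = modelD e f (torModelEquiv hK hr f _)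
  rcases p with _ | p
  · rw [deltaTot_torIncl_zero, map_zero, modelD_torModelEquiv_torIncl_zero]
  · rw [deltaTot_torIncl_succ, torModelEquiv_torIncl_deltaDeg]

end Comparison

/-! ### Exactness -/

section Components
variable {R : Type u} [CommRing R] (I : Ideal R)

lemma deltaTot_apply_zero (w : TorGr I) : deltaTot I w 0 = 0 := by
  induction w using DirectSum.induction_on with
  | zero => simp only [map_zero, DirectSum.zero_apply]
  | add x y hx hy => rw [map_add, DirectSum.add_apply, hx, hy, add_zero]
  | of t y =>
    exact (congrArg (fun z => z 0) (deltaTot_lof I t y)).trans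
      (DirectSum.of_eq_of_ne _ _ _ (Nat.succ_ne_zero t).symm)

lemma deltaTot_apply_succ (w : TorGr I) (s : ℕ) : deltaTot I w (s + 1) = delta I s (w s) := by
  induction w using DirectSum.induction_on with
  | zero => simp only [map_zero, DirectSum.zero_apply]
  | add x y hx hy => simp only [map_add, DirectSum.add_apply, hx, hy]
  | of t y =>
    refine (congrArg (fun z => z (s + 1)) (deltaTot_lof I t y)).trans ?_
    obtain rfl | hst := eq_or_ne s t
    · exact (DirectSum.of_eq_same _ _).trans (congrArg (delta I s)
        (DirectSum.of_eq_same (β := fun s => TorTot I (Gr I s)) s y).symm)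
    · exact (DirectSum.of_eq_of_ne _ _ _ (by omega)).trans ((congrArg (delta I s)
        (DirectSum.of_eq_of_ne (β := fun s => TorTot I (Gr I s)) t s y hst)).trans
          (map_zero _)).symm

lemma delta_eq_zero_iff_deltaTot {s : ℕ} {x : TorTot I (Gr I s)} :
    delta I s x = 0 ↔ deltaTot I (DirectSum.lof R ℕ (fun s => TorTot I (Gr I s)) s x) = 0 := by
  rw [deltaTot_lof]
  exact (map_eq_zero_iff _
    (DirectSum.of_injective (β := fun s => TorTot I (Gr I s)) (s + 1))).symm

lemma bijective_unitGr : Function.Bijective (unitGr I) := by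
  constructor
  · refine (injective_iff_map_eq_zero _).2 fun a ha => ?_
    obtain ⟨a, rfl⟩ := Ideal.Quotient.mk_surjective a
    replace ha : Gr.mk (a * 1) (Gr.mem_zero _) = Gr.mk 0 (zero_mem (I ^ 0)) := ha
    rw [Gr.mk_eq, mul_one, sub_zero, zero_add, pow_one] at ha
    exact Ideal.Quotient.eq_zero_iff_mem.2 ha
  · intro m
    induction m using Gr.ind with | h x hx
    refine ⟨Ideal.Quotient.mk _ x, ?_⟩
    change Gr.mk (x * 1) (Gr.mem_zero _) = _
    rw [Gr.mk_eq, mul_one, sub_self]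
    exact zero_mem _

variable {N N' : Type u} [AddCommGroup N] [Module R N] [AddCommGroup N'] [Module R N']

lemma bijective_torMap (g : N ≃ₗ[R] N') (p : ℕ) :
    Function.Bijective (torMap I g.toLinearMap p) := by
  refine Function.bijective_iff_has_inverse.2
    ⟨torMap I g.symm.toLinearMap p, fun x => ?_, fun x => ?_⟩
  · rw [← LinearMap.comp_apply, ← torMap_comp, LinearEquiv.symm_comp, torMap_id]; rfl
  · rw [← LinearMap.comp_apply, ← torMap_comp, LinearEquiv.comp_symm, torMap_id]; rfl

lemma bijective_torTotMap_unitGr : Function.Bijective (torTotMap I (unitGr I)) := by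
  have bijective_torMap_unitGr (p : ℕ) : Function.Bijective (torMap I (unitGr I) p) :=
    bijective_torMap I (LinearEquiv.ofBijective (unitGr I) (bijective_unitGr I)) p
  exact ⟨(DirectSum.lmap_injective _).2 fun p => (bijective_torMap_unitGr p).1,
    (DirectSum.lmap_surjective _).2 fun p => (bijective_torMap_unitGr p).2⟩

end Components

lemma koszulD_constr_ι_eq_zero_iff {S W : Type*} [CommRing S] [AddCommGroup W] [Module S W] {n : ℕ}
    (f : Module.Basis (Fin n) S W) {M : Type*} [AddCommGroup M] [Module (SymmetricAlgebra S W) M]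
    (e : Module.Basis (Fin n) (SymmetricAlgebra S W) M)
    {x : ExteriorAlgebra (SymmetricAlgebra S W) M} :
    koszulD (e.constr (SymmetricAlgebra S W) fun j => SymmetricAlgebra.ι S W (f j)) x = 0 ↔
      ∃ y a, x =
        koszulD (e.constr (SymmetricAlgebra S W) fun j => SymmetricAlgebra.ι S W (f j)) y +
          algebraMap (SymmetricAlgebra S W) _ (algebraMap S _ a) := by
  constructor
  · intro hx
    obtain ⟨y, c, rfl⟩ := (isRegularFamily_ι f).exists_eq_koszulD_add_algebraMap e hx
    obtain ⟨a, b, hb, rfl⟩ := exists_eq_algebraMap_add_mem_span_ι f c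
    obtain ⟨z, -, hz⟩ := exists_koszulD_eq_algebraMap
      (ξ := e.constr (SymmetricAlgebra S W) fun j => SymmetricAlgebra.ι S W (f j))
      (by rwa [Module.Basis.constr_range])
    exact ⟨y + z, a, by rw [map_add, map_add, hz, add_assoc, add_comm (algebraMap _ _ b)]⟩
  · rintro ⟨y, a, rfl⟩
    rw [map_add, koszulD_koszulD, koszulD_algebraMap, add_zero]

section Exactness
variable {R : Type u} [CommRing R] {U : Type u} [AddCommGroup U] [Module R U] {n : ℕ}
  {r : Fin n → R} {e : Module.Basis (Fin n) R U}
  {W : Type w} [AddCommGroup W] [Module (R ⧸ seqIdeal r) W]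

lemma modelD_eq_zero_iff (e : Module.Basis (Fin n) R U)
    (f : Module.Basis (Fin n) (R ⧸ seqIdeal r) W) {x : ModelKoszul (seqIdeal r) W U} :
    modelD e f x = 0 ↔ ∃ y a, x = modelD e f y +
      algebraMap (SymmetricAlgebra (R ⧸ seqIdeal r) W) _ (algebraMap (R ⧸ seqIdeal r) _ a) := by
  have koszulD_eq_zero_iff :=
    koszulD_constr_ι_eq_zero_iff f (e.baseChange (SymmetricAlgebra (R ⧸ seqIdeal r) W)) (x := x)
  exact koszulD_eq_zero_iff

variable (hK : QuasiIso (koszulSeqAug r e)) (hr : IsRegularFamily r)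
  (f : Module.Basis (Fin n) (R ⧸ seqIdeal r) W)
include hK hr f

lemma deltaTot_eq_zero_iff {x : TorGr (seqIdeal r)} :
    deltaTot (seqIdeal r) x = 0 ↔ ∃ w a, x = deltaTot (seqIdeal r) w +
      DirectSum.lof R ℕ (fun s => TorTot (seqIdeal r) (Gr (seqIdeal r) s)) 0
        (torTotMap (seqIdeal r) (unitGr (seqIdeal r)) (eta (seqIdeal r) a)) := by
  rw [← (torModelEquiv hK hr f).map_eq_zero_iff, torModelEquiv_deltaTot, modelD_eq_zero_iff,
    (torModelEquiv hK hr f).surjective.exists]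
  simp only [← (torModelEquiv hK hr f).injective.eq_iff (a := x), map_add, torModelEquiv_deltaTot,
    torModelEquiv_eta]

theorem delta_exact (s : ℕ) :
    Function.Exact (delta (seqIdeal r) s) (delta (seqIdeal r) (s + 1)) := by
  intro y
  rw [delta_eq_zero_iff_deltaTot, deltaTot_eq_zero_iff hK hr f]
  constructor
  · rintro ⟨w, a, hy⟩
    refine ⟨w s, ?_⟩
    have hy_apply := congrArg (fun z => z (s + 1)) hy
    rw [DirectSum.add_apply, deltaTot_apply_succ] at hy_apply
    refine Eq.trans ?_ (hy_apply.symm.trans (DirectSum.of_eq_same _ _))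
    exact (add_zero _).symm.trans (congrArg (delta (seqIdeal r) s (w s) + ·)
      (DirectSum.of_eq_of_ne (β := fun s => TorTot (seqIdeal r) (Gr (seqIdeal r) s))
        0 (s + 1) _ s.succ_ne_zero).symm)
  · rintro ⟨x, rfl⟩
    refine ⟨DirectSum.lof R ℕ _ s x, 0, ?_⟩
    rw [deltaTot_lof, map_zero, map_zero, map_zero, add_zero]

theorem eta_injective : Function.Injective (eta (seqIdeal r)) := by
  refine (injective_iff_map_eq_zero _).2 fun a ha => ?_
  have model_eta := torModelEquiv_eta hK hr f a
  rw [ha, map_zero, map_zero, map_zero] at model_eta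
  exact (SymmetricAlgebra.algebraMap_eq_zero_iff _ a).1
    ((ExteriorAlgebra.algebraMap_eq_zero_iff _ _).1 model_eta.symm)

theorem eta_exact : Function.Exact (eta (seqIdeal r)) (deltaZero (seqIdeal r)) := by
  intro x
  rw [deltaZero, LinearMap.comp_apply, delta_eq_zero_iff_deltaTot, deltaTot_eq_zero_iff hK hr f]
  constructor
  · rintro ⟨w, a, hx⟩
    refine ⟨a, (bijective_torTotMap_unitGr _).1 ?_⟩
    have hx_apply := congrArg (fun z => z 0) hx
    rw [DirectSum.add_apply, deltaTot_apply_zero] at hx_apply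
    have lof_apply (y) := DirectSum.of_eq_same
      (β := fun s => TorTot (seqIdeal r) (Gr (seqIdeal r) s)) 0 y
    exact (lof_apply _).symm.trans
      ((zero_add _).symm.trans (hx_apply.symm.trans (lof_apply _)))
  · rintro ⟨a, rfl⟩
    exact ⟨0, a, (zero_add _).symm.trans (congrArg (· + _) (map_zero _).symm)⟩

theorem deltaZero_exact : Function.Exact (deltaZero (seqIdeal r)) (delta (seqIdeal r) 1) := by
  intro y
  rw [delta_exact hK hr f 0 y, deltaZero, LinearMap.coe_comp,
    (bijective_torTotMap_unitGr _).2.range_comp]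

end Exactness

end KoszulTor

theorem mainTheorem3 {R : Type u} [CommRing R] {n : ℕ} (r : Fin n → R)
    (hr : RingTheory.Sequence.IsWeaklyRegular R (List.ofFn r))
    {U : Type u} [AddCommGroup U] [Module R U] (e : Module.Basis (Fin n) R U)
    {W : Type w} [AddCommGroup W] [Module (R ⧸ seqIdeal r) W]
    (f : Module.Basis (Fin n) (R ⧸ seqIdeal r) W) :
    ∃ (hK : QuasiIso (koszulSeqAug r e))
      (φ : (⨁ s, Gr (seqIdeal r) s) ≃ₐ[R] SymmetricAlgebra (R ⧸ seqIdeal r) W)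
      (ψ : TorGr (seqIdeal r) ≃ₗ[R] ModelKoszul (seqIdeal r) W U),
      -- `φ` is the graded algebra isomorphism sending the class of `r_j` in `I/I^2` to `-f_j`
      (∀ (j : Fin n) (hj : r j ∈ seqIdeal r ^ 1),
        φ (DirectSum.of (Gr (seqIdeal r)) 1 (Gr.mk (r j) hj)) =
          -SymmetricAlgebra.ι (R ⧸ seqIdeal r) W (f j)) ∧
      (∀ s, φ '' Set.range (DirectSum.of (Gr (seqIdeal r)) s) = symPiece (seqIdeal r) W s) ∧
      -- `ψ` is the bigraded isomorphism obtained from `φ` and from the Koszul resolution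
      (∀ (s p : ℕ) (m : Gr (seqIdeal r) s) (v : Fin p → U),
        ψ (DirectSum.lof R ℕ (fun s => TorTot (seqIdeal r) (Gr (seqIdeal r) s)) s
            (DirectSum.lof R ℕ (fun p => TorQ (seqIdeal r) (Gr (seqIdeal r) s) p) p
              (torMap (seqIdeal r) (Gr.act m) p
                (koszulClass r e hK p (exteriorPower.ιMulti R p v))))) =
          φ (DirectSum.of (Gr (seqIdeal r)) s m) •
            ExteriorAlgebra.ιMulti (SymmetricAlgebra (R ⧸ seqIdeal r) W) p
              (fun i => 1 ⊗ₜ[R] v i)) ∧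
      (∀ s p : ℕ,
        (LinearMap.range (DirectSum.lof R ℕ (fun s => TorTot (seqIdeal r) (Gr (seqIdeal r) s)) s ∘ₗ
          DirectSum.lof R ℕ (fun p => TorQ (seqIdeal r) (Gr (seqIdeal r) s) p) p)).map
            (ψ : TorGr (seqIdeal r) →ₗ[R] ModelKoszul (seqIdeal r) W U) =
          modelPiece (seqIdeal r) W U s p) ∧
      -- `δ^*` corresponds to the Koszul differential, and `η` to the inclusion of `R/I`
      (∀ x : TorGr (seqIdeal r), ψ (deltaTot (seqIdeal r) x) = modelD e f (ψ x)) ∧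
      (∀ a : R ⧸ seqIdeal r,
        ψ (DirectSum.lof R ℕ (fun s => TorTot (seqIdeal r) (Gr (seqIdeal r) s)) 0
            (torTotMap (seqIdeal r) (unitGr (seqIdeal r)) (eta (seqIdeal r) a))) =
          algebraMap (SymmetricAlgebra (R ⧸ seqIdeal r) W) _ (algebraMap (R ⧸ seqIdeal r) _ a)) ∧
      -- exactness
      Function.Injective (eta (seqIdeal r)) ∧
      Function.Exact (eta (seqIdeal r)) (deltaZero (seqIdeal r)) ∧
      Function.Exact (deltaZero (seqIdeal r)) (delta (seqIdeal r) 1) ∧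
      ∀ s : ℕ, Function.Exact (delta (seqIdeal r) (s + 1)) (delta (seqIdeal r) (s + 2)) := by
  have hr' := IsRegularFamily.of_isWeaklyRegular hr
  have hK := hr'.quasiIso_koszulSeqAug e
  exact ⟨hK, grSymEquiv hr' f, torModelEquiv hK hr' f, grSymEquiv_of_one hr' f,
    image_grSymEquiv hr' f, fun _ _ m v => torModelEquiv_torIncl_ιMulti hK hr' f m v,
    torModelEquiv_map_range hK hr' f, torModelEquiv_deltaTot hK hr' f, torModelEquiv_eta hK hr' f,
    eta_injective hK hr' f, eta_exact hK hr' f, deltaZero_exact hK hr' f,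
    fun s => delta_exact hK hr' f (s + 1)⟩
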